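/- **Setting.** Let $N$ be a lattice (a free abelian group of finite rank) with dual lattice $M$, torus $N_{\mathbb C^*}=N\otimes\mathbb C^*$ with its complex conjugation, and logarithmic map $\log:N_{\mathbb C^*}\to N_{\mathbb R}=N\otimes\mathbb R$, $n\otimes z\mapsto n\otimes\log|z|$. An *oriented real curve* $f:S\dashrightarrow N_{\mathbb C^*}$ consists of a compact connected Riemann surface $\mathbb CC$ with an antiholomorphic involution $\sigma$ such that the complement of the fixed locus of $\sigma$ has exactly two connected components $S$ and $\overline S=\sigma(S)$, one of which, $S$, is chosen, and of a rational map $f:\mathbb CC\dashrightarrow N_{\mathbb C^*}$ (holomorphic outside a finite set, with every monomial $\chi^m\circ f$, $m\in M$, meromorphic) that commutes with the conjugations. For $p\in\mathbb CC$ let $n_p\in N$ be the vector with $\mathrm{ord}_p(\chi^m\circ f)=\langle m,n_p\rangle$ for all $m\in M$; the curve meets the toric boundary at $p$ if $n_p\neq0$. The curve has degree $\Delta=(n_k)_k$, a finite family in $N$, if there are distinct points $p_k$ with $n_{p_k}=n_k$ and $n_p=0$ at all other points $p$ (zero vectors are allowed in $\Delta$). It has *only real intersection points* if $n_p\ne0$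 implies $\sigma(p)=p$. For an integral $2$-form $\varpi\in\Lambda^2M$ on $N$, the logarithmic area is $\mathcal A_{\log}(S,\varpi)=\int_S(\log\circ f)^*\varpi$. If the curve has only real intersection points, its *quantum index* $h(S)$ is the unique class in $\Lambda^2N$ with $\mathcal A_{\log}(S,\varpi)=\frac{\pi^2}{2}\langle h(S),\varpi\rangle$ for all $\varpi\in\Lambda^2 M$. **Proposition.** Let $N',N$ be lattices, let $\alpha:N'_{\mathbb C^*}\to N_{\mathbb C^*}$ be the monomial map associated to an integer linear map $A:N'\to N$, and let $f:S\dashrightarrow N'_{\mathbb C^*}$ be an oriented real curve of degree $\Delta'$. Then $\alpha\circ f:S\dashrightarrow N_{\mathbb C^*}$, denoted $\alpha(S)$, is an oriented real curve of degree $A(\Delta')$. Moreover: - If $f$ has only real intersection points, then the quantum indices $h(S)\in\Lambda^2N'$ and $h(\alpha(S))\in\Lambda^2N$ exist and are unique, and $$h(\alpha(S))=(\Lambda^2A)(h(S))\in\Lambda^2N.$$ - In general, in particular in the presence of non-real intersection points, for every $2$-form $\varpi\in\Lambda^2M$ the integrals defining $\mathcal A_{\log}(\alpha(S),\varpi)$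 and $\mathcal A_{\log}(S,A^*\varpi)$ converge absolutely, and $$\mathcal A_{\log}(\alpha(S),\varpi)=\mathcal A_{\log}(S,A^*\varpi).$$ -/

import Mathlib

open scoped Manifold ContDiff TensorProduct

noncomputable section

namespace QuantumIndex

/-! ### The torus of a lattice -/

/-- The complex torus `N ⊗ ℂ*` of a lattice `N` (the group law is written additively). -/
abbrev Torus (N : Type*) [AddCommGroup N] : Type _ := N ⊗[ℤ] Additive ℂˣ

/-- The monomial map `N' ⊗ ℂ* → N ⊗ ℂ*` of an integer linear map `A : N' → N`. -/
def monomialMap {N' N : Type*} [AddCommGroup N'] [AddCommGroup N] (A : N' →ₗ[ℤ] N)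
    (t : Torus N') : Torus N :=
  A.rTensor (Additive ℂˣ) t

/-- The homomorphism `z ↦ log |z|` from `ℂ*` to `ℝ`. -/
def logAbs : Additive ℂˣ →+ ℝ where
  toFun z := Real.log ‖(z.toMul : ℂ)‖
  map_zero' := by simp
  map_add' z w := by simp [Real.log_mul]

section Lattice

variable {N : Type*} [AddCommGroup N]

/-- The value at a point of the torus of the monomial with exponent `m` in the dual lattice:
`n ⊗ z ↦ z ^ m n`. -/
def monomial (m : Module.Dual ℤ N) (t : Torus N) : ℂ :=
  ((TensorProduct.lid ℤ (Additive ℂˣ) (m.rTensor (Additive ℂˣ) t)).toMul : ℂˣ)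

/-- Complex conjugation of the torus: `n ⊗ z ↦ n ⊗ conj z`. -/
def torusConj (t : Torus N) : Torus N :=
  (MonoidHom.toAdditive (Units.map (starRingEnd ℂ : ℂ →* ℂ))).toIntLinearMap.lTensor N t

/-- The logarithmic map `N ⊗ ℂ* → N_ℝ = N ⊗ ℝ`: `n ⊗ z ↦ n ⊗ log |z|`. -/
def logMap (t : Torus N) : N ⊗[ℤ] ℝ :=
  logAbs.toIntLinearMap.lTensor N t

/-- The real linear coordinate on `N_ℝ` defined by `m` in the dual lattice. -/
def realCoord (m : Module.Dual ℤ N) (v : N ⊗[ℤ] ℝ) : ℝ :=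
  TensorProduct.lid ℤ ℝ (m.rTensor ℝ v)

/-- The pullback by `F : ℂ → N_ℝ` of the constant `2`-form `ϖ`, evaluated at `z` on the positively
oriented frame `(∂/∂x, ∂/∂y)`. In the linear coordinates `x_i` of a basis `b` of `N` one has
`ϖ = ∑_{i < j} ϖ(b_i, b_j) dx_i ∧ dx_j`. -/
def pullbackDensity [Module.Free ℤ N] [Module.Finite ℤ N]
    (ϖ : N [⋀^Fin 2]→ₗ[ℤ] ℤ) (F : ℂ → N ⊗[ℤ] ℝ) (z : ℂ) : ℝ :=
  let b := Module.Free.chooseBasis ℤ N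
  ∑ i, ∑ j, (ϖ ![b i, b j] : ℝ) *
    (fderiv ℝ (fun w => realCoord (b.coord i) (F w)) z 1 *
      fderiv ℝ (fun w => realCoord (b.coord j) (F w)) z Complex.I)

end Lattice

/-! ### Oriented real curves

`X` is a compact connected Riemann surface. A rational map `X ⇢ N ⊗ ℂ*` is given by a function on
`X` whose values at finitely many points are irrelevant. -/

section Curve

variable {X : Type*} [TopologicalSpace X] [ChartedSpace ℂ X]

/-- `σ` is an antiholomorphic involution. -/
structure IsRealStructure (σ : X → X) : Prop where
  continuous : Continuous σ
  involutive : Function.Involutive σ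
  antiholomorphic : ∀ x, DifferentiableAt ℂ
    (fun z => starRingEnd ℂ (chartAt ℂ (σ x) (σ ((chartAt ℂ x).symm z)))) (chartAt ℂ x x)

/-- The complement of the real locus of `σ` has exactly the two connected components `S` and
`σ(S)`. -/
structure IsHalf (σ : X → X) (S : Set X) : Prop where
  isOpen : IsOpen S
  isConnected : IsConnected S
  disjoint : Disjoint S (σ '' S)
  union_eq : S ∪ σ '' S = {x | σ x ≠ x}

variable {N : Type*} [AddCommGroup N]

/-- The monomial `m` along `f`, read in the preferred chart at `x`. -/
def localMonomial (f : X → Torus N) (m : Module.Dual ℤ N) (x : X) (z : ℂ) : ℂ :=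
  monomial m (f ((chartAt ℂ x).symm z))

/-- `f` is an oriented real curve: `σ` is a real structure on the Riemann surface `X`, of type I
with chosen half `S`, and `f : X ⇢ N ⊗ ℂ*` is a rational map that commutes with the
conjugations. -/
structure IsOrientedRealCurve (σ : X → X) (S : Set X) (f : X → Torus N) : Prop where
  isRealStructure : IsRealStructure σ
  isHalf : IsHalf σ S
  meromorphic : ∀ m x, MeromorphicAt (localMonomial f m x) (chartAt ℂ x x)
  exists_punctures : ∃ P : Set X, P.Finite ∧ (∀ x, σ x ∈ P ↔ x ∈ P) ∧
    (∀ m, ∀ x ∉ P, MDifferentiableAt 𝓘(ℂ) 𝓘(ℂ) (fun y => monomial m (f y)) x) ∧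
    ∀ x ∉ P, f (σ x) = torusConj (f x)

/-- `n` is the cocharacter of `f` at `x`: every monomial `m` has order `⟨m, n⟩` at `x`. The
curve meets the toric boundary at `x` exactly if the cocharacter there is non-zero. -/
def IsCocharacterAt (f : X → Torus N) (x : X) (n : N) : Prop :=
  ∀ m : Module.Dual ℤ N,
    meromorphicOrderAt (localMonomial f m x) (chartAt ℂ x x) = ((m n : ℤ) : WithTop ℤ)

/-- `f` has degree `Δ`: the cocharacters at suitable distinct points of the curve are the members
of the family `Δ`, and every other point is mapped to the torus. Zero vectors are allowed
in `Δ`; their points are also mapped to the torus. -/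
def HasDegree {ι : Type*} (f : X → Torus N) (Δ : ι → N) : Prop :=
  ∃ p : ι ↪ X, (∀ k, IsCocharacterAt f (p k) (Δ k)) ∧
    ∀ x ∉ Set.range p, IsCocharacterAt f x 0

/-- All intersection points with the toric boundary are real. -/
def HasOnlyRealIntersections (σ : X → X) (f : X → Torus N) : Prop :=
  ∀ x, ¬ IsCocharacterAt f x 0 → σ x = x

/-! ### Logarithmic area and quantum index -/

variable (X) in
/-- A partition of `X` into finitely many Borel sets, each of them contained in the domain of a
chart. -/
structure ChartPartition where
  size : ℕ
  chart : Fin size → OpenPartialHomeomorph X ℂ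
  piece : Fin size → Set X
  chart_mem : ∀ i, chart i ∈ atlas ℂ X
  measurable : ∀ i, @MeasurableSet X (borel X) (piece i)
  subset : ∀ i, piece i ⊆ (chart i).source
  disjoint : Pairwise fun i j => Disjoint (piece i) (piece j)
  covers : ⋃ i, piece i = Set.univ

theorem nonempty_chartPartition [CompactSpace X] : Nonempty (ChartPartition X) := by
  obtain ⟨t, ht⟩ := isCompact_univ.elim_finite_subcover
    (fun x : X => (chartAt ℂ x).source) (fun x => (chartAt ℂ x).open_source)
    (fun x _ => Set.mem_iUnion.2 ⟨x, mem_chart_source ℂ x⟩)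
  let e := t.equivFin.symm
  let s : Fin t.card → Set X := fun i => (chartAt ℂ (e i : X)).source
  refine ⟨⟨t.card, fun i => chartAt ℂ (e i : X), fun i => s i \ ⋃ j < i, s j,
    fun i => chart_mem_atlas ℂ _, fun i => ?_, fun i => Set.sdiff_subset, ?_, ?_⟩⟩
  · let _ : MeasurableSpace X := borel X
    have : BorelSpace X := ⟨rfl⟩
    refine MeasurableSet.diff (chartAt ℂ _).open_source.measurableSet ?_
    exact (isOpen_biUnion fun j _ => (chartAt ℂ _).open_source).measurableSet
  · have key : ∀ i j, i < j →
        Disjoint (s i \ ⋃ k < i, s k) (s j \ ⋃ k < j, s k) := fun i j hij =>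
      Set.disjoint_left.2 fun x hi hj => hj.2 (Set.mem_biUnion hij hi.1)
    intro i j hij
    rcases lt_or_gt_of_ne hij with h | h
    · exact key i j h
    · exact (key j i h).symm
  · classical
    refine Set.eq_univ_of_forall fun x => ?_
    obtain ⟨y, hy, hx⟩ := Set.mem_iUnion₂.1 (ht (Set.mem_univ x))
    have hne : ∃ i, x ∈ s i := ⟨e.symm ⟨y, hy⟩, by simpa [s] using hx⟩
    obtain ⟨i, hi, hmin⟩ := WellFounded.has_min (wellFounded_lt (α := Fin t.card))
      {i | x ∈ s i} hne
    refine Set.mem_iUnion.2 ⟨i, hi, fun h => ?_⟩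
    obtain ⟨j, hj, hxj⟩ := Set.mem_iUnion₂.1 h
    exact hmin j hxj hj

variable [Module.Free ℤ N] [Module.Finite ℤ N]

/-- The integral over `S`, with its complex orientation, of the `2`-form `(log ∘ f)^* ϖ` converges
absolutely and equals `a`. The integral is computed piece by piece in charts, and the value is the
same for all decompositions. -/
def HasLogArea (S : Set X) (f : X → Torus N) (ϖ : N [⋀^Fin 2]→ₗ[ℤ] ℤ) (a : ℝ) : Prop :=
  ∀ P : ChartPartition X,
    (∀ i, MeasureTheory.IntegrableOn
      (pullbackDensity ϖ fun z => logMap (f ((P.chart i).symm z)))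
      (P.chart i '' (P.piece i ∩ S))) ∧
    ∑ i, ∫ z in P.chart i '' (P.piece i ∩ S),
      pullbackDensity ϖ (fun z => logMap (f ((P.chart i).symm z))) z = a

theorem HasLogArea.unique [CompactSpace X] {S : Set X} {f : X → Torus N}
    {ϖ : N [⋀^Fin 2]→ₗ[ℤ] ℤ} {a a' : ℝ} (h : HasLogArea S f ϖ a) (h' : HasLogArea S f ϖ a') :
    a = a' := by
  obtain ⟨P⟩ := nonempty_chartPartition (X := X)
  exact (h P).2.symm.trans (h' P).2

/-- The logarithmic area `∫_S (log ∘ f)^* ϖ`. -/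
def logArea (S : Set X) (f : X → Torus N) (ϖ : N [⋀^Fin 2]→ₗ[ℤ] ℤ) : ℝ :=
  Classical.epsilon (HasLogArea S f ϖ)

/-- `h` computes the logarithmic area of `S` for every `2`-form `ϖ`, as `(π² / 2) ⟨h, ϖ⟩`. -/
def IsQuantumIndex (S : Set X) (f : X → Torus N) (h : ⋀[ℤ]^2 N) : Prop :=
  ∀ ϖ : N [⋀^Fin 2]→ₗ[ℤ] ℤ,
    logArea S f ϖ = Real.pi ^ 2 / 2 * (exteriorPower.alternatingMapLinearEquiv ϖ h : ℤ)

/-- The quantum index `h(S)`: the class in `Λ² N` that computes the logarithmic areas. -/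
def quantumIndex (S : Set X) (f : X → Torus N) : ⋀[ℤ]^2 N :=
  Classical.epsilon (IsQuantumIndex S f)

end Curve

end QuantumIndex

end

/-!
Since `ϖ` is a combination of the forms `b_i^* ∧ b_j^*`, everything reduces to the integrals over
`S` of `d log|x| ∧ d log|y|` for pairs of monomials `x`, `y` along the curve. These converge
absolutely, because the density is `O(1 / |z - z₀|)` at a zero or pole `z₀`. Pulling back a
constant form by a linear map commutes with pulling it back by `log ∘ f`, which gives the
invariance of the area.

If all the intersection points are real, then `x` and `y` are real functions without zeros and
poles in `S`, and the quantum index exists as soon as the integral is a multiple of `π² / 2` for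
each pair. This is clear if `x` is constant. Otherwise `x` maps the part of `S` over the upper
half plane to it as a branched cover. Take `w = log x` as a coordinate on the strip `0 < Im w <
π`, and let `F` be the logarithm of the product of the values of `y` on the fiber over `w`. Then
`F` is holomorphic, and the integral is, up to sign, that of `Im F'` over the strip. Integrating
along horizontal lines first, it is determined by the behaviour of `Im F` at the two ends, where
`x` has its zeros and poles. These are real, and the real local forms of `x` and `y` there show
that `Im F` tends at each end to an affine function of `Im w`, determined modulo `π` by the orders
and the signs of the leading coefficients. The part of `S` over the lower half plane is treated by
passing from `x` to `-x`, and the sum of the two contributions is a multiple of `π² / 2`.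
-/

noncomputable section

namespace QuantumIndex

open Set Filter Topology MeasureTheory

variable {X : Type*} [TopologicalSpace X] [ChartedSpace ℂ X]

section PuncturedNeighborhoods

theorem map_nhdsNE_of_mem_source {Y Z : Type*} [TopologicalSpace Y] [TopologicalSpace Z]
    (e : OpenPartialHomeomorph Y Z) {y : Y} (hy : y ∈ e.source) :
    map e (𝓝[≠] y) = 𝓝[≠] (e y) :=
  OpenPartialHomeomorph.IsImage.map_nhdsWithin_eq
    (fun _ hq => not_congr (e.injOn.eq_iff hq hy)) hy

theorem tendsto_chartAt_nhdsNE (p : X) :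
    Tendsto (chartAt ℂ p) (𝓝[≠] p) (𝓝[≠] (chartAt ℂ p p)) :=
  (map_nhdsNE_of_mem_source _ (mem_chart_source ℂ p)).le

theorem tendsto_chartAt_symm_nhdsNE (p : X) :
    Tendsto (chartAt ℂ p).symm (𝓝[≠] (chartAt ℂ p p)) (𝓝[≠] p) := by
  simpa [Tendsto] using (map_nhdsNE_of_mem_source (chartAt ℂ p).symm (mem_chart_target ℂ p)).le

theorem eventually_nhdsNE_of_chartAt {p : X} {Q : X → Prop}
    (h : ∀ᶠ z in 𝓝[≠] (chartAt ℂ p p), Q ((chartAt ℂ p).symm z)) : ∀ᶠ q in 𝓝[≠] p, Q q := by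
  filter_upwards [(tendsto_chartAt_nhdsNE p).eventually h,
    eventually_nhdsWithin_of_eventually_nhds (chart_source_mem_nhds ℂ p)] with q hq hs
  rwa [(chartAt ℂ p).left_inv hs] at hq

theorem nhdsNE_neBot (p : X) : (𝓝[≠] p).NeBot :=
  (tendsto_chartAt_symm_nhdsNE p).neBot

theorem finite_of_eventually_nhdsNE {Y : Type*} [TopologicalSpace Y] [CompactSpace Y] {s : Set Y}
    (h : ∀ p, ∀ᶠ q in 𝓝[≠] p, q ∉ s) : s.Finite := by
  have hs : sᶜ ∈ codiscrete Y := mem_codiscreteWithin_iff_forall_mem_nhdsNE.2 fun p _ => by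
    simpa [Filter.Eventually, compl_def] using h p
  simpa using cofinite_le_codiscrete hs

theorem eventually_nhdsNE_of_finite {Y : Type*} [TopologicalSpace Y] [T1Space Y] {s : Set Y}
    (hs : s.Finite) (p : Y) : ∀ᶠ q in 𝓝[≠] p, q ∉ s := by
  simpa [Filter.Eventually, compl_def] using
    mem_codiscreteWithin_iff_forall_mem_nhdsNE.1 hs.compl_mem_codiscrete p
      (mem_univ p)

end PuncturedNeighborhoods

section Meromorphic

/-- `x` is holomorphic and does not vanish at `p`. -/
def RegularAt (x : X → ℂ) (p : X) : Prop :=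
  MDifferentiableAt 𝓘(ℂ) 𝓘(ℂ) x p ∧ x p ≠ 0

/-- The expression of `x` in the preferred chart at `p`. -/
def chartRep (x : X → ℂ) (p : X) (z : ℂ) : ℂ := x ((chartAt ℂ p).symm z)

/-- The order of `x` at `p`. As for `meromorphicOrderAt`, it is `0` where `x` is not meromorphic and
`⊤` where `x` vanishes identically nearby. -/
def ordAt (x : X → ℂ) (p : X) : WithTop ℤ :=
  meromorphicOrderAt (chartRep x p) (chartAt ℂ p p)

/-- `x` is meromorphic at `p` and does not vanish identically near `p`; the value of `x` at `p` is
irrelevant. -/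
structure HasFiniteOrderAt (x : X → ℂ) (p : X) : Prop where
  meromorphicAt : MeromorphicAt (chartRep x p) (chartAt ℂ p p)
  ordAt_ne_top : ordAt x p ≠ ⊤

/-- A meromorphic function on `X`, not vanishing identically near any point, whose values are the
continuous ones at removable singularities and `0` at poles. -/
structure IsNormalMeromorphic (x : X → ℂ) : Prop where
  normalForm : ∀ p, MeromorphicNFAt (chartRep x p) (chartAt ℂ p p)
  ordAt_ne_top : ∀ p, ordAt x p ≠ ⊤

theorem chartRep_self (x : X → ℂ) (p : X) : chartRep x p (chartAt ℂ p p) = x p := by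
  simp [chartRep]

theorem hasFiniteOrderAt_of_ne_zero {x : X → ℂ} {p : X}
    (hx : MeromorphicAt (chartRep x p) (chartAt ℂ p p)) (h0 : ∀ q, x q ≠ 0) :
    HasFiniteOrderAt x p :=
  ⟨hx, (meromorphicOrderAt_ne_top_iff_eventually_ne_zero hx).2 (.of_forall fun _ => h0 _)⟩

section Atlas

variable [IsManifold 𝓘(ℂ) 1 X]

theorem mdifferentiableAt_iff_of_mem_atlas {e : OpenPartialHomeomorph X ℂ} (he : e ∈ atlas ℂ X)
    {x : X → ℂ} {q : X} (hq : q ∈ e.source) :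
    MDifferentiableAt 𝓘(ℂ) 𝓘(ℂ) x q ↔ DifferentiableAt ℂ (fun z => x (e.symm z)) (e q) := by
  rw [← mdifferentiableAt_iff_differentiableAt]
  constructor
  · intro h
    refine MDifferentiableAt.comp (e q) (I' := 𝓘(ℂ)) (g := x) (f := e.symm) ?_
      (mdifferentiableAt_atlas_symm he (e.map_source hq))
    rwa [e.left_inv hq]
  · intro h
    refine (h.comp q (mdifferentiableAt_atlas he hq)).congr_of_eventuallyEq ?_
    filter_upwards [e.open_source.mem_nhds hq] with q' hq'
    simp [e.left_inv hq']

namespace HasFiniteOrderAt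

variable {x : X → ℂ} {p : X} (hx : HasFiniteOrderAt x p)
include hx

theorem eventually_regularAt : ∀ᶠ q in 𝓝[≠] p, RegularAt x q := by
  refine eventually_nhdsNE_of_chartAt ?_
  filter_upwards [eventually_nhdsWithin_of_eventually_nhds (chart_target_mem_nhds ℂ p),
    hx.meromorphicAt.eventually_analyticAt,
    (meromorphicOrderAt_ne_top_iff_eventually_ne_zero hx.meromorphicAt).1 hx.ordAt_ne_top]
    with z hz ha h0
  refine ⟨?_, h0⟩
  rw [mdifferentiableAt_iff_of_mem_atlas (chart_mem_atlas ℂ p) ((chartAt ℂ p).map_target hz),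
    (chartAt ℂ p).right_inv hz]
  exact ha.differentiableAt

end HasFiniteOrderAt

theorem finite_not_regularAt [CompactSpace X] {x : X → ℂ} (hx : ∀ p, HasFiniteOrderAt x p) :
    {p | ¬ RegularAt x p}.Finite :=
  finite_of_eventually_nhdsNE fun p => by simpa using (hx p).eventually_regularAt

end Atlas

namespace IsNormalMeromorphic

variable {x : X → ℂ} (hx : IsNormalMeromorphic x)
include hx

theorem hasFiniteOrderAt (p : X) : HasFiniteOrderAt x p :=
  ⟨(hx.normalForm p).meromorphicAt, hx.ordAt_ne_top p⟩

theorem ordAt_nonneg_iff {p : X} :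
    0 ≤ ordAt x p ↔ AnalyticAt ℂ (chartRep x p) (chartAt ℂ p p) :=
  (hx.normalForm p).meromorphicOrderAt_nonneg_iff_analyticAt

theorem ordAt_eq_zero_iff {p : X} : ordAt x p = 0 ↔ x p ≠ 0 := by
  rw [← chartRep_self x p]
  exact (hx.normalForm p).meromorphicOrderAt_eq_zero_iff

theorem neg : IsNormalMeromorphic (-x) := by
  have hrep (p : X) : chartRep (-x) p = (fun _ => (-1 : ℂ)) * chartRep x p := by
    ext z; simp [chartRep]
  constructor
  · intro p
    rw [hrep]
    exact (meromorphicNFAt_mul_iff_right analyticAt_const (by simp)).2 (hx.normalForm p)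
  · intro p
    rw [ordAt, hrep, meromorphicOrderAt_mul_of_ne_zero analyticAt_const (by simp)]
    exact hx.ordAt_ne_top p

theorem inv : IsNormalMeromorphic x⁻¹ := by
  have hrep (p : X) : chartRep x⁻¹ p = (chartRep x p)⁻¹ := by
    ext z; simp [chartRep]
  constructor
  · intro p
    rw [hrep]
    exact (hx.normalForm p).inv
  · intro p
    rw [ordAt, hrep, meromorphicOrderAt_inv]
    exact mt LinearOrderedAddCommGroupWithTop.neg_eq_top.1 (hx.ordAt_ne_top p)

variable [IsManifold 𝓘(ℂ) 1 X]

theorem mdifferentiableAt {p : X} (h : 0 ≤ ordAt x p) : MDifferentiableAt 𝓘(ℂ) 𝓘(ℂ) x p :=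
  (mdifferentiableAt_iff_of_mem_atlas (chart_mem_atlas ℂ p) (mem_chart_source ℂ p)).2
    (hx.ordAt_nonneg_iff.1 h).differentiableAt

theorem regularAt_iff {p : X} : RegularAt x p ↔ x p ≠ 0 :=
  ⟨fun h => h.2, fun h => ⟨hx.mdifferentiableAt (hx.ordAt_eq_zero_iff.2 h).ge, h⟩⟩

end IsNormalMeromorphic

section Normalize

variable [IsManifold 𝓘(ℂ) 1 X]

/-- The function `x` with its values changed, at each point, to that of the normal form of the
meromorphic germ. -/
def normalize (x : X → ℂ) (p : X) : ℂ :=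
  toMeromorphicNFAt (chartRep x p) (chartAt ℂ p p) (chartAt ℂ p p)

theorem analyticAt_chartRep {x : X → ℂ} {p : X}
    (h : ∀ᶠ q in 𝓝 p, MDifferentiableAt 𝓘(ℂ) 𝓘(ℂ) x q) :
    AnalyticAt ℂ (chartRep x p) (chartAt ℂ p p) := by
  rw [Complex.analyticAt_iff_eventually_differentiableAt]
  filter_upwards [((chartAt ℂ p).eventually_nhds' _ (mem_chart_source ℂ p)).2 h,
    chart_target_mem_nhds ℂ p] with z hz ht
  have := (mdifferentiableAt_iff_of_mem_atlas (chart_mem_atlas ℂ p)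
    ((chartAt ℂ p).map_target ht)).1 hz
  rwa [(chartAt ℂ p).right_inv ht] at this

theorem normalize_eq_of_regularAt {x : X → ℂ} {p : X} (h : RegularAt x p)
    (hx : HasFiniteOrderAt x p) : normalize x p = x p := by
  have hreg : ∀ᶠ q in 𝓝 p, RegularAt x q := by
    rw [← nhdsNE_sup_pure, eventually_sup, eventually_pure]
    exact ⟨hx.eventually_regularAt, h⟩
  have ha := analyticAt_chartRep (hreg.mono fun _ hq => hq.1)
  rw [normalize, toMeromorphicNFAt_eq_self.2 ha.meromorphicNFAt, chartRep_self]

theorem finite_normalize_ne [CompactSpace X] {x : X → ℂ} (hx : ∀ p, HasFiniteOrderAt x p) :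
    {p | normalize x p ≠ x p}.Finite :=
  (finite_not_regularAt hx).subset fun p hp hreg => hp (normalize_eq_of_regularAt hreg (hx p))

variable [T1Space X] [CompactSpace X] {x : X → ℂ} (hx : ∀ p, HasFiniteOrderAt x p)
include hx

theorem chartRep_normalize (p : X) : chartRep (normalize x) p =ᶠ[𝓝 (chartAt ℂ p p)]
    toMeromorphicNFAt (chartRep x p) (chartAt ℂ p p) := by
  refine eventuallyEq_nhds_of_eventuallyEq_nhdsNE ?_ (by simp [chartRep, normalize])
  filter_upwards [(tendsto_chartAt_symm_nhdsNE p).eventually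
    (eventually_nhdsNE_of_finite (finite_normalize_ne hx) p),
    (hx p).meromorphicAt.eq_nhdsNE_toMeromorphicNFAt] with z h1 h2
  rw [← h2]
  exact not_not.1 h1

theorem ordAt_normalize (p : X) : ordAt (normalize x) p = ordAt x p := by
  rw [ordAt, meromorphicOrderAt_congr ((chartRep_normalize hx p).filter_mono
    nhdsWithin_le_nhds), (hx p).meromorphicAt.meromorphicOrderAt_toMeromorphicNFAt, ordAt]

theorem isNormalMeromorphic_normalize : IsNormalMeromorphic (normalize x) where
  normalForm p :=
    (meromorphicNFAt_congr (chartRep_normalize hx p)).2 meromorphicNFAt_toMeromorphicNFAt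
  ordAt_ne_top p := ordAt_normalize hx p ▸ (hx p).ordAt_ne_top

end Normalize

end Meromorphic

section WedgeDensity

/-- The coefficient of `du ∧ dv` with respect to `dx ∧ dy`. -/
def wedgeDensity (u v : ℂ → ℝ) (z : ℂ) : ℝ :=
  fderiv ℝ u z 1 * fderiv ℝ v z Complex.I - fderiv ℝ u z Complex.I * fderiv ℝ v z 1

theorem measurable_wedgeDensity (u v : ℂ → ℝ) : Measurable (wedgeDensity u v) := by
  unfold wedgeDensity
  exact ((measurable_fderiv_apply_const ℝ u 1).mul (measurable_fderiv_apply_const ℝ v _)).sub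
    ((measurable_fderiv_apply_const ℝ u _).mul (measurable_fderiv_apply_const ℝ v 1))

theorem wedgeDensity_congr {u v u' v' : ℂ → ℝ} {z : ℂ} (hu : u =ᶠ[𝓝 z] u') (hv : v =ᶠ[𝓝 z] v') :
    wedgeDensity u v z = wedgeDensity u' v' z := by
  simp [wedgeDensity, hu.fderiv_eq, hv.fderiv_eq]

theorem fderiv_comp_of_hasDerivAt {u : ℂ → ℝ} {φ : ℂ → ℂ} {c z : ℂ} (hφ : HasDerivAt φ c z)
    (hu : DifferentiableAt ℝ u (φ z)) (t : ℂ) :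
    fderiv ℝ (u ∘ φ) z t =
      (t * c).re * fderiv ℝ u (φ z) 1 + (t * c).im * fderiv ℝ u (φ z) Complex.I := by
  rw [(hu.hasFDerivAt.comp z (hφ.hasFDerivAt.restrictScalars ℝ)).fderiv]
  have h : t * c = (t * c).re • (1 : ℂ) + (t * c).im • Complex.I := by
    apply Complex.ext <;> simp
  simp only [ContinuousLinearMap.comp_apply, ContinuousLinearMap.coe_restrictScalars',
    ContinuousLinearMap.toSpanSingleton_apply, smul_eq_mul]
  conv_lhs => rw [h]
  rw [map_add, map_smul, map_smul, smul_eq_mul, smul_eq_mul]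

theorem wedgeDensity_comp {u v : ℂ → ℝ} {φ : ℂ → ℂ} {c z : ℂ} (hφ : HasDerivAt φ c z)
    (hu : DifferentiableAt ℝ u (φ z)) (hv : DifferentiableAt ℝ v (φ z)) :
    wedgeDensity (u ∘ φ) (v ∘ φ) z = ‖c‖ ^ 2 * wedgeDensity u v (φ z) := by
  simp only [wedgeDensity, fderiv_comp_of_hasDerivAt hφ hu, fderiv_comp_of_hasDerivAt hφ hv]
  rw [← Complex.normSq_eq_norm_sq, Complex.normSq_apply]
  simp
  ring

theorem det_toSpanSingleton_restrictScalars (c : ℂ) :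
    ((ContinuousLinearMap.toSpanSingleton ℂ c).restrictScalars ℝ).det = ‖c‖ ^ 2 := by
  simp [ContinuousLinearMap.det, LinearMap.det_restrictScalars,
      Algebra.norm_complex_eq, Complex.normSq_eq_norm_sq]

end WedgeDensity

/-- `u` is real differentiable at `q`, in every chart. -/
def RealDifferentiableAt (u : X → ℝ) (q : X) : Prop :=
  ∀ e ∈ atlas ℂ X, q ∈ e.source → DifferentiableAt ℝ (fun z => u (e.symm z)) (e q)

section AreaDensity

variable (Q : ChartPartition X)

/-- The density of `du ∧ dv` with respect to Lebesgue measure in the charts of `Q`. -/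
def areaDensity (u v : X → ℝ) (p : X) : ℝ :=
  ∑ i, (Q.piece i).indicator (fun p => wedgeDensity (fun z => u ((Q.chart i).symm z))
    (fun z => v ((Q.chart i).symm z)) (Q.chart i p)) p

theorem areaDensity_of_mem (u v : X → ℝ) {i : Fin Q.size} {p : X} (hp : p ∈ Q.piece i) :
    areaDensity Q u v p = wedgeDensity (fun z => u ((Q.chart i).symm z))
      (fun z => v ((Q.chart i).symm z)) (Q.chart i p) := by
  rw [areaDensity, Finset.sum_eq_single i, indicator_of_mem hp]
  · intro j _ hj
    exact indicator_of_notMem (fun h => (Q.disjoint hj).le_bot ⟨h, hp⟩) _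
  · simp

theorem ChartPartition.exists_mem_piece (p : X) : ∃ i, p ∈ Q.piece i :=
  mem_iUnion.1 (Q.covers ▸ mem_univ p)

theorem ChartPartition.image_inter (E : Set X) (i : Fin Q.size) :
    Q.chart i '' (Q.piece i ∩ E) = (Q.chart i).symm ⁻¹' E ∩ Q.chart i '' Q.piece i := by
  ext z
  constructor
  · rintro ⟨p, ⟨hp, hE⟩, rfl⟩
    refine ⟨?_, p, hp, rfl⟩
    simpa [(Q.chart i).left_inv (Q.subset i hp)] using hE
  · rintro ⟨hE, p, hp, rfl⟩
    refine ⟨p, ⟨hp, ?_⟩, rfl⟩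
    simpa [(Q.chart i).left_inv (Q.subset i hp)] using hE

theorem areaDensity_comp_symm_eqOn (u v : X → ℝ) (E : Set X) (i : Fin Q.size) :
    EqOn (fun z => areaDensity Q u v ((Q.chart i).symm z))
      (wedgeDensity (fun z => u ((Q.chart i).symm z)) (fun z => v ((Q.chart i).symm z)))
      (Q.chart i '' (Q.piece i ∩ E)) := by
  rintro _ ⟨p, hp, rfl⟩
  simp only [(Q.chart i).left_inv (Q.subset i hp.1)]
  exact areaDensity_of_mem Q u v hp.1

theorem ChartPartition.image_inter_subset_target (E : Set X) (i : Fin Q.size) :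
    Q.chart i '' (Q.piece i ∩ E) ⊆ (Q.chart i).target := by
  rintro _ ⟨p, hp, rfl⟩
  exact (Q.chart i).map_source (Q.subset i hp.1)

variable [MeasurableSpace X] [BorelSpace X]

theorem ChartPartition.measurableSet_piece (i : Fin Q.size) : MeasurableSet (Q.piece i) := by
  have := Q.measurable i
  rwa [← BorelSpace.measurable_eq (α := X)] at this

theorem measurableSet_image_of_subset_source {Y : Type*} [TopologicalSpace Y] [MeasurableSpace Y]
    [BorelSpace Y] (e : OpenPartialHomeomorph Y ℂ) {E : Set Y}
    (hE : MeasurableSet E) (hs : E ⊆ e.source) : MeasurableSet (e '' E) := by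
  have himage : e '' E = Subtype.val '' ((fun z : e.target => e.symm z) ⁻¹' E) := by
    rw [e.image_eq_target_inter_inv_preimage hs]
    ext z
    simp [and_comm]
  rw [himage]
  refine (MeasurableEmbedding.subtype_coe e.open_target.measurableSet).measurableSet_image.2 ?_
  exact (continuousOn_iff_continuous_domRestrict.1 e.continuousOn_symm).measurable hE

theorem ChartPartition.measurableSet_image {E : Set X} (hE : MeasurableSet E) (i : Fin Q.size) :
    MeasurableSet (Q.chart i '' (Q.piece i ∩ E)) :=
  measurableSet_image_of_subset_source _ ((Q.measurableSet_piece i).inter hE)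
    (inter_subset_left.trans (Q.subset i))

theorem ChartPartition.aemeasurable_symm {E : Set X} (hE : MeasurableSet E) (i : Fin Q.size) :
    AEMeasurable (Q.chart i).symm (volume.restrict (Q.chart i '' (Q.piece i ∩ E))) :=
  ((Q.chart i).continuousOn_symm.mono (Q.image_inter_subset_target E i)).aemeasurable
    (Q.measurableSet_image hE i)

/-- Lebesgue measure in the charts of a partition. -/
def areaMeasure : Measure X :=
  ∑ i, (volume.restrict (Q.chart i '' Q.piece i)).map (Q.chart i).symm

theorem measurable_areaDensity (u v : X → ℝ) : Measurable (areaDensity Q u v) := by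
  classical
  refine Finset.measurable_fun_sum _ fun i _ => ?_
  have hchart : Measurable ((Q.piece i).piecewise (Q.chart i) (fun _ => (0 : ℂ))) :=
    ((Q.chart i).continuousOn.mono (Q.subset i)).measurable_piecewise continuousOn_const
      (Q.measurableSet_piece i)
  convert ((measurable_wedgeDensity (fun z => u ((Q.chart i).symm z))
    (fun z => v ((Q.chart i).symm z))).comp hchart).indicator (Q.measurableSet_piece i) using 1
  ext p
  by_cases hp : p ∈ Q.piece i <;> simp [hp]

theorem areaMeasure_restrict {E : Set X} (hE : MeasurableSet E) :
    (areaMeasure Q).restrict E =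
      ∑ i, (volume.restrict (Q.chart i '' (Q.piece i ∩ E))).map (Q.chart i).symm := by
  have h (i : Fin Q.size) : (volume.restrict (Q.chart i '' (Q.piece i ∩ E))).map (Q.chart i).symm
      = ((volume.restrict (Q.chart i '' (Q.piece i))).map (Q.chart i).symm).restrict E := by
    have hm := Q.aemeasurable_symm .univ i
    have hms := Q.measurableSet_image .univ i
    rw [inter_univ] at hm hms
    rw [Measure.restrict_map_of_aemeasurable hm hE, Measure.restrict_restrict' hms, Q.image_inter]
  simp_rw [h]
  ext A hA
  simp [areaMeasure, Measure.restrict_apply hA, Measure.finsetSum_apply]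

theorem integrableOn_areaDensity_iff (u v : X → ℝ) {E : Set X} (hE : MeasurableSet E) :
    IntegrableOn (areaDensity Q u v) E (areaMeasure Q) ↔
      ∀ i, IntegrableOn (wedgeDensity (fun z => u ((Q.chart i).symm z))
        (fun z => v ((Q.chart i).symm z))) (Q.chart i '' (Q.piece i ∩ E)) := by
  rw [IntegrableOn, areaMeasure_restrict Q hE, integrable_finsetSum_measure]
  simp only [Finset.mem_univ, true_implies]
  refine forall_congr' fun i => ?_
  rw [integrable_map_measure (measurable_areaDensity Q u v).aestronglyMeasurable
    (Q.aemeasurable_symm hE i)]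
  exact integrableOn_congr_fun (areaDensity_comp_symm_eqOn Q u v E i) (Q.measurableSet_image hE i)

theorem setIntegral_areaDensity (u v : X → ℝ) {E : Set X} (hE : MeasurableSet E)
    (hi : IntegrableOn (areaDensity Q u v) E (areaMeasure Q)) :
    ∫ p in E, areaDensity Q u v p ∂areaMeasure Q =
      ∑ i, ∫ z in Q.chart i '' (Q.piece i ∩ E), wedgeDensity (fun z => u ((Q.chart i).symm z))
        (fun z => v ((Q.chart i).symm z)) z := by
  rw [IntegrableOn, areaMeasure_restrict Q hE, integrable_finsetSum_measure] at hi
  rw [areaMeasure_restrict Q hE, integral_finsetSum_measure hi]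
  refine Finset.sum_congr rfl fun i _ => ?_
  rw [integral_map (Q.aemeasurable_symm hE i) (measurable_areaDensity Q u v).aestronglyMeasurable]
  exact setIntegral_congr_fun (Q.measurableSet_image hE i) (areaDensity_comp_symm_eqOn Q u v E i)

theorem areaMeasure_eq_zero_of_finite {F : Set X} (hF : F.Finite) (hFm : MeasurableSet F) :
    areaMeasure Q F = 0 := by
  rw [← Measure.restrict_eq_zero, areaMeasure_restrict Q hFm]
  refine Finset.sum_eq_zero fun i _ => ?_
  have : volume (Q.chart i '' (Q.piece i ∩ F)) = 0 :=
    ((hF.subset inter_subset_right).image _).measure_zero _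
  simp [Measure.restrict_eq_zero.2 this]

theorem areaDensity_ae_eq [T1Space X] {u v u' v' : X → ℝ} {F : Set X} (hF : F.Finite)
    (hu : ∀ p ∉ F, u p = u' p) (hv : ∀ p ∉ F, v p = v' p) :
    areaDensity Q u v =ᵐ[areaMeasure Q] areaDensity Q u' v' := by
  filter_upwards [compl_mem_ae_iff.2 (areaMeasure_eq_zero_of_finite Q hF hF.measurableSet)]
    with p hp
  obtain ⟨i, hi⟩ := Q.exists_mem_piece p
  have hs := Q.subset i hi
  have hev : ∀ᶠ z in 𝓝 (Q.chart i p), (Q.chart i).symm z ∉ F := by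
    have hc := (Q.chart i).continuousAt_symm ((Q.chart i).map_source hs)
    refine hc.eventually_mem (s := Fᶜ) ?_
    rw [(Q.chart i).left_inv hs]
    exact hF.isClosed.isOpen_compl.mem_nhds hp
  rw [areaDensity_of_mem Q _ _ hi, areaDensity_of_mem Q _ _ hi]
  exact wedgeDensity_congr (hev.mono fun z hz => hu _ hz) (hev.mono fun z hz => hv _ hz)

end AreaDensity

section ChangeOfVariables

variable {φ φ' : ℂ → ℂ} {T : Set ℂ} (hT : MeasurableSet T) (hφ : ∀ z ∈ T, HasDerivAt φ (φ' z) z)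
  (hinj : InjOn φ T) (g : ℂ → ℝ)
include hT hφ hinj

theorem integrableOn_image_iff_of_hasDerivAt :
    IntegrableOn g (φ '' T) ↔ IntegrableOn (fun z => ‖φ' z‖ ^ 2 * g (φ z)) T := by
  rw [integrableOn_image_iff_integrableOn_abs_det_fderiv_smul volume hT
    (fun z hz => ((hφ z hz).hasFDerivAt.restrictScalars ℝ).hasFDerivWithinAt) hinj]
  simp [det_toSpanSingleton_restrictScalars]

theorem setIntegral_image_of_hasDerivAt :
    ∫ z in φ '' T, g z = ∫ z in T, ‖φ' z‖ ^ 2 * g (φ z) := by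
  rw [integral_image_eq_integral_abs_det_fderiv_smul volume hT
    (fun z hz => ((hφ z hz).hasFDerivAt.restrictScalars ℝ).hasFDerivWithinAt) hinj]
  simp [det_toSpanSingleton_restrictScalars]

end ChangeOfVariables

/-- A holomorphic parametrization `κ` of a part of `X`, defined on `V`. -/
structure IsParametrization (κ : ℂ → X) (V : Set ℂ) : Prop where
  mdifferentiableAt : ∀ z ∈ V, MDifferentiableAt 𝓘(ℂ) 𝓘(ℂ) κ z
  injOn : InjOn κ V

theorem isParametrization_chart_symm [IsManifold 𝓘(ℂ) 1 X] {e : OpenPartialHomeomorph X ℂ}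
    (he : e ∈ atlas ℂ X) : IsParametrization e.symm e.target :=
  ⟨fun _ hz => mdifferentiableAt_atlas_symm he hz, e.symm.injOn⟩

namespace IsParametrization

variable {κ : ℂ → X} {V T : Set ℂ} (hκ : IsParametrization κ V)
include hκ

theorem continuousOn : ContinuousOn κ V := fun z hz =>
  (hκ.mdifferentiableAt z hz).continuousAt.continuousWithinAt

theorem ae_restrict_notMem (hT : MeasurableSet T) (hTV : T ⊆ V) {P : Set X} (hP : P.Finite) :
    ∀ᵐ z ∂volume.restrict T, κ z ∉ P := by
  have hfin : (T ∩ κ ⁻¹' P).Finite :=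
    .of_finite_image (hP.subset (by rintro _ ⟨z, hz, rfl⟩; exact hz.2))
      (hκ.injOn.mono fun z hz => hTV hz.1)
  filter_upwards [hfin.countable.ae_notMem _, ae_restrict_mem hT] with z hz hzT hzP
  exact hz ⟨hzT, hzP⟩

section Chart

variable [IsManifold 𝓘(ℂ) 1 X] {e : OpenPartialHomeomorph X ℂ} (he : e ∈ atlas ℂ X)
include he

theorem hasDerivAt_chart_comp {z : ℂ} (hz : z ∈ V) (hze : κ z ∈ e.source) :
    HasDerivAt (fun z => e (κ z)) (deriv (fun z => e (κ z)) z) z :=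
  (mdifferentiableAt_iff_differentiableAt.1
    ((mdifferentiableAt_atlas he hze).comp z (hκ.mdifferentiableAt z hz))).hasDerivAt

theorem wedgeDensity_chart_comp {u v : X → ℝ} {z : ℂ} (hz : z ∈ V) (hze : κ z ∈ e.source)
    (hu : RealDifferentiableAt u (κ z)) (hv : RealDifferentiableAt v (κ z)) :
    ‖deriv (fun z => e (κ z)) z‖ ^ 2 *
        wedgeDensity (fun z => u (e.symm z)) (fun z => v (e.symm z)) (e (κ z)) =
      wedgeDensity (fun z => u (κ z)) (fun z => v (κ z)) z := by
  rw [← wedgeDensity_comp (hκ.hasDerivAt_chart_comp he hz hze) (hu _ he hze) (hv _ he hze)]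
  have hev : ∀ᶠ w in 𝓝 z, e.symm (e (κ w)) = κ w :=
    ((hκ.mdifferentiableAt z hz).continuousAt.eventually (e.open_source.mem_nhds hze)).mono
      fun w hw => e.left_inv hw
  apply wedgeDensity_congr <;>
  · filter_upwards [hev] with w hw
    simp [hw]

variable {u v : X → ℝ} {P : Set X} (hP : P.Finite) (hu : ∀ q ∉ P, RealDifferentiableAt u q)
  (hv : ∀ q ∉ P, RealDifferentiableAt v q) (hT : MeasurableSet T) (hTV : T ⊆ V)
  (hTe : MapsTo κ T e.source)
include hP hu hv hT hTV hTe

theorem wedgeDensity_chart_comp_ae :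
    (fun z => ‖deriv (fun z => e (κ z)) z‖ ^ 2 *
        wedgeDensity (fun z => u (e.symm z)) (fun z => v (e.symm z)) (e (κ z)))
      =ᵐ[volume.restrict T] wedgeDensity (fun z => u (κ z)) (fun z => v (κ z)) := by
  filter_upwards [hκ.ae_restrict_notMem hT hTV hP, ae_restrict_mem hT] with z hz hzT
  exact hκ.wedgeDensity_chart_comp he (hTV hzT) (hTe hzT) (hu _ hz) (hv _ hz)

theorem integrableOn_chart_image_iff :
    IntegrableOn (wedgeDensity (fun z => u (e.symm z)) (fun z => v (e.symm z))) (e '' (κ '' T)) ↔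
      IntegrableOn (wedgeDensity (fun z => u (κ z)) (fun z => v (κ z))) T := by
  rw [image_image, integrableOn_image_iff_of_hasDerivAt hT
    (fun z hz => hκ.hasDerivAt_chart_comp he (hTV hz) (hTe hz))
    (e.injOn.comp (hκ.injOn.mono hTV) hTe)]
  exact integrable_congr (hκ.wedgeDensity_chart_comp_ae he hP hu hv hT hTV hTe)

theorem setIntegral_chart_image :
    ∫ z in e '' (κ '' T), wedgeDensity (fun z => u (e.symm z)) (fun z => v (e.symm z)) z =
      ∫ z in T, wedgeDensity (fun z => u (κ z)) (fun z => v (κ z)) z := by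
  rw [image_image, setIntegral_image_of_hasDerivAt hT
    (fun z hz => hκ.hasDerivAt_chart_comp he (hTV hz) (hTe hz))
    (e.injOn.comp (hκ.injOn.mono hTV) hTe)]
  exact integral_congr_ae (hκ.wedgeDensity_chart_comp_ae he hP hu hv hT hTV hTe)

end Chart

section Measurable

variable [MeasurableSpace X] [BorelSpace X]

theorem measurableSet_image [T2Space X] (hT : MeasurableSet T) (hTV : T ⊆ V) :
    MeasurableSet (κ '' T) :=
  hT.image_of_continuousOn_injOn (hκ.continuousOn.mono hTV) (hκ.injOn.mono hTV)

theorem measurableSet_inter_preimage (hT : MeasurableSet T) (hTV : T ⊆ V)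
    {E : Set X} (hE : MeasurableSet E) : MeasurableSet (T ∩ κ ⁻¹' E) := by
  rw [← Subtype.image_preimage_coe]
  refine (MeasurableEmbedding.subtype_coe hT).measurableSet_image.2 ?_
  exact (continuousOn_iff_continuous_domRestrict.1 (hκ.continuousOn.mono hTV)).measurable hE

variable [T2Space X] [IsManifold 𝓘(ℂ) 1 X] (Q : ChartPartition X) {u v : X → ℝ} {P : Set X}
  (hP : P.Finite) (hu : ∀ q ∉ P, RealDifferentiableAt u q)
  (hv : ∀ q ∉ P, RealDifferentiableAt v q) (hT : MeasurableSet T) (hTV : T ⊆ V)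
include hP hu hv hT hTV

theorem integrableOn_areaDensity_image_iff :
    IntegrableOn (areaDensity Q u v) (κ '' T) (areaMeasure Q) ↔
      IntegrableOn (wedgeDensity (fun z => u (κ z)) (fun z => v (κ z))) T := by
  rw [integrableOn_areaDensity_iff Q u v (hκ.measurableSet_image hT hTV)]
  simp_rw [inter_comm (Q.piece _), ← image_inter_preimage]
  rw [forall_congr' fun i => hκ.integrableOn_chart_image_iff (Q.chart_mem i) hP hu hv
    (hκ.measurableSet_inter_preimage hT hTV (Q.measurableSet_piece i))
    (inter_subset_left.trans hTV) fun z hz => Q.subset i hz.2]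
  rw [← integrableOn_finite_iUnion, ← inter_iUnion, ← preimage_iUnion, Q.covers, preimage_univ,
    inter_univ]

theorem setIntegral_areaDensity_image
    (hi : IntegrableOn (areaDensity Q u v) (κ '' T) (areaMeasure Q)) :
    ∫ p in κ '' T, areaDensity Q u v p ∂areaMeasure Q =
      ∫ z in T, wedgeDensity (fun z => u (κ z)) (fun z => v (κ z)) z := by
  have hm (i : Fin Q.size) : MeasurableSet (T ∩ κ ⁻¹' Q.piece i) :=
    hκ.measurableSet_inter_preimage hT hTV (Q.measurableSet_piece i)
  have hcover : T = ⋃ i, T ∩ κ ⁻¹' Q.piece i := by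
    rw [← inter_iUnion, ← preimage_iUnion, Q.covers, preimage_univ, inter_univ]
  rw [setIntegral_areaDensity Q u v (hκ.measurableSet_image hT hTV) hi]
  simp_rw [inter_comm (Q.piece _), ← image_inter_preimage]
  rw [Finset.sum_congr rfl fun i _ => hκ.setIntegral_chart_image (Q.chart_mem i) hP hu hv (hm i)
    (inter_subset_left.trans hTV) fun z hz => Q.subset i hz.2]
  conv_rhs => rw [hcover]
  rw [integral_iUnion_fintype hm]
  · exact fun i j hij =>
      ((Q.disjoint hij).preimage κ).mono inter_subset_right inter_subset_right
  · exact fun i => ((hκ.integrableOn_areaDensity_image_iff Q hP hu hv hT hTV).1 hi).mono_set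
      inter_subset_left

end Measurable

end IsParametrization

section LogNorm

theorem hasFDerivAt_log_norm {g : ℂ → ℂ} {z : ℂ} (hg : DifferentiableAt ℂ g z) (h0 : g z ≠ 0) :
    HasFDerivAt (fun w => Real.log ‖g w‖)
      (Complex.reCLM.comp
        ((ContinuousLinearMap.toSpanSingleton ℂ (logDeriv g z)).restrictScalars ℝ)) z := by
  have hsq := ((hg.hasDerivAt.hasFDerivAt.restrictScalars ℝ).norm_sq.log
    (pow_ne_zero 2 (norm_ne_zero_iff.2 h0))).const_smul (1 / 2 : ℝ)
  refine (hsq.congr_fderiv ?_).congr_of_eventuallyEq ?_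
  · ext t
    have hn : Complex.normSq (g z) ≠ 0 := by simpa using h0
    rw [← Complex.normSq_eq_norm_sq]
    simp only [_root_.smul_apply, ContinuousLinearMap.comp_apply, logDeriv_apply,
      ContinuousLinearMap.coe_restrictScalars', ContinuousLinearMap.toSpanSingleton_apply,
      innerSL_apply_apply, Complex.inner, smul_eq_mul, Complex.reCLM_apply]
    simp only [Complex.mul_re, Complex.mul_im, Complex.div_re, Complex.div_im, Complex.conj_re,
      Complex.conj_im]
    field_simp
    ring
  · filter_upwards with w
    simp [Real.log_pow]

theorem wedgeDensity_log_norm {g h : ℂ → ℂ} {z : ℂ} (hg : DifferentiableAt ℂ g z) (hg0 : g z ≠ 0)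
    (hh : DifferentiableAt ℂ h z) (hh0 : h z ≠ 0) :
    wedgeDensity (fun w => Real.log ‖g w‖) (fun w => Real.log ‖h w‖) z =
      (logDeriv g z * starRingEnd ℂ (logDeriv h z)).im := by
  rw [wedgeDensity, (hasFDerivAt_log_norm hg hg0).fderiv, (hasFDerivAt_log_norm hh hh0).fderiv]
  simp

theorem RegularAt.realDifferentiableAt [IsManifold 𝓘(ℂ) 1 X] {x : X → ℂ} {q : X}
    (h : RegularAt x q) : RealDifferentiableAt (fun p => Real.log ‖x p‖) q := by
  intro e he hq
  refine (hasFDerivAt_log_norm ((mdifferentiableAt_iff_of_mem_atlas he hq).1 h.1)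
    ?_).differentiableAt
  rw [e.left_inv hq]
  exact h.2

end LogNorm

section Integrability

open Asymptotics

theorem logDeriv_zpow_sub_mul {h : ℂ → ℂ} {z z₀ : ℂ} (hz : z ≠ z₀) (hh : DifferentiableAt ℂ h z)
    (h0 : h z ≠ 0) (n : ℤ) :
    logDeriv (fun w => (w - z₀) ^ n * h w) z = n / (z - z₀) + logDeriv h z := by
  have hne : z - z₀ ≠ 0 := sub_ne_zero.2 hz
  rw [logDeriv_mul (f := fun w => (w - z₀) ^ n) (g := h) z (zpow_ne_zero _ hne) h0
    ((differentiableAt_id.sub_const z₀).zpow (Or.inl hne)) hh,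
    logDeriv_fun_zpow (f := fun w => w - z₀) (by fun_prop) n, logDeriv_apply (fun w => w - z₀)]
  simp [div_eq_mul_inv]

theorem exists_logDeriv_eq_div_add {g : ℂ → ℂ} {z₀ : ℂ} (hm : MeromorphicAt g z₀)
    (ht : meromorphicOrderAt g z₀ ≠ ⊤) :
    ∃ (n : ℤ) (k : ℂ → ℂ), AnalyticAt ℂ k z₀ ∧
      ∀ᶠ z in 𝓝[≠] z₀, DifferentiableAt ℂ g z ∧ g z ≠ 0 ∧ logDeriv g z = n / (z - z₀) + k z := by
  lift meromorphicOrderAt g z₀ to ℤ using ht with n hn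
  obtain ⟨h, ha, h0, he⟩ := (meromorphicOrderAt_eq_int_iff hm).1 hn.symm
  refine ⟨n, logDeriv h, ha.deriv.div ha h0, ?_⟩
  have he' : ∀ᶠ z in 𝓝[≠] z₀, g =ᶠ[𝓝 z] fun z => (z - z₀) ^ n * h z := by
    filter_upwards [eventually_eventually_nhdsWithin.2 he, self_mem_nhdsWithin] with z hz hne
    rwa [isOpen_compl_singleton.nhdsWithin_eq hne] at hz
  filter_upwards [he', eventually_nhdsWithin_of_eventually_nhds ha.eventually_analyticAt,
    eventually_nhdsWithin_of_eventually_nhds (ha.continuousAt.eventually_ne h0),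
    self_mem_nhdsWithin] with z hgz haz h0z hne
  have hne' : z - z₀ ≠ 0 := sub_ne_zero.2 hne
  refine ⟨hgz.differentiableAt_iff.2 (((differentiableAt_id.sub_const z₀).zpow (Or.inl hne')).mul
    haz.differentiableAt), ?_, ?_⟩
  · rw [hgz.eq_of_nhds]
    exact mul_ne_zero (zpow_ne_zero _ hne') h0z
  · rw [logDeriv_apply, hgz.deriv_eq, hgz.eq_of_nhds, ← logDeriv_apply,
      logDeriv_zpow_sub_mul hne haz.differentiableAt h0z]

-- The most singular term of the product is real.
theorem im_div_add_mul_conj_div_add (n m : ℤ) (w a b : ℂ) :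
    ((n / w + a) * starRingEnd ℂ (m / w + b)).im =
      (n / w * starRingEnd ℂ b + a * starRingEnd ℂ (m / w) + a * starRingEnd ℂ b).im := by
  have hreal : (n / w * starRingEnd ℂ (m / w) : ℂ) =
      ((n * m * (Complex.normSq w)⁻¹ : ℝ) : ℂ) := by
    simp only [map_div₀, map_intCast]
    push_cast
    rw [← Complex.mul_conj, mul_inv]
    ring
  rw [map_add, add_mul, mul_add, mul_add, hreal]
  simp only [Complex.add_im, Complex.ofReal_im]
  ring

theorem integrableAtFilter_norm_sub_inv (z₀ : ℂ) :
    IntegrableAtFilter (fun z : ℂ => ‖z - z₀‖⁻¹) (𝓝 z₀) := by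
  have hloc : LocallyIntegrable (fun z : ℂ => ‖z‖⁻¹) := by
    refine locallyIntegrable_of_norm_le_rpow (E := ℂ) (C := 1) (α := 1) (by simp) (by simp) ?_
      (by fun_prop)
    filter_upwards with z
    simp [Real.rpow_neg_one]
  obtain ⟨U, hU, hi⟩ := hloc 0
  refine ⟨(fun z => z - z₀) ⁻¹' U,
    (continuous_sub_right z₀).continuousAt.preimage_mem_nhds (by rwa [sub_self]), ?_⟩
  exact ((measurePreserving_sub_right volume z₀).integrableOn_comp_preimage
    (Homeomorph.subRight z₀).measurableEmbedding).2 hi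

theorem isBigO_wedgeDensity_log_norm {g h : ℂ → ℂ} {z₀ : ℂ} (hg : MeromorphicAt g z₀)
    (hg' : meromorphicOrderAt g z₀ ≠ ⊤) (hh : MeromorphicAt h z₀)
    (hh' : meromorphicOrderAt h z₀ ≠ ⊤) :
    wedgeDensity (fun w => Real.log ‖g w‖) (fun w => Real.log ‖h w‖) =O[𝓝[≠] z₀]
      fun z => ‖z - z₀‖⁻¹ := by
  obtain ⟨n, k, hk, hgk⟩ := exists_logDeriv_eq_div_add hg hg'
  obtain ⟨m, l, hl, hhl⟩ := exists_logDeriv_eq_div_add hh hh'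
  have hpole (n : ℤ) : (fun z : ℂ => (n / (z - z₀) : ℂ)) =O[𝓝[≠] z₀] fun z => ‖z - z₀‖⁻¹ :=
    .of_bound ‖(n : ℂ)‖ (.of_forall fun z => by simp [div_eq_mul_inv])
  have hbdd {k : ℂ → ℂ} (hk : AnalyticAt ℂ k z₀) : k =O[𝓝[≠] z₀] fun _ => (1 : ℝ) :=
    (hk.continuousAt.isBigO_one ℝ).mono nhdsWithin_le_nhds
  have hone : (fun _ => (1 : ℝ)) =O[𝓝[≠] z₀] fun z => ‖z - z₀‖⁻¹ := by
    refine .of_bound 1 (eventually_nhdsWithin_iff.2 ?_)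
    filter_upwards [Metric.ball_mem_nhds z₀ one_pos] with z hz hne
    have hz1 : ‖z - z₀‖ ≤ 1 := by simpa [dist_eq_norm] using (Metric.mem_ball.1 hz).le
    simpa using (one_le_inv₀ (norm_pos_iff.2 (sub_ne_zero.2 hne))).2 hz1
  have hconj {k : ℂ → ℂ} {r : ℂ → ℝ} (hk : k =O[𝓝[≠] z₀] r) :
      (fun z => starRingEnd ℂ (k z)) =O[𝓝[≠] z₀] r :=
    IsBigO.of_norm_left (by simpa using hk.norm_left)
  have hsum := ((((hpole n).mul (hconj (hbdd hl))).congr_right fun _ => mul_one _).add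
    (((hbdd hk).mul (hconj (hpole m))).congr_right fun _ => one_mul _)).add
    ((((hbdd hk).mul (hconj (hbdd hl))).congr_right fun _ => mul_one _).trans hone)
  refine IsBigO.trans (IsBigO.of_bound 1 ?_) hsum
  filter_upwards [hgk, hhl] with z ⟨hd, h0, he⟩ ⟨hd', h0', he'⟩
  rw [wedgeDensity_log_norm hd h0 hd' h0', he, he', im_div_add_mul_conj_div_add, one_mul]
  exact Complex.abs_im_le_norm _

theorem integrableAtFilter_wedgeDensity_log_norm {g h : ℂ → ℂ} {z₀ : ℂ} (hg : MeromorphicAt g z₀)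
    (hg' : meromorphicOrderAt g z₀ ≠ ⊤) (hh : MeromorphicAt h z₀)
    (hh' : meromorphicOrderAt h z₀ ≠ ⊤) :
    IntegrableAtFilter (wedgeDensity (fun w => Real.log ‖g w‖) (fun w => Real.log ‖h w‖))
      (𝓝 z₀) := by
  rw [← IntegrableAtFilter.inf_ae_iff]
  have hle : 𝓝 z₀ ⊓ ae volume ≤ 𝓝[≠] z₀ :=
    inf_le_inf_left _ (le_principal_iff.2 (compl_mem_ae_iff.2 (measure_singleton z₀)))
  exact ((isBigO_wedgeDensity_log_norm hg hg' hh hh').mono hle).integrableAtFilter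
    ⟨univ, univ_mem, (measurable_wedgeDensity _ _).aestronglyMeasurable⟩
    ((integrableAtFilter_norm_sub_inv z₀).filter_mono inf_le_left)

theorem integrable_areaDensity [IsManifold 𝓘(ℂ) 1 X] [MeasurableSpace X] [BorelSpace X] [T2Space X]
    [CompactSpace X] (Q : ChartPartition X) {x y : X → ℂ} (hx : ∀ p, HasFiniteOrderAt x p)
    (hy : ∀ p, HasFiniteOrderAt y p) :
    Integrable (areaDensity Q (fun p => Real.log ‖x p‖) (fun p => Real.log ‖y p‖))
      (areaMeasure Q) := by
  have hP := (finite_not_regularAt hx).union (finite_not_regularAt hy)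
  rw [← integrableOn_univ]
  refine LocallyIntegrableOn.integrableOn_isCompact (fun p _ => ?_) isCompact_univ
  rw [nhdsWithin_univ]
  obtain ⟨U, hU, hUi⟩ := integrableAtFilter_wedgeDensity_log_norm (hx p).1 (hx p).2 (hy p).1
    (hy p).2
  obtain ⟨V, hVU, hV, hpV⟩ := mem_nhds_iff.1 (inter_mem hU (chart_target_mem_nhds ℂ p))
  refine ⟨(chartAt ℂ p).symm '' V, ?_, ?_⟩
  · exact ((chartAt ℂ p).symm.isOpen_image_of_subset_source hV fun z hz => (hVU hz).2).mem_nhds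
      ⟨_, hpV, (chartAt ℂ p).left_inv (mem_chart_source ℂ p)⟩
  · rw [(isParametrization_chart_symm (chart_mem_atlas ℂ p)).integrableOn_areaDensity_image_iff Q hP
      (fun q hq => ?_) (fun q hq => ?_) hV.measurableSet (fun z hz => (hVU hz).2)]
    · exact hUi.mono_set fun z hz => (hVU hz).1
    · exact RegularAt.realDifferentiableAt (not_not.1 fun h => hq (Or.inl h))
    · exact RegularAt.realDifferentiableAt (not_not.1 fun h => hq (Or.inr h))

end Integrability

section Coordinates

theorem exists_analyticAt_pow_eq {g : ℂ → ℂ} {z₁ : ℂ} (hg : AnalyticAt ℂ g z₁) (h0 : g z₁ ≠ 0)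
    {n : ℕ} (hn : n ≠ 0) :
    ∃ k : ℂ → ℂ, AnalyticAt ℂ k z₁ ∧ k z₁ ≠ 0 ∧ ∀ᶠ z in 𝓝 z₁, k z ^ n = g z := by
  obtain ⟨c, hc⟩ := IsAlgClosed.exists_pow_nat_eq (g z₁) (Nat.pos_of_ne_zero hn)
  have hc0 : c ≠ 0 := by
    rintro rfl
    rw [zero_pow hn] at hc
    exact h0 hc.symm
  refine ⟨fun z => c * Complex.exp (Complex.log (g z / g z₁) / n), ?_, by simp [hc0, h0], ?_⟩
  · have hlog : AnalyticAt ℂ (fun z => Complex.log (g z / g z₁)) z₁ :=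
      (hg.div analyticAt_const h0).clog (by simp [h0])
    exact analyticAt_const.mul (hlog.div analyticAt_const (by simpa using hn)).cexp
  · filter_upwards [hg.continuousAt.eventually_ne h0] with z hz
    rw [mul_pow, ← Complex.exp_nat_mul, mul_div_cancel₀ _ (by simpa using hn),
      Complex.exp_log (div_ne_zero hz h0), hc]
    field_simp

theorem exists_analytic_openPartialHomeomorph {h : ℂ → ℂ} {w : ℂ} (ha : AnalyticAt ℂ h w)
    (hd : deriv h w ≠ 0) :
    ∃ Φ : OpenPartialHomeomorph ℂ ℂ, w ∈ Φ.source ∧ (∀ z, Φ z = h z) ∧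
      (∀ z ∈ Φ.target, AnalyticAt ℂ Φ.symm z) ∧ deriv Φ.symm (h w) ≠ 0 := by
  have hsd := ha.hasStrictDerivAt
  have hfd := hsd.hasStrictFDerivAt_equiv hd
  set Φ := hfd.toOpenPartialHomeomorph h
  have hw : w ∈ Φ.source := hfd.mem_toOpenPartialHomeomorph_source
  have hsymm : AnalyticAt ℂ Φ.symm (h w) :=
    Φ.analyticAt_symm' hw ha hfd.hasFDerivAt.fderiv
  obtain ⟨W, hW, hWo, hwW⟩ := mem_nhds_iff.1 hsymm.eventually_analyticAt
  refine ⟨(Φ.symm.restrOpen W hWo).symm, ?_, fun _ => rfl, fun z hz => hW hz.2, ?_⟩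
  · simpa using ⟨hw, hwW⟩
  · exact (hsd.to_localInverse hd).hasDerivAt.deriv.trans_ne (inv_ne_zero hd)

/-- A local homeomorphism to `ℂ` around `p` that is a holomorphic coordinate of `X`. -/
structure IsCoordinateAt (Ψ : OpenPartialHomeomorph X ℂ) (p : X) : Prop where
  mem_source : p ∈ Ψ.source
  mdifferentiableAt_symm : ∀ z ∈ Ψ.target, MDifferentiableAt 𝓘(ℂ) 𝓘(ℂ) Ψ.symm z
  analyticAt_chart_symm : AnalyticAt ℂ (fun z => chartAt ℂ p (Ψ.symm z)) (Ψ p)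
  deriv_chart_symm_ne_zero : deriv (fun z => chartAt ℂ p (Ψ.symm z)) (Ψ p) ≠ 0

variable [IsManifold 𝓘(ℂ) 1 X]

theorem exists_coordinate {p : X} {h : ℂ → ℂ} (ha : AnalyticAt ℂ h (chartAt ℂ p p))
    (hd : deriv h (chartAt ℂ p p) ≠ 0) {O : Set X} (hO : O ∈ 𝓝 p) :
    ∃ Ψ : OpenPartialHomeomorph X ℂ, IsCoordinateAt Ψ p ∧ Ψ.source ⊆ O ∧
      ∀ q, Ψ q = h (chartAt ℂ p q) := by
  set e := chartAt ℂ p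
  obtain ⟨Φ, hpΦ, hΦ, hΦs, hΦd⟩ := exists_analytic_openPartialHomeomorph ha hd
  obtain ⟨W, hWO, hWo, hpW⟩ := mem_nhds_iff.1 hO
  have hΦp : Φ.symm (h (e p)) = e p := by rw [← hΦ, Φ.left_inv hpΦ]
  have hpt : h (e p) ∈ Φ.target := hΦ (e p) ▸ Φ.map_source hpΦ
  set Ψ := (e.restrOpen W hWo).trans Φ
  have htarget : ∀ z ∈ Ψ.target, z ∈ Φ.target ∧ Φ.symm z ∈ e.target := fun z hz => by
    simp [Ψ] at hz
    tauto
  have hΨp : Ψ p = h (e p) := hΦ _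
  have hchart : (fun z => e (Ψ.symm z)) =ᶠ[𝓝 (Ψ p)] Φ.symm := by
    rw [hΨp]
    have hmem : Φ.symm (h (e p)) ∈ e.target := hΦp.symm ▸ mem_chart_target ℂ p
    filter_upwards [(hΦs _ hpt).continuousAt.eventually (e.open_target.mem_nhds hmem)] with z hz
    exact e.right_inv hz
  refine ⟨Ψ, ⟨?_, fun z hz => ?_, ?_, ?_⟩, fun q hq => hWO ?_, fun q => hΦ _⟩
  · simpa [Ψ] using ⟨⟨mem_chart_source ℂ p, hpW⟩, hpΦ⟩
  · have hz' := htarget z hz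
    exact MDifferentiableAt.comp (I' := 𝓘(ℂ)) (g := e.symm) (f := Φ.symm) z
      (mdifferentiableAt_atlas_symm (chart_mem_atlas ℂ p) hz'.2)
      (mdifferentiableAt_iff_differentiableAt.2 (hΦs z hz'.1).differentiableAt)
  · exact (hΨp ▸ hΦs _ hpt).congr hchart.symm
  · rw [hchart.deriv_eq, hΨp]
    exact hΦd
  · have hq' : (q ∈ e.source ∧ q ∈ W) ∧ e q ∈ Φ.source := by simpa [Ψ] using hq
    exact hq'.1.2

theorem exists_root_coordinate {p : X} {x : X → ℂ} {z₀ : ℂ} {n : ℕ} (hn : n ≠ 0)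
    (ha : AnalyticAt ℂ (chartRep x p) (chartAt ℂ p p))
    (ho : analyticOrderAt (fun z => chartRep x p z - z₀) (chartAt ℂ p p) = n)
    {O : Set X} (hO : O ∈ 𝓝 p) :
    ∃ Ψ : OpenPartialHomeomorph X ℂ, IsCoordinateAt Ψ p ∧ Ψ.source ⊆ O ∧ Ψ p = 0 ∧
      ∀ q ∈ Ψ.source, x q = z₀ + Ψ q ^ n := by
  set w := chartAt ℂ p p
  obtain ⟨g, hg, hg0, hxg⟩ := (AnalyticAt.analyticOrderAt_eq_natCast
    (ha.sub analyticAt_const)).1 ho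
  obtain ⟨k, hk, hk0, hkg⟩ := exists_analyticAt_pow_eq hg hg0 hn
  have hd : HasDerivAt (fun z => (z - w) * k z) (k w) w := by
    simpa using ((hasDerivAt_id w).sub_const w).fun_mul hk.differentiableAt.hasDerivAt
  have hO' : O ∩ ((chartAt ℂ p).source ∩ {q | chartRep x p (chartAt ℂ p q) - z₀ =
      (chartAt ℂ p q - w) ^ n • g (chartAt ℂ p q) ∧
      k (chartAt ℂ p q) ^ n = g (chartAt ℂ p q)}) ∈ 𝓝 p :=
    inter_mem hO (inter_mem (chart_source_mem_nhds ℂ p)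
      (((chartAt ℂ p).continuousAt (mem_chart_source ℂ p)).eventually (hxg.and hkg)))
  obtain ⟨Ψ, hΨ, hΨO, hΨh⟩ := exists_coordinate
    ((analyticAt_id.sub analyticAt_const).mul hk) (hd.deriv.trans_ne hk0) hO'
  refine ⟨Ψ, hΨ, hΨO.trans inter_subset_left, by simp [hΨh], fun q hq => ?_⟩
  obtain ⟨-, hqs, hxq, hkq⟩ := hΨO hq
  have hΨq : Ψ q ^ n = x q - z₀ := by
    rw [hΨh]
    simp only [Pi.mul_apply, Pi.sub_apply, id, mul_pow]
    rw [hkq, ← smul_eq_mul, ← hxq]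
    simp [chartRep, (chartAt ℂ p).left_inv hqs]
  rw [hΨq, add_sub_cancel]

theorem mfderiv_eq_zero_iff_of_mem_atlas {e : OpenPartialHomeomorph X ℂ} (he : e ∈ atlas ℂ X)
    {x : X → ℂ} {q : X} (hq : q ∈ e.source) (hx : MDifferentiableAt 𝓘(ℂ) 𝓘(ℂ) x q) :
    mfderiv 𝓘(ℂ) 𝓘(ℂ) x q = 0 ↔ deriv (fun z => x (e.symm z)) (e q) = 0 := by
  have hxs : MDifferentiableAt 𝓘(ℂ) 𝓘(ℂ) x (e.symm (e q)) := by rwa [e.left_inv hq]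
  have hcomp : fderiv ℂ (fun z => x (e.symm z)) (e q) =
      (mfderiv 𝓘(ℂ) 𝓘(ℂ) x (e.symm (e q))).comp (mfderiv 𝓘(ℂ) 𝓘(ℂ) e.symm (e q)) := by
    rw [← mfderiv_comp (I' := 𝓘(ℂ)) (e q) hxs
      (mdifferentiableAt_atlas_symm (I := 𝓘(ℂ)) he (e.map_source hq)), mfderiv_eq_fderiv]
    rfl
  have hsurj := (mdifferentiable_of_mem_atlas (I := 𝓘(ℂ)) he).symm.mfderiv_surjective
    (x := e q) (e.map_source hq)
  have hleft : mfderiv 𝓘(ℂ) 𝓘(ℂ) x q = 0 ↔ mfderiv 𝓘(ℂ) 𝓘(ℂ) x (e.symm (e q)) = 0 := by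
    rw [e.left_inv hq]
  rw [hleft, ← fderiv_apply_one_eq_deriv]
  constructor
  · intro h
    rw [hcomp, h]
    rfl
  · intro h
    have hzero : fderiv ℂ (fun z => x (e.symm z)) (e q) = 0 := by
      ext
      simpa using h
    refine ContinuousLinearMap.ext fun v => ?_
    obtain ⟨w, rfl⟩ := hsurj v
    exact congrArg (fun L : ℂ →L[ℂ] ℂ => L w) (hcomp.symm.trans hzero)

end Coordinates

section Dichotomy

theorem forall_eventually_nhdsNE_or_not {Y : Type*} [TopologicalSpace Y] [T1Space Y]
    [PreconnectedSpace Y] {R : Y → Prop} (hne : ∀ p : Y, (𝓝[≠] p).NeBot)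
    (h : ∀ p, (∀ᶠ q in 𝓝[≠] p, R q) ∨ ∀ᶠ q in 𝓝[≠] p, ¬ R q) :
    (∀ p, ∀ᶠ q in 𝓝[≠] p, R q) ∨ ∀ p, ∀ᶠ q in 𝓝[≠] p, ¬ R q := by
  have hcompl : {p | ∀ᶠ q in 𝓝[≠] p, R q}ᶜ = {p | ∀ᶠ q in 𝓝[≠] p, ¬ R q} := by
    ext p
    have := hne p
    refine ⟨(h p).resolve_left, fun hnot hR => ?_⟩
    rw [mem_ofPred_eq] at hR hnot
    obtain ⟨q, hq, hq'⟩ := (hR.and hnot).exists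
    exact hq' hq
  have hclopen : IsClopen {p | ∀ᶠ q in 𝓝[≠] p, R q} :=
    ⟨⟨hcompl ▸ isOpen_setOfPred_eventually_nhdsWithin⟩, isOpen_setOfPred_eventually_nhdsWithin⟩
  rcases isClopen_iff.1 hclopen with hempty | huniv
  · rw [hempty, compl_empty] at hcompl
    exact .inr (eq_univ_iff_forall.1 hcompl.symm)
  · exact .inl (eq_univ_iff_forall.1 huniv)

theorem IsNormalMeromorphic.mfderiv_dichotomy [IsManifold 𝓘(ℂ) 1 X] [T1Space X]
    [PreconnectedSpace X] {x : X → ℂ} (hx : IsNormalMeromorphic x) :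
    (∀ p, ∀ᶠ q in 𝓝[≠] p, mfderiv 𝓘(ℂ) 𝓘(ℂ) x q = 0) ∨
      (∀ p, ∀ᶠ q in 𝓝[≠] p, mfderiv 𝓘(ℂ) 𝓘(ℂ) x q ≠ 0) := by
  refine forall_eventually_nhdsNE_or_not nhdsNE_neBot fun p => ?_
  have hiff : ∀ᶠ q in 𝓝[≠] p, mfderiv 𝓘(ℂ) 𝓘(ℂ) x q = 0 ↔
      deriv (chartRep x p) (chartAt ℂ p q) = 0 := by
    filter_upwards [(hx.hasFiniteOrderAt p).eventually_regularAt,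
      eventually_nhdsWithin_of_eventually_nhds (chart_source_mem_nhds ℂ p)] with q hreg hq
    exact mfderiv_eq_zero_iff_of_mem_atlas (chart_mem_atlas ℂ p) hq hreg.1
  refine ((hx.normalForm p).meromorphicAt.deriv.eventually_eq_zero_or_eventually_ne_zero).imp
    (fun h => ?_) fun h => ?_
  · filter_upwards [hiff, (tendsto_chartAt_nhdsNE p).eventually h] with q hq h0 using hq.2 h0
  · filter_upwards [hiff, (tendsto_chartAt_nhdsNE p).eventually h] with q hq h0 using mt hq.1 h0

end Dichotomy

section RealFunctions

/-- A real meromorphic function all of whose zeros and poles are real points. -/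
structure IsRealFunction (σ : X → X) (x : X → ℂ) : Prop where
  normal : IsNormalMeromorphic x
  conj : ∀ p, ∀ᶠ q in 𝓝[≠] p, x (σ q) = starRingEnd ℂ (x q)
  ne_zero : ∀ p, σ p ≠ p → x p ≠ 0

namespace IsRealFunction

variable {σ : X → X} {x : X → ℂ} (hx : IsRealFunction σ x)
include hx

theorem neg : IsRealFunction σ (-x) :=
  ⟨hx.normal.neg, fun p => by filter_upwards [hx.conj p] with q hq; simp [hq],
    fun p hp => by simpa using hx.ne_zero p hp⟩

theorem inv : IsRealFunction σ x⁻¹ :=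
  ⟨hx.normal.inv, fun p => by filter_upwards [hx.conj p] with q hq; simp [hq],
    fun p hp => by simpa using hx.ne_zero p hp⟩

theorem map_eq_self {p : X} (hp : x p = 0) : σ p = p :=
  not_imp_comm.1 (hx.ne_zero p) (not_not.2 hp)

theorem im_eq_zero [IsManifold 𝓘(ℂ) 1 X] (hσ : Continuous σ) {p : X} (hp : σ p = p) :
    (x p).im = 0 := by
  by_cases h0 : x p = 0
  · simp [h0]
  have hc : ContinuousAt x p := (hx.normal.regularAt_iff.2 h0).1.continuousAt
  have hlim : Tendsto (fun q => x (σ q)) (𝓝[≠] p) (𝓝 (x p)) := by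
    have hσp : Tendsto σ (𝓝 p) (𝓝 p) := by simpa only [hp] using hσ.tendsto p
    exact (hc.tendsto.comp hσp).mono_left nhdsWithin_le_nhds
  have hlim_conj : Tendsto (fun q => starRingEnd ℂ (x q)) (𝓝[≠] p) (𝓝 (starRingEnd ℂ (x p))) :=
    (Complex.continuous_conj.continuousAt.tendsto.comp hc.tendsto).mono_left nhdsWithin_le_nhds
  have := nhdsNE_neBot p
  exact Complex.conj_eq_iff_im.1 (tendsto_nhds_unique (hlim.congr' (hx.conj p)) hlim_conj).symm

end IsRealFunction

end RealFunctions

section Halves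

variable {Y : Type*} [TopologicalSpace Y] {σ : Y → Y} {S : Set Y} (hS : IsHalf σ S)
include hS

theorem IsHalf.ne_of_mem {p : Y} (hp : p ∈ S) : σ p ≠ p := by
  have : p ∈ S ∪ σ '' S := Or.inl hp
  rwa [hS.union_eq] at this

theorem IsHalf.isOpen_image (hσ : Continuous σ) (hi : Function.Involutive σ) :
    IsOpen (σ '' S) := by
  rw [image_eq_preimage_of_inverse hi.leftInverse hi.rightInverse]
  exact hS.isOpen.preimage hσ

theorem IsHalf.mem_or {p : Y} (hp : p ∉ σ '' S) : p ∈ S ∨ σ p = p := by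
  by_contra! h
  have : p ∈ S ∪ σ '' S := by rw [hS.union_eq]; exact h.2
  exact this.elim h.1 hp

end Halves

section Proper

theorem tendsto_norm_atTop_of_ordAt_neg {x : X → ℂ} {p : X} (h : ordAt x p < 0) :
    Tendsto (fun q => ‖x q‖) (𝓝[≠] p) atTop := by
  refine ((tendsto_norm_cobounded_atTop.comp (tendsto_cobounded_of_meromorphicOrderAt_neg h)).comp
    (tendsto_chartAt_nhdsNE p)).congr' ?_
  filter_upwards [eventually_nhdsWithin_of_eventually_nhds (chart_source_mem_nhds ℂ p)] with q hq
  simp [chartRep, (chartAt ℂ p).left_inv hq]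

theorem IsNormalMeromorphic.eq_zero_of_ordAt_neg {x : X → ℂ} (hx : IsNormalMeromorphic x) {p : X}
    (h : ordAt x p < 0) : x p = 0 := by
  by_contra hne
  exact h.ne (hx.ordAt_eq_zero_iff.2 hne)

variable [IsManifold 𝓘(ℂ) 1 X]

theorem IsNormalMeromorphic.eventually_ne {x : X → ℂ} (hx : IsNormalMeromorphic x) {p : X}
    {z₀ : ℂ} (hp : 0 ≤ ordAt x p → x p ≠ z₀) :
    ∀ᶠ a : ℂ × X in 𝓝 z₀ ×ˢ 𝓝 p, a.2 ≠ p ∨ 0 ≤ ordAt x p → x a.2 ≠ a.1 := by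
  by_cases ho : 0 ≤ ordAt x p
  · have hlim : Tendsto (fun a : ℂ × X => x a.2 - a.1) (𝓝 z₀ ×ˢ 𝓝 p) (𝓝 (x p - z₀)) :=
      ((hx.mdifferentiableAt ho).continuousAt.tendsto.comp tendsto_snd).sub tendsto_fst
    filter_upwards [hlim.eventually_ne (sub_ne_zero.2 (hp ho))] with a ha _
    exact sub_ne_zero.1 ha
  · have hlarge := eventually_nhdsWithin_iff.1
      ((tendsto_norm_atTop_of_ordAt_neg (not_le.1 ho)).eventually_gt_atTop (‖z₀‖ + 1))
    have hsmall : ∀ᶠ z in 𝓝 z₀, ‖z‖ < ‖z₀‖ + 1 :=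
      continuous_norm.continuousAt.eventually_lt_const (lt_add_one _)
    filter_upwards [tendsto_snd.eventually hlarge, tendsto_fst.eventually hsmall] with a h₁ h₂ h₃
    intro hxa
    exact lt_asymm (h₁ (h₃.resolve_right ho)) (hxa ▸ h₂)

theorem eventually_fiber_subset [CompactSpace X] {σ : X → X} {S : Set X} {x : X → ℂ}
    (hσ : Continuous σ) (hi : Function.Involutive σ) (hS : IsHalf σ S) (hx : IsRealFunction σ x)
    {z₀ : ℂ} {W : Set X} (hW : IsOpen W)
    (hfib : ∀ p ∉ σ '' S, 0 ≤ ordAt x p → x p = z₀ → p ∈ W) :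
    ∀ᶠ z in 𝓝 z₀, ∀ q ∈ S, x q = z → q ∈ W := by
  have hlocal : ∀ p, ∀ᶠ a : ℂ × X in 𝓝 z₀ ×ˢ 𝓝 p, a.2 ∈ S → x a.2 = a.1 → a.2 ∈ W := by
    intro p
    by_cases hpW : p ∈ W
    · filter_upwards [tendsto_snd.eventually (hW.mem_nhds hpW)] with a ha _ _ using ha
    by_cases hpS : p ∈ σ '' S
    · filter_upwards [tendsto_snd.eventually ((hS.isOpen_image hσ hi).mem_nhds hpS)] with a ha h _
      exact (hS.disjoint.le_bot ⟨h, ha⟩).elim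
    filter_upwards [hx.normal.eventually_ne fun ho h => hpW (hfib p hpS ho h)] with a ha haS hax
    refine (ha ?_ hax).elim
    by_contra! h
    exact hS.ne_of_mem haS (hx.map_eq_self (h.1 ▸ hx.normal.eq_zero_of_ordAt_neg h.2))
  filter_upwards [isCompact_univ.eventually_forall_of_forall_eventually (x₀ := z₀)
    (K := (univ : Set X)) (P := fun z q => q ∈ S → x q = z → q ∈ W)
    fun p _ => nhds_prod_eq (x := z₀) (y := p) ▸ hlocal p] with z hz q hq
  exact hz q (mem_univ q) hq

end Proper

section RootsOfUnity

theorem isPreconnected_ball_diff_zero (r : ℝ) :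
    IsPreconnected (Metric.ball (0 : ℂ) r \ {0}) := by
  rcases le_or_gt r 0 with hr | hr
  · rw [Metric.ball_eq_empty.2 hr, empty_sdiff]
    exact isPreconnected_empty
  have hexp : Metric.ball (0 : ℂ) r \ {0} = Complex.exp '' {w | w.re < Real.log r} := by
    ext z
    constructor
    · rintro ⟨hz, hz0⟩
      refine ⟨Complex.log z, ?_, Complex.exp_log hz0⟩
      simpa [Complex.log_re] using
        Real.log_lt_log (norm_pos_iff.2 hz0) (mem_ball_zero_iff.1 hz)
    · rintro ⟨w, hw, rfl⟩
      refine ⟨?_, Complex.exp_ne_zero w⟩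
      rw [mem_ball_zero_iff, Complex.norm_exp]
      exact (Real.lt_log_iff_exp_lt hr).1 hw
  rw [hexp]
  exact (convex_halfSpace_re_lt _).isPreconnected.image _ Complex.continuous_exp.continuousOn

theorem finite_setOf_pow_eq_one {a : ℕ} (ha : a ≠ 0) : {z : ℂ | z ^ a = 1}.Finite :=
  (Polynomial.nthRootsFinset a (1 : ℂ)).finite_toSet.subset fun z hz => by
    simpa [Polynomial.mem_nthRootsFinset (Nat.pos_of_ne_zero ha)] using hz

theorem exists_eq_mul_of_pow_eq {ρ : ℂ → ℂ} {r : ℝ} {a : ℕ} (ha : a ≠ 0)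
    (hρ : ContinuousOn ρ (Metric.ball 0 r)) (h : ∀ t ∈ Metric.ball 0 r, ρ t ^ a = t ^ a) :
    ∃ ζ : ℂ, ζ ^ a = 1 ∧ ∀ t ∈ Metric.ball 0 r, ρ t = ζ * t := by
  have hquot : MapsTo (fun t => ρ t / t) (Metric.ball 0 r \ {0}) {z : ℂ | z ^ a = 1} := by
    rintro t ⟨ht, ht0⟩
    rw [mem_ofPred_eq, div_pow, h t ht, div_self (pow_ne_zero a ht0)]
  obtain ⟨ζ, hζ, hζρ⟩ := (isPreconnected_ball_diff_zero r).eqOn_const_of_mapsTo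
    (finite_setOf_pow_eq_one ha).isDiscrete
    ((hρ.mono sdiff_subset).div continuousOn_id fun _ ht => ht.2) hquot ⟨1, one_pow a⟩
  refine ⟨ζ, hζ, fun t ht => ?_⟩
  by_cases h0 : t = 0
  · have := h t ht
    rw [h0, zero_pow ha, pow_eq_zero_iff ha] at this
    simp [h0, this]
  · exact (div_eq_iff h0).1 (hζρ ⟨ht, h0⟩)

end RootsOfUnity

section RealDiscs

/-- A holomorphic parametrization `τ` by the disc of radius `r` of a neighbourhood of the point
`τ 0 = p`, intertwining complex conjugation and `σ`. -/
structure IsRealDisc (σ : X → X) (p : X) (r : ℝ) (τ : ℂ → X) : Prop where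
  radius_pos : 0 < r
  map_zero : τ 0 = p
  continuousOn : ContinuousOn τ (Metric.ball 0 r)
  injOn : InjOn τ (Metric.ball 0 r)
  image_mem_nhds : τ '' Metric.ball 0 r ∈ 𝓝 p
  map_conj : ∀ t ∈ Metric.ball 0 r, τ (starRingEnd ℂ t) = σ (τ t)
  analyticAt_chart : AnalyticAt ℂ (fun t => chartAt ℂ p (τ t)) 0
  deriv_chart_ne_zero : deriv (fun t => chartAt ℂ p (τ t)) 0 ≠ 0

theorem exists_conj_coordinate_eq {Y : Type*} [TopologicalSpace Y] {σ : Y → Y} {x : Y → ℂ} {p : Y}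
    {a : ℕ} (ha : a ≠ 0) (hσ : Continuous σ) (hp : σ p = p)
    (hconj : ∀ᶠ q in 𝓝 p, x (σ q) = starRingEnd ℂ (x q)) {Ψ : OpenPartialHomeomorph Y ℂ}
    (hpΨ : p ∈ Ψ.source) (hΨp : Ψ p = 0) (hΨx : ∀ q ∈ Ψ.source, x q = Ψ q ^ a) :
    ∃ ζ : ℂ, ∃ r > 0, ζ ^ a = 1 ∧ Metric.ball 0 r ⊆ Ψ.target ∧
      ∀ t ∈ Metric.ball 0 r, σ (Ψ.symm t) = Ψ.symm (starRingEnd ℂ (ζ * t)) := by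
  have hΨs : Ψ.symm 0 = p := by rw [← hΨp, Ψ.left_inv hpΨ]
  have h0t : (0 : ℂ) ∈ Ψ.target := hΨp ▸ Ψ.map_source hpΨ
  have hsymm : Tendsto Ψ.symm (𝓝 0) (𝓝 p) := by
    simpa only [hΨs] using (Ψ.continuousAt_symm h0t).tendsto
  have hσp : Tendsto σ (𝓝 p) (𝓝 p) := by simpa only [hp] using hσ.tendsto p
  obtain ⟨r, hr, hball⟩ : ∃ r > 0, ∀ t ∈ Metric.ball 0 r, t ∈ Ψ.target ∧
      σ (Ψ.symm t) ∈ Ψ.source ∧ x (σ (Ψ.symm t)) = starRingEnd ℂ (x (Ψ.symm t)) :=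
    Metric.eventually_nhds_iff_ball.1 ((Ψ.open_target.eventually_mem h0t).and
      (((hσp.comp hsymm).eventually (Ψ.open_source.eventually_mem hpΨ)).and
        (hsymm.eventually hconj)))
  have hcont : ContinuousOn (fun t => starRingEnd ℂ (Ψ (σ (Ψ.symm t)))) (Metric.ball 0 r) := by
    refine Complex.continuous_conj.comp_continuousOn ?_
    exact Ψ.continuousOn.comp (hσ.comp_continuousOn (Ψ.continuousOn_symm.mono
      fun t ht => (hball t ht).1)) fun t ht => (hball t ht).2.1
  have hpow : ∀ t ∈ Metric.ball 0 r, starRingEnd ℂ (Ψ (σ (Ψ.symm t))) ^ a = t ^ a := by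
    intro t ht
    obtain ⟨htarget, hsource, hxσ⟩ := hball t ht
    rw [← map_pow, ← hΨx _ hsource, hxσ, Complex.conj_conj, hΨx _ (Ψ.map_target htarget),
      Ψ.right_inv htarget]
  obtain ⟨ζ, hζ, hζt⟩ := exists_eq_mul_of_pow_eq ha hcont hpow
  refine ⟨ζ, r, hr, hζ, fun t ht => (hball t ht).1, fun t ht => ?_⟩
  rw [← hζt t ht, Complex.conj_conj, Ψ.left_inv (hball t ht).2.1]

theorem isRealDisc_symm_div {σ : X → X} {p : X} {Ψ : OpenPartialHomeomorph X ℂ}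
    (hΨ : IsCoordinateAt Ψ p) (hΨp : Ψ p = 0) {r : ℝ} (hr : 0 < r)
    (hball : Metric.ball 0 r ⊆ Ψ.target) {η : ℂ} (hη : ‖η‖ = 1)
    (hconj : ∀ t ∈ Metric.ball 0 r, σ (Ψ.symm t) = Ψ.symm (starRingEnd ℂ (η ^ 2 * t))) :
    IsRealDisc σ p r fun t => Ψ.symm (t / η) := by
  have hη0 : η ≠ 0 := norm_ne_zero_iff.1 (hη ▸ one_ne_zero)
  have hdiv : MapsTo (fun t => t / η) (Metric.ball 0 r) (Metric.ball 0 r) := fun t ht => by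
    simpa [hη] using ht
  have hderiv : HasDerivAt (fun t : ℂ => t / η) η⁻¹ 0 := by
    simpa using (hasDerivAt_id (0 : ℂ)).div_const η
  have hanalytic := hΨp ▸ hΨ.analyticAt_chart_symm
  refine ⟨hr, ?_, ?_, ?_, ?_, fun t ht => ?_, ?_, ?_⟩
  · rw [zero_div, ← hΨp, Ψ.left_inv hΨ.mem_source]
  · exact (Ψ.continuousOn_symm.mono hball).comp (continuous_id.div_const η).continuousOn hdiv
  · exact (Ψ.symm.injOn.mono hball).comp (fun _ _ _ _ h => (div_left_inj' hη0).1 h) hdiv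
  · have himage : (fun t => Ψ.symm (t / η)) '' Metric.ball 0 r = Ψ.symm '' Metric.ball 0 r := by
      rw [← image_image Ψ.symm (· / η)]
      refine congrArg _ (hdiv.image_subset.antisymm fun t ht => ⟨t * η, ?_, by simp [hη0]⟩)
      simpa [hη] using ht
    rw [himage]
    exact (Ψ.symm.isOpen_image_of_subset_source Metric.isOpen_ball hball).mem_nhds
      ⟨0, Metric.mem_ball_self hr, by rw [← hΨp, Ψ.left_inv hΨ.mem_source]⟩
  · have hηc : starRingEnd ℂ η = η⁻¹ := by
      rw [Complex.inv_def, Complex.normSq_eq_norm_sq, hη]; simp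
    rw [hconj _ (hdiv ht)]
    congr 1
    simp only [map_mul, map_pow, map_div₀, hηc]
    field_simp
  · exact AnalyticAt.comp (g := fun z => chartAt ℂ p (Ψ.symm z)) (f := fun t => t / η)
      (by simpa using hanalytic) (analyticAt_id.div_const)
  · have hcomp : HasDerivAt (fun t => chartAt ℂ p (Ψ.symm (t / η)))
        (deriv (fun z => chartAt ℂ p (Ψ.symm z)) 0 * η⁻¹) 0 :=
      HasDerivAt.comp (h₂ := fun z => chartAt ℂ p (Ψ.symm z)) 0
        (by simpa using hanalytic.differentiableAt.hasDerivAt) hderiv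
    exact hcomp.deriv.trans_ne (mul_ne_zero (hΨp ▸ hΨ.deriv_chart_symm_ne_zero) (inv_ne_zero hη0))

theorem exists_isRealDisc [IsManifold 𝓘(ℂ) 1 X] {σ : X → X} {x : X → ℂ} (hσ : Continuous σ)
    (hx : IsRealFunction σ x) {p : X} (hp : 0 < ordAt x p) {O : Set X} (hO : O ∈ 𝓝 p) :
    ∃ a : ℕ, ∃ ε : ℂ, ∃ r τ, a ≠ 0 ∧ (ε = 1 ∨ ε = -1) ∧ IsRealDisc σ p r τ ∧
      τ '' Metric.ball 0 r ⊆ O ∧ ∀ t ∈ Metric.ball 0 r, x (τ t) = ε * t ^ a := by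
  have hx0 : x p = 0 := by
    by_contra h
    exact hp.ne' (hx.normal.ordAt_eq_zero_iff.2 h)
  have hσp : σ p = p := hx.map_eq_self hx0
  have hconj : ∀ᶠ q in 𝓝 p, x (σ q) = starRingEnd ℂ (x q) := by
    rw [← nhdsNE_sup_pure, eventually_sup]
    exact ⟨hx.conj p, by simp [hσp, hx0]⟩
  have hanalytic := hx.normal.ordAt_nonneg_iff.1 hp.le
  obtain ⟨a, ha⟩ : ∃ a : ℕ, analyticOrderAt (chartRep x p) (chartAt ℂ p p) = a := by
    refine ENat.ne_top_iff_exists.1 (fun h => hx.normal.ordAt_ne_top p ?_) |>.imp fun _ => Eq.symm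
    rw [ordAt, hanalytic.meromorphicOrderAt_eq, h]
    rfl
  have ha0 : a ≠ 0 := by
    rintro rfl
    rw [ordAt, hanalytic.meromorphicOrderAt_eq, ha] at hp
    simp at hp
  obtain ⟨Ψ, hΨ, hΨO, hΨp, hΨx⟩ := exists_root_coordinate ha0 hanalytic (z₀ := 0)
    (by simpa using ha) hO
  simp only [zero_add] at hΨx
  obtain ⟨ζ, r, hr, hζ, hball, hζt⟩ :=
    exists_conj_coordinate_eq ha0 hσ hσp hconj hΨ.mem_source hΨp hΨx
  obtain ⟨η, rfl⟩ := IsAlgClosed.exists_pow_nat_eq ζ (n := 2) two_pos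
  have hη : (η ^ a) ^ 2 = 1 := by rw [← pow_mul, mul_comm, pow_mul, hζ]
  have hη1 : ‖η‖ = 1 := Complex.norm_eq_one_of_pow_eq_one (by rwa [← pow_mul] at hζ) (by simp [ha0])
  have hdiv : ∀ t ∈ Metric.ball 0 r, t / η ∈ Metric.ball 0 r := fun t ht => by
    simpa [hη1] using ht
  refine ⟨a, (η ^ a)⁻¹, r, fun t => Ψ.symm (t / η), ha0, ?_,
    isRealDisc_symm_div hΨ hΨp hr hball hη1 hζt, ?_, fun t ht => ?_⟩
  · exact (sq_eq_one_iff.1 hη).imp (by simp +contextual) (by simp +contextual [inv_neg])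
  · rintro _ ⟨t, ht, rfl⟩
    exact hΨO (Ψ.map_target (hball (hdiv t ht)))
  · rw [hΨx _ (Ψ.map_target (hball (hdiv t ht))), Ψ.right_inv (hball (hdiv t ht)), div_pow,
      div_eq_inv_mul]

namespace IsRealDisc

variable {σ : X → X} {p : X} {r : ℝ} {τ : ℂ → X} (hτ : IsRealDisc σ p r τ)
include hτ

theorem comp_neg : IsRealDisc σ p r fun t => τ (-t) := by
  have hneg : MapsTo (fun t : ℂ => -t) (Metric.ball 0 r) (Metric.ball 0 r) := fun t ht => by
    simpa using ht
  refine ⟨hτ.radius_pos, by simpa using hτ.map_zero,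
    hτ.continuousOn.comp continuous_neg.continuousOn hneg,
    hτ.injOn.comp neg_injective.injOn hneg, ?_, fun t ht => ?_, ?_, ?_⟩
  · rw [← image_image τ, image_neg_eq_neg, neg_ball, neg_zero]
    exact hτ.image_mem_nhds
  · simpa using hτ.map_conj (-t) (hneg ht)
  · exact AnalyticAt.comp (g := fun t => chartAt ℂ p (τ t)) (f := fun t => -t)
      (by simpa using hτ.analyticAt_chart) analyticAt_id.neg
  · rw [deriv_comp_neg (fun t => chartAt ℂ p (τ t)), neg_zero]
    exact neg_ne_zero.2 hτ.deriv_chart_ne_zero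

theorem ball_mem_nhds : Metric.ball (0 : ℂ) r ∈ 𝓝 0 :=
  Metric.ball_mem_nhds _ hτ.radius_pos

theorem tendsto_nhdsNE : Tendsto τ (𝓝[≠] 0) (𝓝[≠] p) := by
  refine tendsto_nhdsWithin_iff.2 ⟨?_, ?_⟩
  · simpa only [hτ.map_zero] using (hτ.continuousOn.continuousAt hτ.ball_mem_nhds).tendsto.mono_left
      nhdsWithin_le_nhds
  · filter_upwards [self_mem_nhdsWithin, nhdsWithin_le_nhds hτ.ball_mem_nhds] with t ht0 ht h
    exact ht0 (hτ.injOn ht (mem_of_mem_nhds hτ.ball_mem_nhds) (h.trans hτ.map_zero.symm))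

theorem map_eq_self_iff {t : ℂ} (ht : t ∈ Metric.ball 0 r) : σ (τ t) = τ t ↔ t.im = 0 := by
  rw [← hτ.map_conj t ht, hτ.injOn.eq_iff (by simpa using ht) ht, Complex.conj_eq_iff_im]

theorem mem_iff_of_upper {S : Set X} (hS : IsHalf σ S)
    (hup : ∀ t ∈ Metric.ball 0 r, 0 < t.im → τ t ∈ S) {t : ℂ} (ht : t ∈ Metric.ball 0 r) :
    τ t ∈ S ↔ 0 < t.im := by
  refine ⟨fun h => ?_, hup t ht⟩
  by_contra! him
  have ht' : starRingEnd ℂ t ∈ Metric.ball (0 : ℂ) r := by simpa using ht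
  rcases him.lt_or_eq with hlt | heq
  · refine hS.disjoint.le_bot ⟨h, _, hup _ ht' (by simpa using hlt), ?_⟩
    rw [← hτ.map_conj _ ht', Complex.conj_conj]
  · exact hS.ne_of_mem h ((hτ.map_eq_self_iff ht).2 heq)

theorem upper_or_lower_subset {S : Set X} (hS : IsHalf σ S) (hσ : Continuous σ)
    (hi : Function.Involutive σ) :
    (∀ t ∈ Metric.ball 0 r, 0 < t.im → τ t ∈ S) ∨
      ∀ t ∈ Metric.ball 0 r, 0 < t.im → τ (-t) ∈ S := by
  have hconv : IsPreconnected (Metric.ball (0 : ℂ) r ∩ {t | 0 < t.im}) :=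
    ((convex_ball _ _).inter (convex_halfSpace_im_gt 0)).isPreconnected
  have hsub : τ '' (Metric.ball (0 : ℂ) r ∩ {t | 0 < t.im}) ⊆ S ∪ σ '' S := by
    rintro _ ⟨t, ⟨ht, him⟩, rfl⟩
    rw [hS.union_eq]
    exact fun h => him.ne' ((hτ.map_eq_self_iff ht).1 h)
  refine ((hconv.image _ (hτ.continuousOn.mono inter_subset_left)).subset_or_subset hS.isOpen
    (hS.isOpen_image hσ hi) hS.disjoint hsub).imp (fun h t ht him => h ⟨t, ⟨ht, him⟩, rfl⟩)
    fun h t ht him => ?_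
  have ht' : -starRingEnd ℂ t ∈ Metric.ball (0 : ℂ) r := by simpa using ht
  obtain ⟨s, hs, hsτ⟩ := h ⟨-starRingEnd ℂ t, ⟨ht', by simpa using him⟩, rfl⟩
  have hconj := hτ.map_conj _ ht'
  rw [← hsτ, hi s] at hconj
  simpa [← hconj] using hs

theorem exists_eq_zpow_mul {y : X → ℂ} (hy : HasFiniteOrderAt y p) :
    ∃ b : ℤ, ∃ g : ℂ → ℂ, AnalyticAt ℂ g 0 ∧ g 0 ≠ 0 ∧
      ∀ᶠ t in 𝓝[≠] (0 : ℂ), y (τ t) = t ^ b * g t := by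
  have hrep : ∀ᶠ t in 𝓝[≠] (0 : ℂ), chartRep y p (chartAt ℂ p (τ t)) = y (τ t) := by
    filter_upwards [hτ.tendsto_nhdsNE.eventually
      (eventually_nhdsWithin_of_eventually_nhds (chart_source_mem_nhds ℂ p))] with t ht
    simp [chartRep, (chartAt ℂ p).left_inv ht]
  have hord := meromorphicOrderAt_comp_of_deriv_ne_zero (f := chartRep y p) hτ.analyticAt_chart
    hτ.deriv_chart_ne_zero
  have hmer : MeromorphicAt (chartRep y p ∘ fun t => chartAt ℂ p (τ t)) 0 :=
    MeromorphicAt.comp_analyticAt (by simpa only [hτ.map_zero] using hy.meromorphicAt)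
      hτ.analyticAt_chart
  obtain ⟨b, hb⟩ := WithTop.ne_top_iff_exists.1 hy.ordAt_ne_top
  rw [hτ.map_zero] at hord
  obtain ⟨g, hg, hg0, hge⟩ := (meromorphicOrderAt_eq_int_iff hmer).1 (hord.trans hb.symm)
  refine ⟨b, g, hg, hg0, ?_⟩
  filter_upwards [hge, hrep] with t ht ht'
  simpa [← ht'] using ht

theorem exists_tendsto_div_zpow {y : X → ℂ} (hy : HasFiniteOrderAt y p)
    (hconj : ∀ᶠ q in 𝓝[≠] p, y (σ q) = starRingEnd ℂ (y q)) :
    ∃ b : ℤ, ∃ c : ℝ, c ≠ 0 ∧ Tendsto (fun t => y (τ t) / (c * t ^ b)) (𝓝[≠] 0) (𝓝 1) := by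
  obtain ⟨b, g, hg, hg0, hyg⟩ := hτ.exists_eq_zpow_mul hy
  have hreal : Tendsto (fun s : ℝ => (s : ℂ)) (𝓝[≠] 0) (𝓝[≠] 0) := by
    simpa using Complex.continuous_ofReal.continuousWithinAt.tendsto_nhdsWithin
      (x := 0) (s := {0}ᶜ) (t := {0}ᶜ) fun s hs => by simpa using hs
  have him : ∀ᶠ s : ℝ in 𝓝[≠] 0, (g s).im = 0 := by
    filter_upwards [hreal.eventually (hτ.tendsto_nhdsNE.eventually hconj), hreal.eventually hyg,
      hreal.eventually (eventually_nhdsWithin_of_eventually_nhds hτ.ball_mem_nhds),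
      self_mem_nhdsWithin] with s hs hsg hsr hs0
    rw [(hτ.map_eq_self_iff hsr).2 (Complex.ofReal_im s)] at hs
    obtain ⟨v, hv⟩ := Complex.conj_eq_iff_real.1 hs.symm
    have hgs : g s = ((v / s ^ b : ℝ) : ℂ) := by
      push_cast
      rw [← hv, hsg, mul_div_cancel_left₀ _ (zpow_ne_zero _ (by simpa using hs0))]
    rw [hgs, Complex.ofReal_im]
  have hlim : Tendsto g (𝓝[≠] 0) (𝓝 (g 0)) := hg.continuousAt.tendsto.mono_left nhdsWithin_le_nhds
  have hg0im : (g 0).im = 0 := tendsto_nhds_unique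
    (((Complex.continuous_im.tendsto _).comp (hlim.comp hreal)).congr' him) tendsto_const_nhds
  have hc : (((g 0).re : ℝ) : ℂ) = g 0 := Complex.ext rfl (by simp [hg0im])
  refine ⟨b, (g 0).re, fun h => hg0 (by rw [← hc, h, Complex.ofReal_zero]), ?_⟩
  have hone := hlim.div_const (g 0)
  rw [div_self hg0] at hone
  refine hone.congr' ?_
  filter_upwards [hyg, self_mem_nhdsWithin] with t ht h0
  rw [ht, hc, mul_comm (g 0), mul_div_mul_left _ _ (zpow_ne_zero _ h0)]

end IsRealDisc

end RealDiscs

section LocalForms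

/-- Near a real zero `p` of `x`, in the coordinate given by `τ`, the function `x` is `ε t ^ a`, the
half `S` is the upper half disc and the leading term of `y` is `c t ^ b`. -/
structure IsLocalForm {Y : Type*} [TopologicalSpace Y] (S : Set Y) (x y : Y → ℂ) (p : Y) (a : ℕ)
    (b : ℤ) (ε : ℂ) (c : ℝ) (r : ℝ) (τ : ℂ → Y) : Prop where
  exponent_ne_zero : a ≠ 0
  sign : ε = 1 ∨ ε = -1
  coeff_ne_zero : c ≠ 0
  radius_pos : 0 < r
  injOn : InjOn τ (Metric.ball 0 r)
  image_mem_nhds : τ '' Metric.ball 0 r ∈ 𝓝 p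
  apply_eq : ∀ t ∈ Metric.ball 0 r, x (τ t) = ε * t ^ a
  mem_iff : ∀ t ∈ Metric.ball 0 r, τ t ∈ S ↔ 0 < t.im
  tendsto : Tendsto (fun t => y (τ t) / (c * t ^ b)) (𝓝[≠] 0) (𝓝 1)

theorem IsLocalForm.neg {Y : Type*} [TopologicalSpace Y] {S : Set Y} {x y : Y → ℂ} {p : Y} {a : ℕ}
    {b : ℤ} {ε : ℂ} {c r : ℝ} {τ : ℂ → Y} (h : IsLocalForm S x y p a b ε c r τ) :
    IsLocalForm S (-x) y p a b (-ε) c r τ :=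
  { h with
    sign := by rcases h.sign with h | h <;> simp [h]
    apply_eq := fun t ht => by simp [h.apply_eq t ht] }

theorem exists_localForm [IsManifold 𝓘(ℂ) 1 X] {σ : X → X} {S : Set X} {x y : X → ℂ}
    (hσ : Continuous σ) (hi : Function.Involutive σ) (hS : IsHalf σ S) (hx : IsRealFunction σ x)
    (hy : IsRealFunction σ y) {p : X} (hp : 0 < ordAt x p) {O : Set X} (hO : O ∈ 𝓝 p) :
    ∃ a b ε c r τ, IsLocalForm S x y p a b ε c r τ ∧ τ '' Metric.ball 0 r ⊆ O := by
  suffices ∃ a : ℕ, ∃ ε : ℂ, ∃ r τ, a ≠ 0 ∧ (ε = 1 ∨ ε = -1) ∧ IsRealDisc σ p r τ ∧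
      τ '' Metric.ball 0 r ⊆ O ∧ (∀ t ∈ Metric.ball 0 r, x (τ t) = ε * t ^ a) ∧
      ∀ t ∈ Metric.ball 0 r, 0 < t.im → τ t ∈ S by
    obtain ⟨a, ε, r, τ, ha, hε, hτ, hτO, hxτ, hup⟩ := this
    obtain ⟨b, c, hc, hlim⟩ := hτ.exists_tendsto_div_zpow (hy.normal.hasFiniteOrderAt p) (hy.conj p)
    exact ⟨a, b, ε, c, r, τ, ⟨ha, hε, hc, hτ.radius_pos, hτ.injOn, hτ.image_mem_nhds, hxτ,
      fun t ht => hτ.mem_iff_of_upper hS hup ht, hlim⟩, hτO⟩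
  obtain ⟨a, ε, r, τ, ha, hε, hτ, hτO, hxτ⟩ := exists_isRealDisc hσ hx hp hO
  have hneg : ∀ t ∈ Metric.ball (0 : ℂ) r, -t ∈ Metric.ball (0 : ℂ) r := fun t ht => by
    simpa using ht
  rcases hτ.upper_or_lower_subset hS hσ hi with hup | hlow
  · exact ⟨a, ε, r, τ, ha, hε, hτ, hτO, hxτ, hup⟩
  · refine ⟨a, ε * (-1) ^ a, r, fun t => τ (-t), ha, ?_, hτ.comp_neg, ?_, fun t ht => ?_, hlow⟩
    · rcases hε with rfl | rfl <;> rcases neg_one_pow_eq_or ℂ a with h | h <;> simp [h]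
    · rintro _ ⟨t, ht, rfl⟩
      exact hτO ⟨-t, hneg t ht, rfl⟩
    · rw [hxτ _ (hneg t ht), neg_pow, mul_assoc]

end LocalForms

section Strip

/-- The strip `0 < Im w < π`, which `exp` maps onto the upper half plane. -/
def strip : Set ℂ := {w | 0 < w.im ∧ w.im < Real.pi}

theorem isOpen_strip : IsOpen strip :=
  (isOpen_lt continuous_const Complex.continuous_im).inter
    (isOpen_lt Complex.continuous_im continuous_const)

theorem convex_strip : Convex ℝ strip :=
  (convex_halfSpace_im_gt 0).inter (convex_halfSpace_im_lt Real.pi)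

theorem log_exp_of_mem_strip {w : ℂ} (hw : w ∈ strip) : Complex.log (Complex.exp w) = w :=
  Complex.log_exp (by linarith [hw.1, Real.pi_pos]) hw.2.le

theorem injOn_exp_strip : InjOn Complex.exp strip :=
  LeftInvOn.injOn fun _ => log_exp_of_mem_strip

theorem exp_im_pos {w : ℂ} (hw : w ∈ strip) : 0 < (Complex.exp w).im := by
  rw [Complex.exp_im]
  exact mul_pos (Real.exp_pos _) (Real.sin_pos_of_pos_of_lt_pi hw.1 hw.2)

theorem log_mem_strip {z : ℂ} (hz : 0 < z.im) : Complex.log z ∈ strip := by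
  constructor <;> rw [Complex.log_im]
  · exact (Complex.arg_nonneg_iff.2 hz.le).lt_of_ne fun h =>
      hz.ne' (Complex.arg_eq_zero_iff.1 h.symm).2
  · exact (Complex.arg_le_pi z).lt_of_ne fun h => hz.ne' (Complex.arg_eq_pi_iff.1 h).2

/-- The filter of neighbourhoods of the end `Re w → -∞` of the strip. -/
def stripEnd : Filter ℂ := comap Complex.re atBot ⊓ 𝓟 strip

theorem eventually_stripEnd_iff {R : ℂ → Prop} :
    (∀ᶠ w in stripEnd, R w) ↔ ∃ s₀ : ℝ, ∀ w ∈ strip, w.re < s₀ → R w := by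
  rw [stripEnd, eventually_inf_principal, eventually_comap, eventually_atBot]
  constructor
  · rintro ⟨s, hs⟩
    exact ⟨s, fun w hw h => hs w.re h.le w rfl hw⟩
  · rintro ⟨s, hs⟩
    exact ⟨s - 1, fun t ht w hwt hw => hs w hw (by linarith)⟩

theorem nonneg_and_lt_of_mul_eq_add {l w : ℂ} (hl : l ∈ strip) (hw : w ∈ strip) {a : ℕ}
    (ha : a ≠ 0) {n : ℤ} (h : a * l = w + n * (Real.pi * Complex.I)) : 0 ≤ n ∧ n < a := by
  have ha' : (0 : ℝ) < a := by exact_mod_cast Nat.pos_of_ne_zero ha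
  have him : a * l.im = w.im + n * Real.pi := by simpa using congrArg Complex.im h
  have hlower : 0 < a * l.im := mul_pos ha' hl.1
  have hupper : a * l.im < a * Real.pi := mul_lt_mul_of_pos_left hl.2 ha'
  have hnonneg : (-1 : ℝ) < n := by nlinarith [hw.2, Real.pi_pos]
  have hlt : (n : ℝ) < a := by nlinarith [hw.1, Real.pi_pos]
  exact ⟨Int.le_of_sub_one_lt (by exact_mod_cast hnonneg), by exact_mod_cast hlt⟩

end Strip

section Sheet

open Classical in
/-- The indices `k` of the branches `sheet a k` of `t` in the equation `ε * t ^ a = exp w`, for `w`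
in the strip and `t` in the upper half plane; here `ε` is a sign. -/
def sheetIndices (ε : ℂ) (a : ℕ) : Finset ℕ :=
  (Finset.range a).filter fun k => ε * (-1) ^ k = 1

theorem mem_sheetIndices {ε : ℂ} {a k : ℕ} :
    k ∈ sheetIndices ε a ↔ k < a ∧ ε * (-1) ^ k = 1 := by
  simp [sheetIndices]

theorem sum_sheetIndices_add_neg {ε : ℂ} (hε : ε = 1 ∨ ε = -1) (a : ℕ) (φ : ℕ → ℝ) :
    ∑ k ∈ sheetIndices ε a, φ k + ∑ k ∈ sheetIndices (-ε) a, φ k = ∑ k ∈ Finset.range a, φ k := by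
  have hneg : ∀ k : ℕ, -ε * (-1) ^ k = 1 ↔ ¬ ε * (-1) ^ k = 1 := by
    intro k
    rcases hε with rfl | rfl <;> rcases neg_one_pow_eq_or ℂ k with h | h <;> rw [h] <;> norm_num
  simp only [sheetIndices, hneg, Finset.sum_filter_add_sum_filter_not]

/-- The `k`-th branch over the strip of the `a`-th root of `(-1) ^ k * exp w`. -/
def sheet (a k : ℕ) (w : ℂ) : ℂ := Complex.exp ((w + k * (Real.pi * Complex.I)) / a)

theorem sheet_im_pos {a k : ℕ} (hk : k < a) {w : ℂ} (hw : w ∈ strip) : 0 < (sheet a k w).im := by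
  have ha : (0 : ℝ) < a := by exact_mod_cast (Nat.zero_le k).trans_lt hk
  have hk1 : (k : ℝ) + 1 ≤ a := by exact_mod_cast hk
  have him : ((w + k * (Real.pi * Complex.I)) / a).im = (w.im + k * Real.pi) / a := by
    rw [← Complex.ofReal_natCast a, Complex.div_ofReal_im]
    simp
  obtain ⟨hw0, hwπ⟩ := hw
  refine exp_im_pos ⟨?_, ?_⟩
  · rw [him]
    positivity
  · rw [him, div_lt_iff₀ ha]
    nlinarith [Real.pi_pos]

theorem norm_sheet (a k : ℕ) (w : ℂ) : ‖sheet a k w‖ = Real.exp (w.re / a) := by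
  rw [sheet, Complex.norm_exp, ← Complex.ofReal_natCast a, Complex.div_ofReal_re]
  simp

theorem sheet_pow {a : ℕ} (ha : a ≠ 0) (k : ℕ) (w : ℂ) :
    sheet a k w ^ a = (-1) ^ k * Complex.exp w := by
  rw [sheet, ← Complex.exp_nat_mul, mul_div_cancel₀ _ (by exact_mod_cast ha), Complex.exp_add,
    Complex.exp_nat_mul, Complex.exp_pi_mul_I, mul_comm]

theorem sheet_zpow (a k : ℕ) (b : ℤ) (w : ℂ) :
    sheet a k w ^ b = Complex.exp (b * ((w + k * (Real.pi * Complex.I)) / a)) := by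
  rw [sheet, Complex.exp_int_mul]

theorem exists_sheet_of_pow_eq {ε t w : ℂ} (hε : ε = 1 ∨ ε = -1) {a : ℕ} (ha : a ≠ 0)
    (ht : 0 < t.im) (hw : w ∈ strip) (h : ε * t ^ a = Complex.exp w) :
    ∃ k ∈ sheetIndices ε a, sheet a k w = t := by
  have ht0 : t ≠ 0 := by
    rintro rfl
    simp at ht
  -- Squaring removes the sign `ε`, so that logarithms are compared modulo `π * I`.
  have hsq : Complex.exp (2 * (a * Complex.log t)) = Complex.exp (2 * w) := by
    have hε2 : ε ^ 2 = 1 := sq_eq_one_iff.2 hε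
    rw [two_mul, Complex.exp_add, Complex.exp_nat_mul, Complex.exp_log ht0, two_mul,
      Complex.exp_add, ← h]
    linear_combination -(t ^ a) ^ 2 * hε2
  obtain ⟨n, hn⟩ := Complex.exp_eq_exp_iff_exists_int.1 hsq
  have hlog : a * Complex.log t = w + n * (Real.pi * Complex.I) := by linear_combination hn / 2
  obtain ⟨hn0, hna⟩ := nonneg_and_lt_of_mul_eq_add (log_mem_strip ht) hw ha hlog
  lift n to ℕ using hn0 with k
  have hsheet : sheet a k w = t := by
    have hquot : (w + k * (Real.pi * Complex.I)) / a = Complex.log t := by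
      rw [div_eq_iff (by exact_mod_cast ha), mul_comm (Complex.log t), hlog, Int.cast_natCast]
    rw [sheet, hquot, Complex.exp_log ht0]
  refine ⟨k, mem_sheetIndices.2 ⟨by exact_mod_cast hna, ?_⟩, hsheet⟩
  rw [← hsheet, sheet_pow ha, ← mul_assoc] at h
  exact mul_right_cancel₀ (Complex.exp_ne_zero w) (h.trans (one_mul _).symm)

theorem sheet_injOn {a : ℕ} {w : ℂ} : InjOn (fun k => sheet a k w) {k | k < a} := by
  intro k hk j hj h
  rw [mem_ofPred_eq] at hk hj
  have ha : (a : ℂ) ≠ 0 := by exact_mod_cast (Nat.zero_le k |>.trans_lt hk).ne'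
  obtain ⟨n, hn⟩ := Complex.exp_eq_exp_iff_exists_int.1 h
  have hmul : (k : ℂ) * (Real.pi * Complex.I) = (j + 2 * n * a) * (Real.pi * Complex.I) := by
    field_simp at hn
    linear_combination hn
  have hkj : (k : ℤ) = j + 2 * n * a := by
    exact_mod_cast mul_right_cancel₀ (by simp [Real.pi_ne_zero]) hmul
  obtain rfl : n = 0 := by
    rcases lt_trichotomy n 0 with h | h | h
    · nlinarith
    · exact h
    · nlinarith
  simpa using hkj

theorem tendsto_sheet {a : ℕ} (ha : a ≠ 0) (k : ℕ) :
    Tendsto (sheet a k) stripEnd (𝓝[≠] 0) := by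
  refine tendsto_nhdsWithin_iff.2 ⟨?_, Eventually.of_forall fun w => Complex.exp_ne_zero _⟩
  rw [tendsto_zero_iff_norm_tendsto_zero]
  simp_rw [norm_sheet]
  exact Real.tendsto_exp_atBot.comp ((tendsto_comap.mono_left inf_le_left).atBot_div_const
    (by exact_mod_cast Nat.pos_of_ne_zero ha))

end Sheet

section StripEnd

variable {Y : Type*} {S : Set Y} {x y : Y → ℂ}

/-- The points of `S` over `exp w`. -/
def fiber (S : Set Y) (x : Y → ℂ) (w : ℂ) : Set Y := {p | p ∈ S ∧ x p = Complex.exp w}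

/-- The norm of `y` along `x`, restricted to `S`: the product of the values of `y` over a fiber. -/
def fiberProd (S : Set Y) (x y : Y → ℂ) (w : ℂ) : ℂ := ∏ᶠ p ∈ fiber S x w, y p

theorem fiberProd_neg_inv (S : Set Y) (x y : Y → ℂ) (w : ℂ) :
    fiberProd S (-x⁻¹) y w = fiberProd S x y (Real.pi * Complex.I - w) := by
  have hfiber : fiber S (-x⁻¹) w = fiber S x (Real.pi * Complex.I - w) := by
    ext p
    simp only [fiber, mem_ofPred_eq, Pi.neg_apply, Pi.inv_apply]
    refine and_congr_right fun _ => ?_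
    rw [Complex.exp_sub, Complex.exp_pi_mul_I, neg_eq_iff_eq_neg, inv_eq_iff_eq_inv, inv_neg,
      neg_div, one_div]
  rw [fiberProd, fiberProd, hfiber]

/-- Up to a real factor, the norm of `y` along `x` is asymptotic to `exp (α w + β i)` at the end of
the strip. -/
def HasStripEnd (S : Set Y) (x y : Y → ℂ) (α β : ℝ) : Prop :=
  ∃ C : ℝ, C ≠ 0 ∧ Tendsto (fun w => fiberProd S x y w / (C * Complex.exp (α * w + β * Complex.I)))
    stripEnd (𝓝 1)

theorem tendsto_exp_stripEnd : Tendsto Complex.exp stripEnd (𝓝 0) :=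
  Complex.tendsto_exp_comap_re_atBot.mono_left inf_le_left

theorem eventually_mem_strip : ∀ᶠ w in stripEnd, w ∈ strip :=
  mem_inf_of_right (mem_principal_self _)

theorem tendsto_stripEnd {θ : ℝ} (h0 : 0 < θ) (hπ : θ < Real.pi) :
    Tendsto (fun s : ℝ => (s : ℂ) + θ * Complex.I) atBot stripEnd := by
  refine tendsto_inf.2 ⟨tendsto_comap_iff.2 ?_, tendsto_principal.2 (Eventually.of_forall ?_)⟩
  · exact tendsto_id.congr fun s => by simp
  · intro s
    simpa [strip] using ⟨h0, hπ⟩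

variable [TopologicalSpace Y]

namespace IsLocalForm

variable {p : Y} {a : ℕ} {b : ℤ} {ε : ℂ} {c r : ℝ} {τ : ℂ → Y} {w : ℂ} {k : ℕ}
  (h : IsLocalForm S x y p a b ε c r τ)
include h

theorem sheet_mem_fiber (hk : k ∈ sheetIndices ε a) (hw : w ∈ strip)
    (hball : sheet a k w ∈ Metric.ball 0 r) : τ (sheet a k w) ∈ fiber S x w := by
  obtain ⟨hka, hkε⟩ := mem_sheetIndices.1 hk
  refine ⟨(h.mem_iff _ hball).2 (sheet_im_pos hka hw), ?_⟩
  rw [h.apply_eq _ hball, sheet_pow h.exponent_ne_zero, ← mul_assoc, hkε, one_mul]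

theorem exists_sheet {t : ℂ} (ht : t ∈ Metric.ball 0 r) (hw : w ∈ strip)
    (hfiber : τ t ∈ fiber S x w) : ∃ k ∈ sheetIndices ε a, sheet a k w = t :=
  exists_sheet_of_pow_eq h.sign h.exponent_ne_zero ((h.mem_iff t ht).1 hfiber.1) hw
    ((h.apply_eq t ht).symm.trans hfiber.2)

theorem eventually_sheet_mem_ball (k : ℕ) :
    ∀ᶠ w in stripEnd, sheet a k w ∈ Metric.ball 0 r :=
  ((tendsto_sheet h.exponent_ne_zero k).mono_right nhdsWithin_le_nhds).eventually
    (Metric.ball_mem_nhds _ h.radius_pos)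

end IsLocalForm

/-- A finite set `Z` of real zeros of `x`, with local forms in disjoint neighbourhoods which contain
all points of `S` where `x` is small. -/
structure IsLocalFormFamily (S : Set Y) (x y : Y → ℂ) (Z : Finset Y) (a : Y → ℕ) (b : Y → ℤ)
    (ε : Y → ℂ) (c r : Y → ℝ) (τ : Y → ℂ → Y) : Prop where
  isLocalForm : ∀ p ∈ Z, IsLocalForm S x y p (a p) (b p) (ε p) (c p) (r p) (τ p)
  pairwiseDisjoint : (Z : Set Y).PairwiseDisjoint fun p => τ p '' Metric.ball 0 (r p)
  eventually_mem : ∀ᶠ z in 𝓝 (0 : ℂ), ∀ q ∈ S, x q = z → ∃ p ∈ Z, q ∈ τ p '' Metric.ball 0 (r p)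

namespace IsLocalFormFamily

variable {Z : Finset Y} {a : Y → ℕ} {b : Y → ℤ} {ε : Y → ℂ} {c r : Y → ℝ} {τ : Y → ℂ → Y}
  (h : IsLocalFormFamily S x y Z a b ε c r τ)
include h

theorem injOn_sheet {w : ℂ} (hball : ∀ p ∈ Z, ∀ k ∈ sheetIndices (ε p) (a p),
      sheet (a p) k w ∈ Metric.ball 0 (r p)) :
    InjOn (fun j : Σ _ : Y, ℕ => τ j.1 (sheet (a j.1) j.2 w))
      (Z.sigma fun p => sheetIndices (ε p) (a p)) := by
  rintro ⟨p, k⟩ hpk ⟨q, l⟩ hql heq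
  obtain ⟨hp, hk⟩ := Finset.mem_sigma.1 hpk
  obtain ⟨hq, hl⟩ := Finset.mem_sigma.1 hql
  obtain rfl : p = q := h.pairwiseDisjoint.elim_set hp hq _ ⟨_, hball p hp k hk, rfl⟩
    ⟨_, hball q hq l hl, heq.symm⟩
  obtain rfl : k = l := sheet_injOn (mem_sheetIndices.1 hk).1 (mem_sheetIndices.1 hl).1
    ((h.isLocalForm p hp).injOn (hball p hp k hk) (hball p hp l hl) heq)
  rfl

theorem eventually_fiberProd_eq :
    ∀ᶠ w in stripEnd, fiberProd S x y w =
      ∏ p ∈ Z, ∏ k ∈ sheetIndices (ε p) (a p), y (τ p (sheet (a p) k w)) := by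
  classical
  have hball : ∀ᶠ w in stripEnd, ∀ p ∈ Z, ∀ k ∈ sheetIndices (ε p) (a p),
      sheet (a p) k w ∈ Metric.ball 0 (r p) := by
    simp only [Finset.eventually_all]
    exact fun p hp k _ => (h.isLocalForm p hp).eventually_sheet_mem_ball k
  filter_upwards [hball, tendsto_exp_stripEnd.eventually h.eventually_mem, eventually_mem_strip]
    with w hballw hmem hw
  have hfiber : fiber S x w = ↑((Z.sigma fun p => sheetIndices (ε p) (a p)).image
      fun j => τ j.1 (sheet (a j.1) j.2 w)) := by
    ext q
    simp only [Finset.coe_image, mem_image, Finset.mem_coe, Finset.mem_sigma]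
    constructor
    · intro hq
      obtain ⟨p, hp, t, ht, rfl⟩ := hmem q hq.1 hq.2
      obtain ⟨k, hk, rfl⟩ := (h.isLocalForm p hp).exists_sheet ht hw hq
      exact ⟨⟨p, k⟩, ⟨hp, hk⟩, rfl⟩
    · rintro ⟨⟨p, k⟩, ⟨hp, hk⟩, rfl⟩
      exact (h.isLocalForm p hp).sheet_mem_fiber hk hw (hballw p hp k hk)
  rw [fiberProd, hfiber, finprod_mem_coe_finset, Finset.prod_image (h.injOn_sheet hballw),
    Finset.prod_sigma]

theorem hasStripEnd :
    HasStripEnd S x y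
      (∑ p ∈ Z, ∑ _k ∈ sheetIndices (ε p) (a p), (b p / a p : ℝ))
      (∑ p ∈ Z, ∑ k ∈ sheetIndices (ε p) (a p), (b p / a p * (k * Real.pi) : ℝ)) := by
  refine ⟨∏ p ∈ Z, ∏ _k ∈ sheetIndices (ε p) (a p), c p, Finset.prod_ne_zero_iff.2 fun p hp =>
    Finset.prod_ne_zero_iff.2 fun _ _ => (h.isLocalForm p hp).coeff_ne_zero, ?_⟩
  have hlim : Tendsto (fun w => ∏ p ∈ Z, ∏ k ∈ sheetIndices (ε p) (a p),
      y (τ p (sheet (a p) k w)) / (c p * sheet (a p) k w ^ b p)) stripEnd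
      (𝓝 (∏ p ∈ Z, ∏ _k ∈ sheetIndices (ε p) (a p), 1)) :=
    tendsto_finsetProd _ fun p hp => tendsto_finsetProd _ fun k _ =>
      (h.isLocalForm p hp).tendsto.comp (tendsto_sheet (h.isLocalForm p hp).exponent_ne_zero k)
  simp only [Finset.prod_const_one] at hlim
  refine hlim.congr' ?_
  filter_upwards [h.eventually_fiberProd_eq] with w hw
  simp_rw [hw, Finset.prod_div_distrib, Finset.prod_mul_distrib, sheet_zpow, ← Complex.exp_sum]
  congr 2
  · push_cast
    rfl
  · push_cast
    simp_rw [Finset.sum_mul, ← Finset.sum_add_distrib]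
    refine congrArg _ (Finset.sum_congr rfl fun p _ => Finset.sum_congr rfl fun k _ => ?_)
    ring

end IsLocalFormFamily

end StripEnd

section ExistsStripEnd

theorem ordAt_neg (x : X → ℂ) (p : X) : ordAt (-x) p = ordAt x p := by
  have hrep : chartRep (-x) p = (fun _ => (-1 : ℂ)) * chartRep x p := by
    ext z
    simp [chartRep]
  rw [ordAt, hrep, meromorphicOrderAt_mul_of_ne_zero analyticAt_const (by simp)]
  rfl

variable [IsManifold 𝓘(ℂ) 1 X] [CompactSpace X] {σ : X → X} {S : Set X} {x y : X → ℂ}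

theorem eventually_exists_mem_image_ball (hσ : Continuous σ)
    (hi : Function.Involutive σ) (hS : IsHalf σ S) (hx : IsRealFunction σ x) {Z : Finset X}
    (hZ : ∀ p, 0 < ordAt x p → p ∈ Z) {r : X → ℝ} {τ : X → ℂ → X}
    (hτ : ∀ p ∈ Z, τ p '' Metric.ball 0 (r p) ∈ 𝓝 p) :
    ∀ᶠ z in 𝓝 (0 : ℂ), ∀ q ∈ S, x q = z → ∃ p ∈ Z, q ∈ τ p '' Metric.ball 0 (r p) := by
  have hfiber := eventually_fiber_subset hσ hi hS hx (z₀ := 0)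
    (W := ⋃ p ∈ Z, interior (τ p '' Metric.ball 0 (r p)))
    (isOpen_biUnion fun p _ => isOpen_interior) fun p _ hord hp0 => by
      have hp : p ∈ Z := hZ p (hord.lt_of_ne fun h => hx.normal.ordAt_eq_zero_iff.1 h.symm hp0)
      exact mem_biUnion hp (mem_interior_iff_mem_nhds.2 (hτ p hp))
  filter_upwards [hfiber] with z hz q hq hqz
  obtain ⟨p, hp, hqp⟩ := mem_iUnion₂.1 (hz q hq hqz)
  exact ⟨p, hp, interior_subset hqp⟩

variable [T2Space X]

/-- The family for `-x` has the same local parameters as the family for `x`, so that the two ends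
can be compared zero by zero. -/
theorem exists_isLocalFormFamily (hσ : Continuous σ) (hi : Function.Involutive σ)
    (hS : IsHalf σ S) (hx : IsRealFunction σ x) (hy : IsRealFunction σ y) :
    ∃ Z a b ε c r τ, IsLocalFormFamily S x y Z a b ε c r τ ∧
      IsLocalFormFamily S (-x) y Z a b (-ε) c r τ := by
  have hfin : {p | 0 < ordAt x p}.Finite := by
    refine (finite_not_regularAt hx.normal.hasFiniteOrderAt).subset fun p hp h => ?_
    exact (show 0 < ordAt x p from hp).ne' (hx.normal.ordAt_eq_zero_iff.2 h.2)
  obtain ⟨U, hU, hUd⟩ := hfin.t2_separation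
  have hform : ∀ p, ∃ (a : ℕ) (b : ℤ) (ε : ℂ) (c r : ℝ) (τ : ℂ → X), 0 < ordAt x p →
      IsLocalForm S x y p a b ε c r τ ∧ τ '' Metric.ball 0 r ⊆ U p := by
    intro p
    by_cases hp : 0 < ordAt x p
    · obtain ⟨a, b, ε, c, r, τ, h⟩ :=
        exists_localForm hσ hi hS hx hy hp ((hU p).2.mem_nhds (hU p).1)
      exact ⟨a, b, ε, c, r, τ, fun _ => h⟩
    · exact ⟨0, 0, 0, 0, 0, fun _ => p, fun h => (hp h).elim⟩
  choose a b ε c r τ h using hform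
  have hlocal : ∀ p ∈ hfin.toFinset, IsLocalForm S x y p (a p) (b p) (ε p) (c p) (r p) (τ p) :=
    fun p hp => (h p (hfin.mem_toFinset.1 hp)).1
  have hdisj : (hfin.toFinset : Set X).PairwiseDisjoint fun p => τ p '' Metric.ball 0 (r p) := by
    rw [hfin.coe_toFinset]
    exact fun p hp q hq hpq => (hUd hp hq hpq).mono (h p hp).2 (h q hq).2
  have himage := fun p hp => (hlocal p hp).image_mem_nhds
  refine ⟨hfin.toFinset, a, b, ε, c, r, τ, ⟨hlocal, hdisj, ?_⟩,
    ⟨fun p hp => (hlocal p hp).neg, hdisj, ?_⟩⟩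
  · exact eventually_exists_mem_image_ball hσ hi hS hx (fun p hp => hfin.mem_toFinset.2 hp) himage
  · exact eventually_exists_mem_image_ball hσ hi hS hx.neg
      (fun p hp => hfin.mem_toFinset.2 ((ordAt_neg x p).subst hp)) himage

theorem exists_hasStripEnd (hσ : Continuous σ) (hi : Function.Involutive σ) (hS : IsHalf σ S)
    (hx : IsRealFunction σ x) (hy : IsRealFunction σ y) :
    ∃ α β α' β' : ℝ, HasStripEnd S x y α β ∧ HasStripEnd S (-x) y α' β' ∧
      ∃ n : ℤ, (α + α') * (Real.pi ^ 2 / 2) + (β + β') * Real.pi = n * (Real.pi ^ 2 / 2) := by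
  obtain ⟨Z, a, b, ε, c, r, τ, hfam, hneg⟩ := exists_isLocalFormFamily hσ hi hS hx hy
  refine ⟨_, _, _, _, hfam.hasStripEnd, hneg.hasStripEnd, ∑ p ∈ Z, b p * a p, ?_⟩
  rw [← Finset.sum_add_distrib, ← Finset.sum_add_distrib, Finset.sum_mul, Finset.sum_mul,
    ← Finset.sum_add_distrib, Int.cast_sum, Finset.sum_mul]
  refine Finset.sum_congr rfl fun p hp => ?_
  have hlocal := hfam.isLocalForm p hp
  have ha : (a p : ℝ) ≠ 0 := by exact_mod_cast hlocal.exponent_ne_zero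
  have hgauss : ∑ k ∈ Finset.range (a p), (k : ℝ) = a p * (a p - 1) / 2 := by
    rw [← Nat.cast_sum, eq_div_iff two_ne_zero, ← Nat.cast_pred (Nat.pos_of_ne_zero
      hlocal.exponent_ne_zero)]
    exact_mod_cast Finset.sum_range_id_mul_two (a p)
  rw [Pi.neg_apply, sum_sheetIndices_add_neg hlocal.sign, sum_sheetIndices_add_neg hlocal.sign,
    Finset.sum_const, Finset.card_range, ← Finset.mul_sum, ← Finset.sum_mul, hgauss, nsmul_eq_mul]
  push_cast
  field_simp
  ring

end ExistsStripEnd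

section ImLimit

variable {Y : Type*} {S : Set Y} {x y : Y → ℂ}

theorem exists_im_sub_log_eq {D : Set ℂ} (hD : IsPreconnected D) {G R : ℂ → ℂ} {C : ℝ} (hC : C ≠ 0)
    (hG : ContinuousOn G D) (hR : ∀ w ∈ D, R w = Complex.exp (G w) / C)
    (hslit : ∀ w ∈ D, R w ∈ Complex.slitPlane) :
    ∃ n : ℤ, ∀ w ∈ D, (G w - Complex.log (R w)).im = n * Real.pi := by
  have hC' : (C : ℂ) ≠ 0 := by exact_mod_cast hC
  have hRc : ContinuousOn R D := (hG.cexp.div_const _).congr hR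
  have hcont : ContinuousOn (fun w => (G w - Complex.log (R w)).im / Real.pi) D :=
    (Complex.continuous_im.comp_continuousOn (hG.sub (hRc.clog hslit))).div_const _
  have hint : MapsTo (fun w => (G w - Complex.log (R w)).im / Real.pi) D
      (range ((↑) : ℤ → ℝ)) := by
    intro w hw
    have hexp : Complex.exp (G w - Complex.log (R w)) = C := by
      rw [Complex.exp_sub, Complex.exp_log (Complex.slitPlane_ne_zero (hslit w hw)), hR w hw]
      field_simp
    have him := congrArg Complex.im hexp
    rw [Complex.exp_im, Complex.ofReal_im, mul_eq_zero] at him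
    obtain ⟨n, hn⟩ := Real.sin_eq_zero_iff.1 (him.resolve_left (Real.exp_pos _).ne')
    exact ⟨n, by simp only [← hn, mul_div_cancel_right₀ _ Real.pi_ne_zero]⟩
  obtain ⟨_, ⟨n, rfl⟩, hn⟩ := hD.eqOn_const_of_mapsTo
    Int.isClosedEmbedding_coe_real.isInducing.isDiscrete_range hcont hint ⟨0, 0, by simp⟩
  exact ⟨n, fun w hw => (div_eq_iff Real.pi_ne_zero).1 (hn hw)⟩

theorem HasStripEnd.exists_tendsto_im {α β : ℝ} (h : HasStripEnd S x y α β) {F : ℂ → ℂ}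
    (hF : ContinuousOn F strip)
    (hexp : ∀ᶠ w in stripEnd, Complex.exp (F w) = fiberProd S x y w) :
    ∃ n : ℤ, Tendsto (fun w => (F w).im - (α * w.im + β)) stripEnd (𝓝 (n * Real.pi)) := by
  obtain ⟨C, hC, hlim⟩ := h
  set G : ℂ → ℂ := fun w => F w - (α * w + β * Complex.I) with hG
  set R : ℂ → ℂ := fun w => Complex.exp (G w) / C with hR
  have hRlim : Tendsto R stripEnd (𝓝 1) := by
    refine hlim.congr' ?_
    filter_upwards [hexp] with w hw
    rw [hR, hG, ← hw]
    simp only [Complex.exp_sub]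
    rw [div_div, mul_comm]
  obtain ⟨s₀, hs₀⟩ := eventually_stripEnd_iff.1
    (hRlim.eventually (Metric.ball_mem_nhds (1 : ℂ) one_pos))
  obtain ⟨n, hn⟩ : ∃ n : ℤ, ∀ w ∈ strip ∩ {w | w.re < s₀},
      (G w - Complex.log (R w)).im = n * Real.pi := exists_im_sub_log_eq
    (convex_strip.inter (convex_halfSpace_re_lt s₀)).isPreconnected hC
    ((hF.mono inter_subset_left).sub (by fun_prop)) (fun _ _ => rfl)
    fun w hw => Complex.ball_one_subset_slitPlane (hs₀ w hw.1 hw.2)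
  have hlog : Tendsto (fun w => (Complex.log (R w)).im + n * Real.pi) stripEnd
      (𝓝 (n * Real.pi)) := by
    have hlog_one : Tendsto (Complex.log ∘ R) stripEnd (𝓝 0) := by
      simpa using (continuousAt_clog (x := 1) (by simp)).tendsto.comp hRlim
    simpa using ((Complex.continuous_im.tendsto 0).comp hlog_one).add_const (n * Real.pi)
  refine ⟨n, hlog.congr' (eventually_stripEnd_iff.2 ⟨s₀, fun w hw hws => ?_⟩)⟩
  rw [← hn w ⟨hw, hws⟩, hG]
  simp

end ImLimit

section StripIntegral

theorem measurableEquivRealProd_symm_eq (q : ℝ × ℝ) :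
    Complex.measurableEquivRealProd.symm q = q.1 + q.2 * Complex.I := by
  apply Complex.ext <;> simp [Complex.measurableEquivRealProd]

theorem volume_restrict_preimage_strip :
    (volume : Measure (ℝ × ℝ)).restrict (Complex.measurableEquivRealProd.symm ⁻¹' strip) =
      (volume : Measure ℝ).prod (volume.restrict (Ioo 0 Real.pi)) := by
  have hpre : Complex.measurableEquivRealProd.symm ⁻¹' strip = univ ×ˢ Ioo 0 Real.pi := by
    ext q
    simp [strip]
  rw [hpre, Measure.volume_eq_prod, ← Measure.prod_restrict, Measure.restrict_univ]

theorem integrable_comp_of_integrableOn_strip {g : ℂ → ℝ} (hg : IntegrableOn g strip) :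
    Integrable (fun q : ℝ × ℝ => g (q.1 + q.2 * Complex.I))
      ((volume : Measure ℝ).prod (volume.restrict (Ioo 0 Real.pi))) := by
  rw [← volume_restrict_preimage_strip]
  simp_rw [← measurableEquivRealProd_symm_eq]
  exact (Complex.volume_preserving_equiv_real_prod.symm.integrableOn_comp_preimage
    (MeasurableEquiv.measurableEmbedding _)).2 hg

theorem setIntegral_strip {g : ℂ → ℝ} (hg : IntegrableOn g strip) :
    ∫ w in strip, g w = ∫ θ in Ioo 0 Real.pi, ∫ s : ℝ, g (s + θ * Complex.I) := by
  rw [← integral_prod_symm _ (integrable_comp_of_integrableOn_strip hg),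
    ← volume_restrict_preimage_strip]
  simp_rw [← measurableEquivRealProd_symm_eq]
  exact (Complex.volume_preserving_equiv_real_prod.symm.setIntegral_preimage_emb
    (MeasurableEquiv.measurableEmbedding _) _ _).symm

theorem integral_line_im_deriv {F : ℂ → ℂ} (hF : DifferentiableOn ℂ F strip) {θ : ℝ}
    (hθ : θ ∈ Ioo 0 Real.pi)
    (hint : Integrable fun s : ℝ => (deriv F (s + θ * Complex.I)).im) {α β B α' β' B' : ℝ}
    (hbot : Tendsto (fun w => (F w).im - (α * w.im + β)) stripEnd (𝓝 B))
    (htop : Tendsto (fun w => (F (Real.pi * Complex.I - w)).im - (α' * w.im + β'))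
      stripEnd (𝓝 B')) :
    ∫ s : ℝ, (deriv F (s + θ * Complex.I)).im =
      (α' * (Real.pi - θ) + β' + B') - (α * θ + β + B) := by
  have hmem : ∀ s : ℝ, (s : ℂ) + θ * Complex.I ∈ strip := fun s => by simpa [strip] using hθ
  refine integral_of_hasDerivAt_of_tendsto (f := fun s : ℝ => (F (s + θ * Complex.I)).im)
    (fun s => ?_) hint ?_ ?_
  · have hline : HasDerivAt (fun s : ℝ => (s : ℂ) + θ * Complex.I) 1 s :=
      Complex.ofRealCLM.hasDerivAt.add_const _
    have hcomp := (hF.differentiableAt (isOpen_strip.mem_nhds (hmem s))).hasDerivAt.comp s hline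
    rw [mul_one] at hcomp
    exact Complex.imCLM.hasFDerivAt.comp_hasDerivAt s hcomp
  · rw [add_comm]
    refine ((hbot.comp (tendsto_stripEnd hθ.1 hθ.2)).add_const (α * θ + β)).congr fun s => ?_
    simp
  · have hend := htop.comp (tendsto_stripEnd (θ := Real.pi - θ) (by linarith [hθ.2])
      (by linarith [hθ.1]))
    rw [add_comm]
    refine ((hend.add_const (α' * (Real.pi - θ) + β')).comp tendsto_neg_atTop_atBot).congr
      fun s => ?_
    have hreflect : Real.pi * Complex.I - (((-s : ℝ) : ℂ) + ((Real.pi - θ : ℝ) : ℂ) * Complex.I) =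
        s + θ * Complex.I := by
      push_cast
      ring
    simp only [Function.comp_apply, hreflect]
    simp

theorem setIntegral_strip_im_deriv {F : ℂ → ℂ} (hF : DifferentiableOn ℂ F strip)
    (hint : IntegrableOn (fun w => (deriv F w).im) strip) {α β B α' β' B' : ℝ}
    (hbot : Tendsto (fun w => (F w).im - (α * w.im + β)) stripEnd (𝓝 B))
    (htop : Tendsto (fun w => (F (Real.pi * Complex.I - w)).im - (α' * w.im + β'))
      stripEnd (𝓝 B')) :
    ∫ w in strip, (deriv F w).im =
      (α' * (Real.pi ^ 2 / 2) + β' * Real.pi + B' * Real.pi) -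
        (α * (Real.pi ^ 2 / 2) + β * Real.pi + B * Real.pi) := by
  have hline : ∀ᵐ θ : ℝ ∂(volume.restrict (Ioo 0 Real.pi)),
      ∫ s : ℝ, (deriv F (s + θ * Complex.I)).im =
        (α' * (Real.pi - θ) + β' + B') - (α * θ + β + B) := by
    filter_upwards [(integrable_comp_of_integrableOn_strip hint).prod_left_ae,
      ae_restrict_mem measurableSet_Ioo] with θ hintθ hθ
    exact integral_line_im_deriv hF hθ hintθ hbot htop
  rw [setIntegral_strip hint, integral_congr_ae hline, ← integral_Ioc_eq_integral_Ioo,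
    ← intervalIntegral.integral_of_le Real.pi_pos.le]
  have hlinear : ∀ θ : ℝ, (α' * (Real.pi - θ) + β' + B') - (α * θ + β + B) =
      (α' * Real.pi + β' + B' - β - B) - (α' + α) * θ := fun θ => by ring
  simp_rw [hlinear]
  rw [intervalIntegral.integral_sub (by simp)
      ((continuous_const_mul (α' + α)).intervalIntegrable _ _),
    intervalIntegral.integral_const_mul, intervalIntegral.integral_const, integral_id, smul_eq_mul]
  ring

end StripIntegral

theorem norm_finprod_mem_le_pow {α : Type*} {s : Set α} (hs : s.Finite) {g : α → ℂ} {M : ℝ}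
    (hM : 1 ≤ M) (hg : ∀ q ∈ s, ‖g q‖ ≤ M) {n : ℕ} (hn : s.ncard ≤ n) :
    ‖∏ᶠ q ∈ s, g q‖ ≤ M ^ n := by
  rw [finprod_mem_eq_finite_toFinset_prod _ hs, norm_prod]
  calc ∏ q ∈ hs.toFinset, ‖g q‖
      ≤ ∏ _q ∈ hs.toFinset, M :=
        Finset.prod_le_prod (fun _ _ => norm_nonneg _) fun q hq => hg q (hs.mem_toFinset.1 hq)
    _ = M ^ s.ncard := by rw [Finset.prod_const, ncard_eq_toFinset_card s hs]
    _ ≤ M ^ n := pow_le_pow_right₀ hM hn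

section RealPair

/-- Two real functions on a Riemann surface with a chosen half `S`, the first of them with
isolated critical points: the first serves as the coordinate on the base, the second as the
function whose fiberwise norm is taken. -/
structure IsRealPair (σ : X → X) (S : Set X) (x y : X → ℂ) : Prop where
  continuous : Continuous σ
  involutive : Function.Involutive σ
  isHalf : IsHalf σ S
  fst : IsRealFunction σ x
  snd : IsRealFunction σ y
  isolated : ∀ p, ∀ᶠ q in 𝓝[≠] p, mfderiv 𝓘(ℂ) 𝓘(ℂ) x q ≠ 0

/-- The sheets of `x` over `V`, in the logarithmic coordinate `w` of the base: sections `κ p`,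
`p ∈ T`, of `x` over `exp V`, which are distinct at every point and exhaust `S`. -/
structure IsSheets (S : Set X) (x : X → ℂ) (V : Set ℂ) (T : Finset X) (κ : X → ℂ → X) : Prop where
  isParametrization : ∀ p ∈ T, IsParametrization (κ p) V
  mem_fiber : ∀ p ∈ T, ∀ w ∈ V, κ p w ∈ fiber S x w
  exists_eq : ∀ w ∈ V, ∀ q ∈ fiber S x w, ∃ p ∈ T, κ p w = q
  injOn : ∀ w ∈ V, InjOn (fun p => κ p w) T

/-- The critical values of `x` on `S`, in the logarithmic coordinate of the upper half plane. -/
def criticalValues (S : Set X) (x : X → ℂ) : Set ℂ :=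
  {w | w ∈ strip ∧ ∃ p ∈ fiber S x w, mfderiv 𝓘(ℂ) 𝓘(ℂ) x p = 0}

theorem isSheets_of_log_coordinates {S : Set X} {x : X → ℂ} {V : Set ℂ} {T : Finset X}
    {Ψ : X → OpenPartialHomeomorph X ℂ} (hx : ∀ q ∈ S, x q ≠ 0)
    (hVstrip : V ⊆ strip) (hVtarget : ∀ p ∈ T, V ⊆ (Ψ p).target)
    (hΨ : ∀ p ∈ T, ∀ w ∈ V, MDifferentiableAt 𝓘(ℂ) 𝓘(ℂ) (Ψ p).symm w)
    (hlog : ∀ p ∈ T, ∀ q ∈ (Ψ p).source, Ψ p q = Complex.log (x q))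
    (hsource : ∀ p ∈ T, (Ψ p).source ⊆ S)
    (hdisj : (T : Set X).PairwiseDisjoint fun p => (Ψ p).source)
    (hfiber : ∀ w ∈ V, fiber S x w ⊆ ⋃ p ∈ T, (Ψ p).source) :
    IsSheets S x V T fun p => (Ψ p).symm where
  isParametrization p hp := ⟨hΨ p hp, (Ψ p).symm.injOn.mono (hVtarget p hp)⟩
  mem_fiber p hp w hw := by
    have hs := (Ψ p).map_target (hVtarget p hp hw)
    refine ⟨hsource p hp hs, ?_⟩
    rw [← Complex.exp_log (hx _ (hsource p hp hs)), ← hlog p hp _ hs,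
      (Ψ p).right_inv (hVtarget p hp hw)]
  exists_eq w hw q hq := by
    obtain ⟨p, hp, hqp⟩ := mem_iUnion₂.1 (hfiber w hw hq)
    refine ⟨p, hp, ?_⟩
    rw [← log_exp_of_mem_strip (hVstrip hw), ← hq.2, ← hlog p hp q hqp, (Ψ p).left_inv hqp]
  injOn w hw p hp q hq hpq := by
    have hpq' : (Ψ p).symm w = (Ψ q).symm w := hpq
    have hq' := (Ψ q).map_target (hVtarget q hq hw)
    exact hdisj.elim_set hp hq _ ((Ψ p).map_target (hVtarget p hp hw)) (hpq' ▸ hq')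

namespace IsRealPair

variable {σ : X → X} {S : Set X} {x y : X → ℂ} (h : IsRealPair σ S x y)
include h

theorem fst_ne_zero {p : X} (hp : p ∈ S) : x p ≠ 0 := h.fst.ne_zero p (h.isHalf.ne_of_mem hp)

theorem snd_ne_zero {p : X} (hp : p ∈ S) : y p ≠ 0 := h.snd.ne_zero p (h.isHalf.ne_of_mem hp)

theorem finite_criticalValues [CompactSpace X] : (criticalValues S x).Finite := by
  have hfin : {p | mfderiv 𝓘(ℂ) 𝓘(ℂ) x p = 0}.Finite :=
    finite_of_eventually_nhdsNE fun p => by simpa using h.isolated p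
  refine Set.Finite.of_finite_image (f := Complex.exp) ((hfin.image x).subset ?_)
    (injOn_exp_strip.mono fun w hw => hw.1)
  rintro _ ⟨w, ⟨-, p, hp, hc⟩, rfl⟩
  exact ⟨p, hc, hp.2⟩

theorem fst_analyticAt {p : X} (hp : p ∈ S) :
    AnalyticAt ℂ (chartRep x p) (chartAt ℂ p p) :=
  h.fst.normal.ordAt_nonneg_iff.1 (h.fst.normal.ordAt_eq_zero_iff.2 (h.fst_ne_zero hp)).ge

variable [IsManifold 𝓘(ℂ) 1 X]

theorem fst_mdifferentiableAt {p : X} (hp : p ∈ S) : MDifferentiableAt 𝓘(ℂ) 𝓘(ℂ) x p :=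
  (h.fst.normal.regularAt_iff.2 (h.fst_ne_zero hp)).1

theorem snd_mdifferentiableAt {p : X} (hp : p ∈ S) : MDifferentiableAt 𝓘(ℂ) 𝓘(ℂ) y p :=
  (h.snd.normal.regularAt_iff.2 (h.snd_ne_zero hp)).1

theorem eventually_chartRep_sub_ne_zero (c : ℂ) (p : X) :
    ∀ᶠ z in 𝓝[≠] (chartAt ℂ p p), chartRep x p z - c ≠ 0 := by
  have hm : MeromorphicAt (fun z => chartRep x p z - c) (chartAt ℂ p p) :=
    (h.fst.normal.normalForm p).meromorphicAt.sub (MeromorphicAt.const c _)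
  refine hm.eventually_eq_zero_or_eventually_ne_zero.resolve_left fun h0 => ?_
  have hderiv : ∀ᶠ z in 𝓝[≠] (chartAt ℂ p p), deriv (chartRep x p) z = 0 := by
    filter_upwards [eventually_eventually_nhdsWithin.2 h0, self_mem_nhdsWithin] with z hz hne
    rw [isOpen_compl_singleton.nhdsWithin_eq hne] at hz
    have hconst : chartRep x p =ᶠ[𝓝 z] fun _ => c := hz.mono fun _ => sub_eq_zero.1
    rw [hconst.deriv_eq, deriv_const]
  have hsource : ∀ᶠ q in 𝓝[≠] p, q ∈ (chartAt ℂ p).source :=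
    eventually_nhdsWithin_of_eventually_nhds (chart_source_mem_nhds ℂ p)
  have := nhdsNE_neBot p
  obtain ⟨q, hq0, hqc, hqs, hqr⟩ := (((tendsto_chartAt_nhdsNE p).eventually hderiv).and
    ((h.isolated p).and
      (hsource.and (h.fst.normal.hasFiniteOrderAt p).eventually_regularAt))).exists
  exact hqc ((mfderiv_eq_zero_iff_of_mem_atlas (chart_mem_atlas ℂ p) hqs hqr.1).2 hq0)

theorem finite_fiber [CompactSpace X] (w : ℂ) : (fiber S x w).Finite := by
  refine finite_of_eventually_nhdsNE fun p => ?_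
  apply eventually_nhdsNE_of_chartAt
  filter_upwards [h.eventually_chartRep_sub_ne_zero (Complex.exp w) p] with z hz hf
  exact hz (sub_eq_zero.2 hf.2)

theorem eventually_fiber_subset [CompactSpace X] {w₀ : ℂ} (hw₀ : w₀ ∈ strip) {W : Set X}
    (hW : IsOpen W) (hfib : fiber S x w₀ ⊆ W) : ∀ᶠ w in 𝓝 w₀, fiber S x w ⊆ W := by
  have hev : ∀ᶠ z in 𝓝 (Complex.exp w₀), ∀ q ∈ S, x q = z → q ∈ W :=
    QuantumIndex.eventually_fiber_subset h.continuous h.involutive h.isHalf h.fst hW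
      fun p hp _ hpw => (h.isHalf.mem_or hp).elim (fun hS => hfib ⟨hS, hpw⟩) fun hfix =>
        absurd (hpw ▸ h.fst.im_eq_zero h.continuous hfix) (exp_im_pos hw₀).ne'
  filter_upwards [Complex.continuous_exp.continuousAt.eventually hev] with w hw q hq
  exact hw q hq.1 hq.2

theorem exists_log_coordinate {w₀ : ℂ} (hw₀ : w₀ ∈ strip) {p : X} (hp : p ∈ fiber S x w₀)
    (hd : mfderiv 𝓘(ℂ) 𝓘(ℂ) x p ≠ 0) {O : Set X} (hO : O ∈ 𝓝 p) :
    ∃ Ψ : OpenPartialHomeomorph X ℂ, IsCoordinateAt Ψ p ∧ Ψ.source ⊆ O ∧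
      ∀ q ∈ Ψ.source, Ψ q = Complex.log (x q) := by
  have hslit : chartRep x p (chartAt ℂ p p) ∈ Complex.slitPlane := by
    rw [chartRep_self, hp.2]
    exact Or.inr (exp_im_pos hw₀).ne'
  have han := h.fst_analyticAt hp.1
  have hd' : deriv (chartRep x p) (chartAt ℂ p p) ≠ 0 :=
    mt (mfderiv_eq_zero_iff_of_mem_atlas (chart_mem_atlas ℂ p) (mem_chart_source ℂ p)
      (h.fst_mdifferentiableAt hp.1)).2 hd
  have hdlog : deriv (fun z => Complex.log (chartRep x p z)) (chartAt ℂ p p) ≠ 0 := by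
    rw [(han.differentiableAt.hasDerivAt.clog hslit).deriv]
    exact div_ne_zero hd' (Complex.slitPlane_ne_zero hslit)
  obtain ⟨Ψ, hΨ, hΨO, hΨx⟩ := exists_coordinate (han.clog hslit) hdlog
    (inter_mem (chart_source_mem_nhds ℂ p) hO)
  refine ⟨Ψ, hΨ, hΨO.trans inter_subset_right, fun q hq => ?_⟩
  rw [hΨx q, chartRep, (chartAt ℂ p).left_inv (hΨO hq).1]

theorem exists_isSheets [CompactSpace X] [T2Space X] {w₀ : ℂ} (hw₀ : w₀ ∈ strip)
    (hc : w₀ ∉ criticalValues S x) :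
    ∃ V, IsOpen V ∧ w₀ ∈ V ∧ V ⊆ strip ∧ ∃ (T : Finset X) (κ : X → ℂ → X),
      IsSheets S x V T κ := by
  have hfin := h.finite_fiber w₀
  obtain ⟨U, hU, hUd⟩ := hfin.t2_separation
  have hcoord (p : X) : ∃ Ψ : OpenPartialHomeomorph X ℂ, p ∈ fiber S x w₀ →
      IsCoordinateAt Ψ p ∧ Ψ.source ⊆ U p ∩ S ∧ ∀ q ∈ Ψ.source, Ψ q = Complex.log (x q) := by
    by_cases hp : p ∈ fiber S x w₀
    · obtain ⟨Ψ, hΨ⟩ := h.exists_log_coordinate hw₀ hp (fun hd => hc ⟨hw₀, p, hp, hd⟩)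
        (((hU p).2.inter h.isHalf.isOpen).mem_nhds ⟨(hU p).1, hp.1⟩)
      exact ⟨Ψ, fun _ => hΨ⟩
    · exact ⟨chartAt ℂ p, fun hp' => absurd hp' hp⟩
  choose Ψ hΨ using hcoord
  have hmem : ∀ p ∈ hfin.toFinset, p ∈ fiber S x w₀ := fun p => hfin.mem_toFinset.1
  have htarget : ∀ᶠ w in 𝓝 w₀, ∀ p ∈ hfin.toFinset, w ∈ (Ψ p).target := by
    refine (Finset.eventually_all _).2 fun p hp => ?_
    obtain ⟨hΨp, -, hlog⟩ := hΨ p (hmem p hp)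
    have hp₀ : Ψ p p = w₀ := by
      rw [hlog p hΨp.mem_source, (hmem p hp).2, log_exp_of_mem_strip hw₀]
    exact (Ψ p).open_target.mem_nhds (hp₀ ▸ (Ψ p).map_source hΨp.mem_source)
  have hfiber := h.eventually_fiber_subset hw₀ (W := ⋃ p ∈ hfin.toFinset, (Ψ p).source)
    (isOpen_biUnion fun p _ => (Ψ p).open_source)
    fun p hp => mem_biUnion (hfin.mem_toFinset.2 hp) (hΨ p hp).1.mem_source
  obtain ⟨V, hV, hVo, hwV⟩ := mem_nhds_iff.1
    (htarget.and (hfiber.and (isOpen_strip.mem_nhds hw₀)))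
  refine ⟨V, hVo, hwV, fun w hw => (hV hw).2.2, hfin.toFinset, fun p => (Ψ p).symm,
    isSheets_of_log_coordinates (fun q hq => h.fst_ne_zero hq) (fun w hw => (hV hw).2.2)
      (fun p hp w hw => (hV hw).1 p hp) (fun p hp w hw => ?_)
      (fun p hp => (hΨ p (hmem p hp)).2.2)
      (fun p hp => (hΨ p (hmem p hp)).2.1.trans inter_subset_right)
      (fun p hp q hq hpq => ?_) fun w hw => (hV hw).2.1⟩
  · exact (hΨ p (hmem p hp)).1.mdifferentiableAt_symm w ((hV hw).1 p hp)
  · exact (hUd (hmem p hp) (hmem q hq) hpq).mono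
      ((hΨ p (hmem p hp)).2.1.trans inter_subset_left)
      ((hΨ q (hmem q hq)).2.1.trans inter_subset_left)

theorem exists_analyticOrderAt_eq {w₀ : ℂ} {p : X} (hp : p ∈ fiber S x w₀) :
    ∃ n : ℕ, n ≠ 0 ∧
      analyticOrderAt (fun z => chartRep x p z - Complex.exp w₀) (chartAt ℂ p p) = n := by
  set g := fun z => chartRep x p z - Complex.exp w₀
  have hg : AnalyticAt ℂ g (chartAt ℂ p p) := (h.fst_analyticAt hp.1).sub analyticAt_const
  have htop : analyticOrderAt g (chartAt ℂ p p) ≠ ⊤ := fun htop => by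
    have h0 := eventually_nhdsWithin_of_eventually_nhds (s := {chartAt ℂ p p}ᶜ)
      (analyticOrderAt_eq_top.1 htop)
    obtain ⟨z, hz, hz'⟩ := (h0.and (h.eventually_chartRep_sub_ne_zero _ p)).exists
    exact hz' hz
  obtain ⟨n, hn⟩ := ENat.ne_top_iff_exists.1 htop
  refine ⟨n, ?_, hn.symm⟩
  rintro rfl
  refine hg.analyticOrderAt_eq_zero.1 hn.symm ?_
  simp only [g]
  rw [chartRep_self, hp.2, sub_self]

/-- Near a point of `S`, possibly critical for `x`, the fibers of `x` are sets of roots of a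
fixed order. -/
theorem exists_isOpen_ncard_fiber_le {w₀ : ℂ} {p : X} (hp : p ∈ fiber S x w₀) {O : Set X}
    (hO : O ∈ 𝓝 p) :
    ∃ (n : ℕ) (W : Set X), IsOpen W ∧ p ∈ W ∧ W ⊆ O ∧ ∀ w, (fiber S x w ∩ W).ncard ≤ n := by
  classical
  obtain ⟨n, hn0, hn⟩ := h.exists_analyticOrderAt_eq hp
  obtain ⟨Ψ, hΨ, hΨO, -, hx⟩ := exists_root_coordinate hn0 (h.fst_analyticAt hp.1) hn hO
  refine ⟨n, Ψ.source, Ψ.open_source, hΨ.mem_source, hΨO, fun w => ?_⟩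
  set R := (Polynomial.nthRoots n (Complex.exp w - Complex.exp w₀)).toFinset
  have hsub : Ψ '' (fiber S x w ∩ Ψ.source) ⊆ R := by
    rintro _ ⟨q, ⟨hq, hqs⟩, rfl⟩
    have hroot : Ψ q ^ n = Complex.exp w - Complex.exp w₀ := by
      rw [← hq.2, hx q hqs, add_sub_cancel_left]
    simpa [R, Polynomial.mem_nthRoots (Nat.pos_of_ne_zero hn0)] using hroot
  calc (fiber S x w ∩ Ψ.source).ncard
      = (Ψ '' (fiber S x w ∩ Ψ.source)).ncard :=
        ((Ψ.injOn.mono inter_subset_right).ncard_image).symm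
    _ ≤ R.card := by
        rw [← ncard_coe_finset]
        exact ncard_le_ncard hsub R.finite_toSet
    _ ≤ n := (Multiset.toFinset_card_le _).trans (Polynomial.card_nthRoots n _)

theorem exists_eventually_norm_fiberProd_le [CompactSpace X] {w₀ : ℂ} (hw₀ : w₀ ∈ strip) :
    ∃ B : ℝ, ∀ᶠ w in 𝓝 w₀, ‖fiberProd S x y w‖ ≤ B ∧ ‖(fiberProd S x y w)⁻¹‖ ≤ B := by
  have hfin := h.finite_fiber w₀
  obtain ⟨m, hm⟩ : ∃ m, ∀ p ∈ fiber S x w₀, ‖y p‖ < m ∧ ‖(y p)⁻¹‖ < m := by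
    obtain ⟨m, hm⟩ := (hfin.image fun p => ‖y p‖ + ‖(y p)⁻¹‖).bddAbove
    refine ⟨m + 1, fun p hp => ?_⟩
    have hle : ‖y p‖ + ‖(y p)⁻¹‖ ≤ m := hm (mem_image_of_mem _ hp)
    constructor <;> linarith [norm_nonneg (y p), norm_nonneg (y p)⁻¹]
  have hlocal (p : X) : ∃ (n : ℕ) (W : Set X), IsOpen W ∧ (p ∈ fiber S x w₀ →
      p ∈ W ∧ (∀ q ∈ W, ‖y q‖ < m ∧ ‖(y q)⁻¹‖ < m) ∧ ∀ w, (fiber S x w ∩ W).ncard ≤ n) := by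
    by_cases hp : p ∈ fiber S x w₀
    · have hyc := (h.snd_mdifferentiableAt hp.1).continuousAt
      have hO := (hyc.norm.eventually_lt_const (hm p hp).1).and
        ((hyc.inv₀ (h.snd_ne_zero hp.1)).norm.eventually_lt_const (hm p hp).2)
      obtain ⟨n, W, hWo, hpW, hWO, hn⟩ := h.exists_isOpen_ncard_fiber_le hp hO
      exact ⟨n, W, hWo, fun _ => ⟨hpW, hWO, hn⟩⟩
    · exact ⟨0, ∅, isOpen_empty, fun hp' => absurd hp' hp⟩
  choose n W hWo hW using hlocal
  have hmem : ∀ p ∈ hfin.toFinset, p ∈ fiber S x w₀ := fun p => hfin.mem_toFinset.1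
  set k := ∑ p ∈ hfin.toFinset, n p
  refine ⟨max 1 m ^ k, ?_⟩
  filter_upwards [h.eventually_fiber_subset hw₀ (W := ⋃ p ∈ hfin.toFinset, W p)
    (isOpen_biUnion fun p _ => hWo p)
    fun p hp => mem_biUnion (hfin.mem_toFinset.2 hp) (hW p hp).1] with w hw
  have hcard : (fiber S x w).ncard ≤ k := by
    have hunion : fiber S x w = ⋃ p ∈ hfin.toFinset, fiber S x w ∩ W p := by
      rw [← inter_iUnion₂, inter_eq_left.2 hw]
    rw [hunion]
    exact (Finset.set_ncard_biUnion_le _ _).trans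
      (Finset.sum_le_sum fun p hp => (hW p (hmem p hp)).2.2 w)
  have hbound : ∀ q ∈ fiber S x w, ‖y q‖ < m ∧ ‖(y q)⁻¹‖ < m := fun q hq => by
    obtain ⟨p, hp, hqp⟩ := mem_iUnion₂.1 (hw hq)
    exact (hW p (hmem p hp)).2.1 q hqp
  rw [fiberProd, ← finprod_mem_inv_distrib _ (h.finite_fiber w)]
  exact ⟨norm_finprod_mem_le_pow (h.finite_fiber w) (le_max_left _ _)
      (fun q hq => (hbound q hq).1.le.trans (le_max_right _ _)) hcard,
    norm_finprod_mem_le_pow (h.finite_fiber w) (le_max_left _ _)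
      (fun q hq => (hbound q hq).2.le.trans (le_max_right _ _)) hcard⟩

end IsRealPair

end RealPair

section HolomorphicExtension

variable {U B : Set ℂ}

theorem eventually_nhdsNE_mem_diff (hU : IsOpen U) (hB : B.Finite) {w : ℂ} (hw : w ∈ U) :
    ∀ᶠ v in 𝓝[≠] w, v ∈ U \ B :=
  (eventually_nhdsWithin_of_eventually_nhds (hU.mem_nhds hw)).and (eventually_nhdsNE_of_finite hB w)

theorem exists_differentiableOn_extension {G : ℂ → ℂ} (hU : IsOpen U) (hB : B.Finite)
    (hG : DifferentiableOn ℂ G (U \ B)) (hb : ∀ w ∈ U, ∃ M : ℝ, ∀ᶠ v in 𝓝 w, ‖G v‖ ≤ M) :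
    ∃ Y : ℂ → ℂ, DifferentiableOn ℂ Y U ∧ EqOn Y G (U \ B) := by
  have hopen : IsOpen (U \ B) := hU.sdiff hB.isClosed
  set Y : ℂ → ℂ := fun w => limUnder (𝓝[≠] w) G
  have heq : EqOn Y G (U \ B) := fun w hw =>
    ((hG.differentiableAt (hopen.mem_nhds hw)).continuousAt.tendsto.mono_left
      nhdsWithin_le_nhds).limUnder_eq
  refine ⟨Y, fun w hw => DifferentiableAt.differentiableWithinAt ?_, heq⟩
  obtain ⟨M, hM⟩ := hb w hw
  set s := {v | ‖G v‖ ≤ M ∧ (v ∈ ({w}ᶜ : Set ℂ) → v ∈ U \ B)}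
  have hs : s ∈ 𝓝 w :=
    hM.and (eventually_nhdsWithin_iff.1 (eventually_nhdsNE_mem_diff hU hB hw))
  have hsub : s \ {w} ⊆ U \ B := fun v hv => hv.1.2 hv.2
  have hupdate := Complex.differentiableOn_update_limUnder_of_bddAbove hs (hG.mono hsub)
    ⟨M, by rintro _ ⟨v, hv, rfl⟩; exact hv.1.1⟩
  refine (hupdate.congr fun v hv => ?_).differentiableAt hs
  by_cases hvw : v = w
  · subst hvw
    rw [Function.update_self]
  · rw [Function.update_of_ne hvw]
    exact heq (hsub ⟨hv, hvw⟩)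

theorem exists_differentiableOn_extension_ne_zero {G : ℂ → ℂ} (hU : IsOpen U) (hB : B.Finite)
    (hG : DifferentiableOn ℂ G (U \ B)) (h0 : ∀ w ∈ U \ B, G w ≠ 0)
    (hb : ∀ w ∈ U, ∃ M : ℝ, ∀ᶠ v in 𝓝 w, ‖G v‖ ≤ M ∧ ‖(G v)⁻¹‖ ≤ M) :
    ∃ Y : ℂ → ℂ, DifferentiableOn ℂ Y U ∧ (∀ w ∈ U, Y w ≠ 0) ∧ EqOn Y G (U \ B) := by
  obtain ⟨Y, hY, hYG⟩ := exists_differentiableOn_extension hU hB hG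
    fun w hw => (hb w hw).imp fun _ hM => hM.mono fun _ => And.left
  obtain ⟨Z, hZ, hZG⟩ := exists_differentiableOn_extension hU hB (hG.inv h0)
    fun w hw => (hb w hw).imp fun _ hM => hM.mono fun _ => And.right
  refine ⟨Y, hY, fun w hw => ?_, hYG⟩
  have hYZ : Tendsto (fun v => Y v * Z v) (𝓝[≠] w) (𝓝 (Y w * Z w)) :=
    (((hY.differentiableAt (hU.mem_nhds hw)).continuousAt.mul
      (hZ.differentiableAt (hU.mem_nhds hw)).continuousAt).tendsto).mono_left nhdsWithin_le_nhds
  have hone : Tendsto (fun v => Y v * Z v) (𝓝[≠] w) (𝓝 1) :=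
    tendsto_const_nhds.congr' <| (eventually_nhdsNE_mem_diff hU hB hw).mono fun v hv => by
      simp only [hYG hv, hZG hv, Pi.inv_apply, mul_inv_cancel₀ (h0 v hv)]
  exact left_ne_zero_of_mul_eq_one (tendsto_nhds_unique hYZ hone)

theorem differentiableAt_of_exp {F : ℂ → ℂ} {w : ℂ} (hF : ContinuousAt F w)
    (hexp : DifferentiableAt ℂ (fun v => Complex.exp (F v)) w) : DifferentiableAt ℂ F w := by
  have hlog : DifferentiableAt ℂ
      (fun v => F w + Complex.log (Complex.exp (F v) / Complex.exp (F w))) w :=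
    ((hexp.div_const _).clog (by simp [div_self])).const_add _
  refine hlog.congr_of_eventuallyEq ?_
  have him : Tendsto (fun v => (F v - F w).im) (𝓝 w) (𝓝 0) := by
    have hsub := Complex.continuous_im.continuousAt.tendsto.comp (hF.tendsto.sub_const (F w))
    rwa [sub_self, Complex.zero_im] at hsub
  filter_upwards [him.eventually (Ioo_mem_nhds (neg_lt_zero.2 Real.pi_pos) Real.pi_pos)] with v hv
  rw [← Complex.exp_sub, Complex.log_exp hv.1 hv.2.le, add_sub_cancel]

theorem exists_differentiableOn_log {Y : ℂ → ℂ} (hU : IsOpen U) (hc : Convex ℝ U)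
    (hne : U.Nonempty) (hY : DifferentiableOn ℂ Y U) (h0 : ∀ w ∈ U, Y w ≠ 0) :
    ∃ F : ℂ → ℂ, DifferentiableOn ℂ F U ∧ ∀ w ∈ U, Complex.exp (F w) = Y w := by
  have := hc.contractibleSpace hne
  have hsc : IsSimplyConnected U := inferInstanceAs (SimplyConnectedSpace U)
  obtain ⟨F, hFc, hF⟩ := Complex.exists_continuousOn_eqOn_exp_comp hsc hU hY.continuousOn
    (by rintro ⟨w, hw, h⟩; exact h0 w hw h)
  refine ⟨F, fun w hw => (differentiableAt_of_exp (hFc.continuousAt (hU.mem_nhds hw))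
    ?_).differentiableWithinAt, hF⟩
  exact (hY.differentiableAt (hU.mem_nhds hw)).congr_of_eventuallyEq
    (hF.eventuallyEq_of_mem (hU.mem_nhds hw))

end HolomorphicExtension

section LogFiberProd

namespace IsSheets

variable {S : Set X} {x : X → ℂ} {V : Set ℂ} {T : Finset X} {κ : X → ℂ → X}

theorem fiberProd_eq (hκ : IsSheets S x V T κ) (y : X → ℂ) {w : ℂ} (hw : w ∈ V) :
    fiberProd S x y w = ∏ p ∈ T, y (κ p w) := by
  have hfiber : fiber S x w = (fun p => κ p w) '' T :=
    Subset.antisymm (fun q hq => hκ.exists_eq w hw q hq)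
      (image_subset_iff.2 fun p hp => hκ.mem_fiber p hp w hw)
  rw [fiberProd, hfiber, finprod_mem_image (hκ.injOn w hw), finprod_mem_coe_finset]

theorem mono (hκ : IsSheets S x V T κ) {V' : Set ℂ} (hsub : V' ⊆ V) :
    IsSheets S x V' T κ where
  isParametrization p hp :=
    ⟨fun w hw => (hκ.isParametrization p hp).mdifferentiableAt w (hsub hw),
      (hκ.isParametrization p hp).injOn.mono hsub⟩
  mem_fiber p hp w hw := hκ.mem_fiber p hp w (hsub hw)
  exists_eq w hw := hκ.exists_eq w (hsub hw)
  injOn w hw := hκ.injOn w (hsub hw)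

end IsSheets

namespace IsRealPair

variable {σ : X → X} {S : Set X} {x y : X → ℂ} (h : IsRealPair σ S x y)
include h

theorem snd_sheet_ne_zero {V : Set ℂ} {T : Finset X} {κ : X → ℂ → X}
    (hκ : IsSheets S x V T κ) {p : X} (hp : p ∈ T) {w : ℂ} (hw : w ∈ V) : y (κ p w) ≠ 0 :=
  h.snd_ne_zero (hκ.mem_fiber p hp w hw).1

variable [IsManifold 𝓘(ℂ) 1 X]

theorem differentiableAt_sheet {V : Set ℂ} {T : Finset X} {κ : X → ℂ → X}
    (hκ : IsSheets S x V T κ) {p : X} (hp : p ∈ T) {w : ℂ} (hw : w ∈ V) :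
    DifferentiableAt ℂ (fun w => y (κ p w)) w :=
  mdifferentiableAt_iff_differentiableAt.1
    ((h.snd_mdifferentiableAt (hκ.mem_fiber p hp w hw).1).comp w
      ((hκ.isParametrization p hp).mdifferentiableAt w hw))

theorem exists_isSheets_noncritical [CompactSpace X] [T2Space X] {w : ℂ}
    (hw : w ∈ strip \ criticalValues S x) :
    ∃ V, IsOpen V ∧ w ∈ V ∧ V ⊆ strip \ criticalValues S x ∧ ∃ (T : Finset X) (κ : X → ℂ → X),
      IsSheets S x V T κ := by
  obtain ⟨V, hV, hwV, hVs, T, κ, hκ⟩ := h.exists_isSheets hw.1 hw.2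
  have hV' := hV.sdiff h.finite_criticalValues.isClosed
  exact ⟨V \ criticalValues S x, hV', ⟨hwV, hw.2⟩, sdiff_le_sdiff_right hVs, T, κ,
    hκ.mono sdiff_subset⟩

theorem differentiableAt_fiberProd [CompactSpace X] [T2Space X] {w : ℂ}
    (hw : w ∈ strip \ criticalValues S x) : DifferentiableAt ℂ (fiberProd S x y) w := by
  obtain ⟨V, hV, hwV, -, T, κ, hκ⟩ := h.exists_isSheets_noncritical hw
  have hprod : DifferentiableAt ℂ (fun w => ∏ p ∈ T, y (κ p w)) w :=
    DifferentiableAt.fun_finsetProd fun p hp => h.differentiableAt_sheet hκ hp hwV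
  refine hprod.congr_of_eventuallyEq ?_
  filter_upwards [hV.mem_nhds hwV] with v hv using hκ.fiberProd_eq y hv

theorem fiberProd_ne_zero [CompactSpace X] (w : ℂ) : fiberProd S x y w ≠ 0 := by
  rw [fiberProd, finprod_mem_eq_finite_toFinset_prod _ (h.finite_fiber w)]
  exact Finset.prod_ne_zero_iff.2 fun q hq =>
    h.snd_ne_zero ((h.finite_fiber w).mem_toFinset.1 hq).1

theorem exists_log_fiberProd [CompactSpace X] [T2Space X] :
    ∃ F : ℂ → ℂ, DifferentiableOn ℂ F strip ∧
      ∀ w ∈ strip \ criticalValues S x, Complex.exp (F w) = fiberProd S x y w := by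
  obtain ⟨Y, hY, hY0, hYG⟩ := exists_differentiableOn_extension_ne_zero isOpen_strip
    h.finite_criticalValues
    (fun w hw => (h.differentiableAt_fiberProd hw).differentiableWithinAt)
    (fun w _ => h.fiberProd_ne_zero w) fun w hw => h.exists_eventually_norm_fiberProd_le hw
  have hne : strip.Nonempty := ⟨Complex.I, by simp [strip]; linarith [Real.pi_gt_three]⟩
  obtain ⟨F, hF, hFY⟩ := exists_differentiableOn_log isOpen_strip convex_strip hne hY hY0
  exact ⟨F, hF, fun w hw => (hFY w hw.1).trans (hYG hw)⟩

theorem deriv_log_fiberProd {F : ℂ → ℂ} (hF : DifferentiableOn ℂ F strip)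
    (hexp : ∀ w ∈ strip \ criticalValues S x, Complex.exp (F w) = fiberProd S x y w)
    {V : Set ℂ} {T : Finset X} {κ : X → ℂ → X} (hκ : IsSheets S x V T κ) (hV : IsOpen V)
    (hVs : V ⊆ strip \ criticalValues S x) {w : ℂ} (hw : w ∈ V) :
    deriv F w = ∑ p ∈ T, logDeriv (fun w => y (κ p w)) w := by
  have hFd := hF.differentiableAt (isOpen_strip.mem_nhds (hVs hw).1)
  have hprod : (fun w => Complex.exp (F w)) =ᶠ[𝓝 w] fun w => ∏ p ∈ T, y (κ p w) := by
    filter_upwards [hV.mem_nhds hw] with v hv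
    rw [hexp v (hVs hv), hκ.fiberProd_eq y hv]
  calc deriv F w = logDeriv (fun w => Complex.exp (F w)) w := by
        rw [logDeriv_apply, hFd.hasDerivAt.cexp.deriv,
          mul_div_cancel_left₀ _ (Complex.exp_ne_zero _)]
    _ = logDeriv (fun w => ∏ p ∈ T, y (κ p w)) w := by
        rw [logDeriv_apply, logDeriv_apply, hprod.deriv_eq, hprod.eq_of_nhds]
    _ = ∑ p ∈ T, logDeriv (fun w => y (κ p w)) w :=
        logDeriv_prod (fun p hp => h.snd_sheet_ne_zero hκ hp hw)
          fun p hp => h.differentiableAt_sheet hκ hp hw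

end IsRealPair

end LogFiberProd

section FiberIntegral

open scoped Function

/-- Over `V`, the integral of `g` against `ν` is the integral of `D` against `μ` on the part of `H`
above it, where `L : α → β` is the projection: this is integration along the fibers of `L`. -/
structure HasFiberIntegral {α β : Type*} [MeasurableSpace α] [MeasurableSpace β] (μ : Measure α)
    (ν : Measure β) (D : α → ℝ) (g : β → ℝ) (H : Set α) (L : α → β) (V : Set β) : Prop where
  integrableOn : ∀ E ⊆ V, MeasurableSet E → IntegrableOn g E ν
  measurableSet : ∀ E ⊆ V, MeasurableSet E → MeasurableSet (H ∩ L ⁻¹' E)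
  setIntegral_eq : ∀ E ⊆ V, MeasurableSet E →
    ∫ p in H ∩ L ⁻¹' E, D p ∂μ = ∫ w in E, g w ∂ν

namespace HasFiberIntegral

variable {α β : Type*} [MeasurableSpace α] [MeasurableSpace β] {μ : Measure α} {ν : Measure β}
  {D : α → ℝ} {g : β → ℝ} {H : Set α} {L : α → β} {V : Set β}

theorem mono (h : HasFiberIntegral μ ν D g H L V) {V' : Set β} (hV : V' ⊆ V) :
    HasFiberIntegral μ ν D g H L V' :=
  ⟨fun E hE => h.integrableOn E (hE.trans hV), fun E hE => h.measurableSet E (hE.trans hV),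
    fun E hE => h.setIntegral_eq E (hE.trans hV)⟩

theorem empty (μ : Measure α) (ν : Measure β) (D : α → ℝ) (g : β → ℝ) (H : Set α) (L : α → β) :
    HasFiberIntegral μ ν D g H L ∅ := by
  constructor <;> intro E hE _ <;> simp [subset_empty_iff.1 hE]

/-- Splitting `E` along the sign of `g` reduces this to the equality of integrals. -/
theorem setIntegral_norm_le (h : HasFiberIntegral μ ν D g H L V) (hD : Integrable D μ)
    (hg : Measurable g) {E : Set β} (hE : MeasurableSet E) (hEV : E ⊆ V) :
    ∫ w in E, ‖g w‖ ∂ν ≤ ∫ p in H ∩ L ⁻¹' E, ‖D p‖ ∂μ := by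
  set P := {w | 0 ≤ g w}
  have hP : MeasurableSet P := measurableSet_le measurable_const hg
  have hle : ∀ E' ⊆ V, MeasurableSet E' →
      |∫ w in E', g w ∂ν| ≤ ∫ p in H ∩ L ⁻¹' E', ‖D p‖ ∂μ := fun E' hE'V hE' => by
    rw [← h.setIntegral_eq E' hE'V hE']
    exact norm_integral_le_integral_norm (μ := μ.restrict (H ∩ L ⁻¹' E')) D
  have hpos : ∫ w in E ∩ P, ‖g w‖ ∂ν = ∫ w in E ∩ P, g w ∂ν :=
    setIntegral_congr_fun (hE.inter hP) fun w hw => Real.norm_of_nonneg hw.2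
  have hneg : ∫ w in E \ P, ‖g w‖ ∂ν = -∫ w in E \ P, g w ∂ν := by
    rw [← integral_neg]
    exact setIntegral_congr_fun (hE.diff hP) fun w hw =>
      Real.norm_of_nonpos (not_le.1 hw.2).le
  have hcompl : H ∩ L ⁻¹' (E \ P) = (H ∩ L ⁻¹' E) \ (H ∩ L ⁻¹' (E ∩ P)) := by
    ext p
    simp only [mem_inter_iff, mem_preimage, Set.mem_sdiff]
    tauto
  rw [← integral_inter_add_sdiff hP (h.integrableOn E hEV hE).norm, hpos, hneg,
    ← integral_inter_add_sdiff (h.measurableSet (E ∩ P) (inter_subset_left.trans hEV)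
      (hE.inter hP)) hD.norm.integrableOn,
    inter_eq_right.2 (inter_subset_inter_right _ (preimage_mono inter_subset_left)), ← hcompl]
  exact add_le_add
    ((le_abs_self _).trans (hle _ (inter_subset_left.trans hEV) (hE.inter hP)))
    ((neg_le_abs _).trans (hle _ (sdiff_subset.trans hEV) (hE.diff hP)))

theorem iUnion {V : ℕ → Set β} (h : ∀ n, HasFiberIntegral μ ν D g H L (V n))
    (hV : ∀ n, MeasurableSet (V n)) (hD : Integrable D μ) (hg : Measurable g) :
    HasFiberIntegral μ ν D g H L (⋃ n, V n) := by
  suffices hpieces : ∀ E ⊆ ⋃ n, V n, MeasurableSet E → IntegrableOn g E ν ∧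
      MeasurableSet (H ∩ L ⁻¹' E) ∧ ∫ p in H ∩ L ⁻¹' E, D p ∂μ = ∫ w in E, g w ∂ν from
    ⟨fun E hE hm => (hpieces E hE hm).1, fun E hE hm => (hpieces E hE hm).2.1,
      fun E hE hm => (hpieces E hE hm).2.2⟩
  intro E hE hEm
  set A : ℕ → Set β := fun n => E ∩ disjointed V n
  have hAV (n : ℕ) : A n ⊆ V n := inter_subset_right.trans (disjointed_subset V n)
  have hAm (n : ℕ) : MeasurableSet (A n) := hEm.inter (MeasurableSet.disjointed hV n)
  have hAd : Pairwise (Disjoint on A) := fun m n hmn =>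
    (disjoint_disjointed V hmn).mono inter_subset_right inter_subset_right
  have hAE : ⋃ n, A n = E := by rw [← inter_iUnion, iUnion_disjointed, inter_eq_left.2 hE]
  have hBm (n : ℕ) : MeasurableSet (H ∩ L ⁻¹' A n) := (h n).measurableSet _ (hAV n) (hAm n)
  have hBd : Pairwise (Disjoint on fun n => H ∩ L ⁻¹' A n) := fun m n hmn =>
    ((hAd hmn).preimage L).mono inter_subset_right inter_subset_right
  have hBE : ⋃ n, H ∩ L ⁻¹' A n = H ∩ L ⁻¹' E := by
    rw [← inter_iUnion, ← preimage_iUnion, hAE]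
  have hint : IntegrableOn g E ν := by
    rw [← hAE]
    exact integrableOn_iUnion_of_summable_integral_norm
      (fun n => (h n).integrableOn _ (hAV n) (hAm n)) <|
      Summable.of_nonneg_of_le (fun n => integral_nonneg fun _ => norm_nonneg _)
        (fun n => (h n).setIntegral_norm_le hD hg (hAm n) (hAV n))
        (hasSum_integral_iUnion hBm hBd hD.norm.integrableOn).summable
  refine ⟨hint, hBE ▸ MeasurableSet.iUnion hBm, ?_⟩
  have hsumD := hasSum_integral_iUnion hBm hBd hD.integrableOn
  have hsumg := hasSum_integral_iUnion hAm hAd (hAE.symm ▸ hint)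
  simp_rw [fun n => (h n).setIntegral_eq _ (hAV n) (hAm n)] at hsumD
  rw [← hBE, hsumD.unique hsumg, hAE]

theorem of_isOpen [TopologicalSpace β] [SecondCountableTopology β] [OpensMeasurableSpace β]
    (h : ∀ w ∈ V, ∃ W, IsOpen W ∧ w ∈ W ∧ HasFiberIntegral μ ν D g H L W)
    (hD : Integrable D μ) (hg : Measurable g) : HasFiberIntegral μ ν D g H L V := by
  rcases V.eq_empty_or_nonempty with rfl | ⟨w₀, hw₀⟩
  · exact empty μ ν D g H L
  have hW (w : V) : ∃ W, IsOpen W ∧ w.1 ∈ W ∧ HasFiberIntegral μ ν D g H L W := h w w.2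
  choose W hWo hwW hW using hW
  obtain ⟨t, htc, ht⟩ := TopologicalSpace.isOpen_iUnion_countable W hWo
  have hcover : V ⊆ ⋃ w ∈ t, W w := ht.symm ▸ fun w hw => mem_iUnion.2 ⟨⟨w, hw⟩, hwW _⟩
  obtain ⟨w₁, hw₁, -⟩ := mem_iUnion₂.1 (hcover hw₀)
  obtain ⟨f, rfl⟩ := htc.exists_eq_range ⟨w₁, hw₁⟩
  rw [biUnion_range] at hcover
  exact (iUnion (fun n => hW (f n)) (fun n => (hWo (f n)).measurableSet) hD hg).mono hcover

end HasFiberIntegral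

end FiberIntegral

section UpperHalf

/-- The part of `S` on which `x` takes values in the upper half plane. -/
def upperHalf {Y : Type*} (S : Set Y) (x : Y → ℂ) : Set Y := S ∩ {p | 0 < (x p).im}

omit [TopologicalSpace X] [ChartedSpace ℂ X] in
theorem mem_fiber_log {S : Set X} {x : X → ℂ} {q : X} (hq : q ∈ upperHalf S x) :
    q ∈ fiber S x (Complex.log (x q)) := by
  refine ⟨hq.1, (Complex.exp_log fun h0 => ?_).symm⟩
  have hpos : 0 < (x q).im := hq.2
  simp [h0] at hpos

omit [TopologicalSpace X] [ChartedSpace ℂ X] in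
theorem mem_upperHalf_of_mem_fiber {S : Set X} {x : X → ℂ} {w : ℂ} (hw : w ∈ strip) {q : X}
    (hq : q ∈ fiber S x w) : q ∈ upperHalf S x ∧ Complex.log (x q) = w := by
  refine ⟨⟨hq.1, ?_⟩, ?_⟩
  · simpa [hq.2] using exp_im_pos hw
  · rw [hq.2, log_exp_of_mem_strip hw]

namespace IsSheets

variable {S : Set X} {x : X → ℂ} {V : Set ℂ} {T : Finset X} {κ : X → ℂ → X}
  (hκ : IsSheets S x V T κ) (hV : V ⊆ strip) {E : Set ℂ} (hE : E ⊆ V)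
include hκ hV hE

theorem upperHalf_inter_preimage :
    upperHalf S x ∩ (fun q => Complex.log (x q)) ⁻¹' E = ⋃ p ∈ T, κ p '' E := by
  ext q
  simp only [mem_iUnion]
  constructor
  · rintro ⟨hq, hw⟩
    obtain ⟨p, hp, hpq⟩ := hκ.exists_eq _ (hE hw) q (mem_fiber_log hq)
    exact ⟨p, hp, _, hw, hpq⟩
  · rintro ⟨p, hp, w, hw, rfl⟩
    obtain ⟨hq, hlog⟩ := mem_upperHalf_of_mem_fiber (hV (hE hw)) (hκ.mem_fiber p hp w (hE hw))
    exact ⟨hq, by rwa [mem_preimage, hlog]⟩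

theorem pairwiseDisjoint_image : (T : Set X).PairwiseDisjoint fun p => κ p '' E := by
  intro p hp q hq hpq
  refine disjoint_left.2 ?_
  rintro _ ⟨w, hw, rfl⟩ ⟨w', hw', hww⟩
  have hlog := (mem_upperHalf_of_mem_fiber (hV (hE hw)) (hκ.mem_fiber p hp w (hE hw))).2
  have hlog' := (mem_upperHalf_of_mem_fiber (hV (hE hw')) (hκ.mem_fiber q hq w' (hE hw'))).2
  obtain rfl : w = w' := by rw [← hlog, ← hlog', hww]
  exact hpq (hκ.injOn w (hE hw) hp hq hww.symm)

end IsSheets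

namespace IsRealPair

variable {σ : X → X} {S : Set X} {x y : X → ℂ} (h : IsRealPair σ S x y) [IsManifold 𝓘(ℂ) 1 X]
include h

theorem wedgeDensity_sheet {V : Set ℂ} {T : Finset X} {κ : X → ℂ → X} (hκ : IsSheets S x V T κ)
    (hV : IsOpen V) {p : X} (hp : p ∈ T) {w : ℂ} (hw : w ∈ V) :
    wedgeDensity (fun w => Real.log ‖x (κ p w)‖) (fun w => Real.log ‖y (κ p w)‖) w =
      -(logDeriv (fun w => y (κ p w)) w).im := by
  have hexp : (fun w => Real.log ‖x (κ p w)‖) =ᶠ[𝓝 w] fun w => Real.log ‖Complex.exp w‖ := by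
    filter_upwards [hV.mem_nhds hw] with v hv
    rw [(hκ.mem_fiber p hp v hv).2]
  have hlogDeriv : logDeriv Complex.exp w = 1 := by
    rw [logDeriv_apply, (Complex.hasDerivAt_exp w).deriv, div_self (Complex.exp_ne_zero w)]
  rw [wedgeDensity_congr hexp EventuallyEq.rfl, wedgeDensity_log_norm
    Complex.differentiableAt_exp (Complex.exp_ne_zero w) (h.differentiableAt_sheet hκ hp hw)
    (h.snd_sheet_ne_zero hκ hp hw), hlogDeriv, one_mul, Complex.conj_im]

variable [CompactSpace X] [T2Space X] [MeasurableSpace X] [BorelSpace X] (Q : ChartPartition X)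

theorem integrable_areaDensity :
    Integrable (areaDensity Q (fun p => Real.log ‖x p‖) (fun p => Real.log ‖y p‖))
      (areaMeasure Q) :=
  QuantumIndex.integrable_areaDensity Q h.fst.normal.hasFiniteOrderAt h.snd.normal.hasFiniteOrderAt

theorem integrableOn_setIntegral_sheet {V : Set ℂ} {T : Finset X} {κ : X → ℂ → X}
    (hκ : IsSheets S x V T κ) (hV : IsOpen V) {p : X} (hp : p ∈ T) {E : Set ℂ}
    (hE : MeasurableSet E) (hEV : E ⊆ V) :
    IntegrableOn (fun w => -(logDeriv (fun w => y (κ p w)) w).im) E ∧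
    ∫ q in κ p '' E, areaDensity Q (fun p => Real.log ‖x p‖) (fun p => Real.log ‖y p‖) q
      ∂areaMeasure Q = ∫ w in E, -(logDeriv (fun w => y (κ p w)) w).im := by
  have hP := (finite_not_regularAt h.fst.normal.hasFiniteOrderAt).union
    (finite_not_regularAt h.snd.normal.hasFiniteOrderAt)
  have hu : ∀ q ∉ {p | ¬ RegularAt x p} ∪ {p | ¬ RegularAt y p},
      RealDifferentiableAt (fun p => Real.log ‖x p‖) q := fun q hq =>
    (not_not.1 fun hn => hq (Or.inl hn) : RegularAt x q).realDifferentiableAt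
  have hv : ∀ q ∉ {p | ¬ RegularAt x p} ∪ {p | ¬ RegularAt y p},
      RealDifferentiableAt (fun p => Real.log ‖y p‖) q := fun q hq =>
    (not_not.1 fun hn => hq (Or.inr hn) : RegularAt y q).realDifferentiableAt
  have hD := (h.integrable_areaDensity Q).integrableOn (s := κ p '' E)
  have hκp := hκ.isParametrization p hp
  have hdensity : EqOn _ _ E := fun w hw => h.wedgeDensity_sheet hκ hV hp (hEV hw)
  refine ⟨(integrableOn_congr_fun hdensity hE).1
    ((hκp.integrableOn_areaDensity_image_iff Q hP hu hv hE hEV).1 hD), ?_⟩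
  rw [hκp.setIntegral_areaDensity_image Q hP hu hv hE hEV hD, setIntegral_congr_fun hE hdensity]

variable {F : ℂ → ℂ} (hF : DifferentiableOn ℂ F strip)
  (hexp : ∀ w ∈ strip \ criticalValues S x, Complex.exp (F w) = fiberProd S x y w)
include hF hexp

theorem hasFiberIntegral_of_isSheets {V : Set ℂ} {T : Finset X} {κ : X → ℂ → X}
    (hκ : IsSheets S x V T κ) (hV : IsOpen V) (hVs : V ⊆ strip \ criticalValues S x) :
    HasFiberIntegral (areaMeasure Q) volume
      (areaDensity Q (fun p => Real.log ‖x p‖) (fun p => Real.log ‖y p‖))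
      (fun w => -(deriv F w).im) (upperHalf S x) (fun q => Complex.log (x q)) V := by
  have hVstrip : V ⊆ strip := hVs.trans sdiff_subset
  have hderiv : ∀ w ∈ V, -(deriv F w).im = ∑ p ∈ T, -(logDeriv (fun w => y (κ p w)) w).im :=
    fun w hw => by
      rw [h.deriv_log_fiberProd hF hexp hκ hV hVs hw, Complex.im_sum, Finset.sum_neg_distrib]
  have himage : ∀ E ⊆ V, MeasurableSet E → ∀ p ∈ T, MeasurableSet (κ p '' E) :=
    fun E hEV hE p hp => (hκ.isParametrization p hp).measurableSet_image hE hEV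
  refine ⟨fun E hEV hE => ?_, fun E hEV hE => ?_, fun E hEV hE => ?_⟩
  · exact (integrableOn_congr_fun (fun w hw => hderiv w (hEV hw)) hE).2
      (integrable_finsetSum T fun p hp =>
        (h.integrableOn_setIntegral_sheet Q hκ hV hp hE hEV).1)
  · rw [hκ.upperHalf_inter_preimage hVstrip hEV]
    exact T.measurableSet_biUnion (himage E hEV hE)
  · rw [hκ.upperHalf_inter_preimage hVstrip hEV,
      integral_biUnion_finset T (himage E hEV hE) (hκ.pairwiseDisjoint_image hVstrip hEV)
        fun p _ => (h.integrable_areaDensity Q).integrableOn,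
      setIntegral_congr_fun hE fun w hw => hderiv w (hEV hw),
      integral_finsetSum T fun p hp => (h.integrableOn_setIntegral_sheet Q hκ hV hp hE hEV).1]
    exact Finset.sum_congr rfl fun p hp =>
      (h.integrableOn_setIntegral_sheet Q hκ hV hp hE hEV).2

theorem hasFiberIntegral :
    HasFiberIntegral (areaMeasure Q) volume
      (areaDensity Q (fun p => Real.log ‖x p‖) (fun p => Real.log ‖y p‖))
      (fun w => -(deriv F w).im) (upperHalf S x) (fun q => Complex.log (x q))
      (strip \ criticalValues S x) := by
  refine .of_isOpen (fun w hw => ?_) (h.integrable_areaDensity Q)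
    (Complex.measurable_im.comp (measurable_deriv F)).neg
  obtain ⟨V, hV, hwV, hVs, T, κ, hκ⟩ := h.exists_isSheets_noncritical hw
  exact ⟨V, hV, hwV, h.hasFiberIntegral_of_isSheets Q hF hexp hκ hV hVs⟩

include Q in
theorem integrableOn_strip_im_deriv : IntegrableOn (fun w => (deriv F w).im) strip := by
  have hC := h.finite_criticalValues
  have hint := ((h.hasFiberIntegral Q hF hexp).integrableOn _ Subset.rfl
    (isOpen_strip.measurableSet.diff hC.measurableSet)).neg
  simpa only [Pi.neg_def, neg_neg] using
    hint.congr_set_ae (sdiff_null_ae_eq_self (hC.measure_zero volume)).symm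

theorem setIntegral_upperHalf :
    ∫ p in upperHalf S x,
      areaDensity Q (fun p => Real.log ‖x p‖) (fun p => Real.log ‖y p‖) p ∂areaMeasure Q =
      -∫ w in strip, (deriv F w).im := by
  have hC := h.finite_criticalValues
  have hfin : (⋃ w ∈ criticalValues S x, fiber S x w).Finite :=
    hC.biUnion fun w _ => h.finite_fiber _
  have hnull := areaMeasure_eq_zero_of_finite Q hfin hfin.measurableSet
  have hae : (upperHalf S x ∩ (fun q => Complex.log (x q)) ⁻¹' (strip \ criticalValues S x) :
      Set X) =ᵐ[areaMeasure Q] upperHalf S x := by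
    filter_upwards [compl_mem_ae_iff.2 hnull] with q hq
    refine propext ⟨fun hq' => hq'.1, fun hq' => ⟨hq', log_mem_strip hq'.2, fun hc => hq ?_⟩⟩
    exact mem_biUnion hc (mem_fiber_log hq')
  rw [← setIntegral_congr_set hae, (h.hasFiberIntegral Q hF hexp).setIntegral_eq _ Subset.rfl
    (isOpen_strip.measurableSet.diff hC.measurableSet), integral_neg,
    setIntegral_congr_set (sdiff_null_ae_eq_self (hC.measure_zero volume))]

end IsRealPair

end UpperHalf

section NullSets

theorem volume_im_eq_zero : volume {z : ℂ | z.im = 0} = 0 := by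
  have hker : LinearMap.ker Complex.imLm ≠ ⊤ := fun h => by
    have hI : Complex.I ∈ LinearMap.ker Complex.imLm := h ▸ Submodule.mem_top
    simp at hI
  exact Measure.addHaar_submodule volume _ hker

variable [IsManifold 𝓘(ℂ) 1 X] (Q : ChartPartition X)

theorem areaDensity_log_norm_eq_zero {x y : X → ℂ} {p : X} (hx : RegularAt x p)
    (hy : RegularAt y p) (h0 : mfderiv 𝓘(ℂ) 𝓘(ℂ) x p = 0) :
    areaDensity Q (fun p => Real.log ‖x p‖) (fun p => Real.log ‖y p‖) p = 0 := by
  obtain ⟨i, hi⟩ := Q.exists_mem_piece p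
  have hpi := Q.subset i hi
  have hdiff {g : X → ℂ} (hg : RegularAt g p) :=
    (mdifferentiableAt_iff_of_mem_atlas (Q.chart_mem i) hpi).1 hg.1
  have hne {g : X → ℂ} (hg : RegularAt g p) : g ((Q.chart i).symm (Q.chart i p)) ≠ 0 := by
    rw [(Q.chart i).left_inv hpi]
    exact hg.2
  rw [areaDensity_of_mem Q _ _ hi, wedgeDensity_log_norm (hdiff hx) (hne hx) (hdiff hy) (hne hy),
    logDeriv_apply, (mfderiv_eq_zero_iff_of_mem_atlas (Q.chart_mem i) hpi hx.1).1 h0]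
  simp

variable [T2Space X] [MeasurableSpace X] [BorelSpace X]

theorem IsParametrization.areaMeasure_image_eq_zero {κ : ℂ → X} {V T : Set ℂ}
    (hκ : IsParametrization κ V) (hT : MeasurableSet T) (hTV : T ⊆ V) (h0 : volume T = 0) :
    areaMeasure Q (κ '' T) = 0 := by
  rw [← Measure.restrict_eq_zero, areaMeasure_restrict Q (hκ.measurableSet_image hT hTV)]
  refine Finset.sum_eq_zero fun i _ => ?_
  have hnull : volume (Q.chart i '' (Q.piece i ∩ κ '' T)) = 0 := by
    rw [inter_comm, ← image_inter_preimage, ← image_comp]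
    refine addHaar_image_eq_zero_of_differentiableOn_of_addHaar_eq_zero volume (fun z hz => ?_)
      (measure_mono_null inter_subset_left h0)
    have hcomp := (mdifferentiableAt_atlas (Q.chart_mem i) (Q.subset i hz.2)).comp z
      (hκ.mdifferentiableAt z (hTV hz.1))
    exact ((mdifferentiableAt_iff_differentiableAt.1 hcomp).restrictScalars
      ℝ).differentiableWithinAt
  rw [Measure.restrict_eq_zero.2 hnull, Measure.map_zero]

end NullSets

section HalfArea

variable [IsManifold 𝓘(ℂ) 1 X] [T2Space X]

namespace IsRealPair

variable {σ : X → X} {S : Set X} {x y : X → ℂ} (h : IsRealPair σ S x y)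
include h

omit [IsManifold 𝓘(ℂ) 1 X] [T2Space X] in
theorem neg_fst : IsRealPair σ S (-x) y where
  continuous := h.continuous
  involutive := h.involutive
  isHalf := h.isHalf
  fst := h.fst.neg
  snd := h.snd
  isolated p := by
    filter_upwards [h.isolated p] with q hq
    rw [mfderiv_neg]
    exact neg_ne_zero.2 hq

variable [CompactSpace X] [MeasurableSpace X] [BorelSpace X] (Q : ChartPartition X)

/- Away from the critical points, the real locus of `x` is the image of a part of the real axis
under a local inverse of `x`. -/
theorem areaMeasure_real_eq_zero : areaMeasure Q (S ∩ {p | (x p).im = 0}) = 0 := by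
  have : SecondCountableTopology X := ChartedSpace.secondCountable_of_sigmaCompact ℂ X
  have hcrit : {p | mfderiv 𝓘(ℂ) 𝓘(ℂ) x p = 0}.Finite :=
    finite_of_eventually_nhdsNE fun p => by simpa using h.isolated p
  rw [← measure_sdiff_null (areaMeasure_eq_zero_of_finite Q hcrit hcrit.measurableSet)]
  refine measure_null_of_locally_null _ fun p hp => ?_
  have hderiv : deriv (chartRep x p) (chartAt ℂ p p) ≠ 0 := fun h0 => hp.2
    ((mfderiv_eq_zero_iff_of_mem_atlas (chart_mem_atlas ℂ p) (mem_chart_source ℂ p)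
      (h.fst_mdifferentiableAt hp.1.1)).2 h0)
  obtain ⟨Ψ, hΨ, hΨs, hΨx⟩ := exists_coordinate (h.fst_analyticAt hp.1.1) hderiv
    (chart_source_mem_nhds ℂ p)
  have hκ : IsParametrization Ψ.symm Ψ.target :=
    ⟨hΨ.mdifferentiableAt_symm, Ψ.symm.injOn⟩
  have hreal : MeasurableSet (Ψ.target ∩ {z | z.im = 0}) := Ψ.open_target.measurableSet.inter
    (measurableSet_eq_fun Complex.measurable_im measurable_const)
  refine ⟨Ψ.symm '' (Ψ.target ∩ {z | z.im = 0}), ?_, hκ.areaMeasure_image_eq_zero Q hreal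
    inter_subset_left (measure_mono_null inter_subset_right volume_im_eq_zero)⟩
  filter_upwards [mem_nhdsWithin_of_mem_nhds (Ψ.open_source.mem_nhds hΨ.mem_source),
    self_mem_nhdsWithin] with q hq hqS
  have hxq : Ψ q = x q := by
    rw [hΨx q, chartRep, (chartAt ℂ p).left_inv (hΨs hq)]
  exact ⟨Ψ q, ⟨Ψ.map_source hq, hxq ▸ hqS.1.2⟩, Ψ.left_inv hq⟩

theorem exists_setIntegral_upperHalf {α β α' β' : ℝ} (hbot : HasStripEnd S x y α β)
    (htop : HasStripEnd S (-x⁻¹) y α' β') :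
    ∃ n : ℤ, ∫ p in upperHalf S x,
      areaDensity Q (fun p => Real.log ‖x p‖) (fun p => Real.log ‖y p‖) p ∂areaMeasure Q =
      (α * (Real.pi ^ 2 / 2) + β * Real.pi) - (α' * (Real.pi ^ 2 / 2) + β' * Real.pi) +
        n * Real.pi ^ 2 := by
  obtain ⟨F, hF, hexp⟩ := h.exists_log_fiberProd
  obtain ⟨s, hs⟩ := (h.finite_criticalValues.image Complex.re).bddBelow
  obtain ⟨t, ht⟩ := (h.finite_criticalValues.image Complex.re).bddAbove
  have hreflect : ∀ w ∈ strip, Real.pi * Complex.I - w ∈ strip := fun w hw => by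
    constructor <;> simp <;> linarith [hw.1, hw.2]
  have hexp_bot : ∀ᶠ w in stripEnd, Complex.exp (F w) = fiberProd S x y w :=
    eventually_stripEnd_iff.2 ⟨s, fun w hw hws => hexp w ⟨hw, fun hc =>
      hws.not_ge (hs ⟨w, hc, rfl⟩)⟩⟩
  have hexp_top : ∀ᶠ w in stripEnd,
      Complex.exp (F (Real.pi * Complex.I - w)) = fiberProd S (-x⁻¹) y w := by
    refine eventually_stripEnd_iff.2 ⟨-t, fun w hw hwt => ?_⟩
    rw [fiberProd_neg_inv]
    refine hexp _ ⟨hreflect w hw, fun hc => ?_⟩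
    have hre := ht ⟨_, hc, rfl⟩
    simp only [Complex.sub_re, Complex.re_ofReal_mul, Complex.I_re, mul_zero] at hre
    linarith
  obtain ⟨n, hn⟩ := hbot.exists_tendsto_im hF.continuousOn hexp_bot
  obtain ⟨n', hn'⟩ := htop.exists_tendsto_im
    (hF.continuousOn.comp (by fun_prop) hreflect) hexp_top
  refine ⟨n - n', ?_⟩
  rw [h.setIntegral_upperHalf Q hF hexp,
    setIntegral_strip_im_deriv hF (h.integrableOn_strip_im_deriv Q hF hexp) hn hn']
  push_cast
  ring

theorem setIntegral_eq_add_upperHalf {D : X → ℝ} (hD : IntegrableOn D S (areaMeasure Q)) :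
    ∫ p in S, D p ∂areaMeasure Q = ∫ p in upperHalf S x, D p ∂areaMeasure Q +
      ∫ p in upperHalf S (-x), D p ∂areaMeasure Q := by
  have hsub (z : X → ℂ) : upperHalf S z ⊆ S := inter_subset_left
  have hcont : ContinuousOn (fun p => ((-x) p).im) S := fun p hp =>
    (Complex.continuous_im.continuousAt.comp
      (h.fst_mdifferentiableAt hp).continuousAt.neg).continuousWithinAt
  have hmeas : MeasurableSet (upperHalf S (-x)) :=
    (hcont.isOpen_inter_preimage h.isHalf.isOpen isOpen_Ioi).measurableSet
  have hdisj : Disjoint (upperHalf S x) (upperHalf S (-x)) := disjoint_left.2 fun p hp hp' => by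
    have hpos : 0 < (x p).im := hp.2
    have hneg : 0 < (-x p).im := hp'.2
    rw [Complex.neg_im] at hneg
    linarith
  have hae : S =ᵐ[areaMeasure Q] (upperHalf S x ∪ upperHalf S (-x) : Set X) := by
    filter_upwards [compl_mem_ae_iff.2 (h.areaMeasure_real_eq_zero Q)] with p hp
    refine propext ⟨fun hpS => ?_, fun hp' => hp'.elim (hsub x ·) (hsub (-x) ·)⟩
    rcases lt_trichotomy (x p).im 0 with hneg | hzero | hpos
    · exact Or.inr ⟨hpS, by simpa using hneg⟩
    · exact absurd ⟨hpS, hzero⟩ hp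
    · exact Or.inl ⟨hpS, hpos⟩
  rw [setIntegral_congr_set hae, setIntegral_union hdisj hmeas (hD.mono_set (hsub x))
    (hD.mono_set (hsub (-x)))]

theorem exists_setIntegral_eq : ∃ n : ℤ, ∫ p in S, areaDensity Q (fun p => Real.log ‖x p‖)
    (fun p => Real.log ‖y p‖) p ∂areaMeasure Q = n * (Real.pi ^ 2 / 2) := by
  obtain ⟨α, β, α₁, β₁, hbot, hbot₁, k, hk⟩ :=
    exists_hasStripEnd h.continuous h.involutive h.isHalf h.fst h.snd
  obtain ⟨α', β', α₁', β₁', htop, htop₁, k', hk'⟩ :=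
    exists_hasStripEnd h.continuous h.involutive h.isHalf h.fst.inv.neg h.snd
  rw [← inv_neg] at htop₁
  obtain ⟨n, hn⟩ := h.exists_setIntegral_upperHalf Q hbot htop
  obtain ⟨n₁, hn₁⟩ := h.neg_fst.exists_setIntegral_upperHalf Q hbot₁ htop₁
  simp only [Pi.neg_apply, norm_neg] at hn₁
  rw [h.setIntegral_eq_add_upperHalf Q (h.integrable_areaDensity Q).integrableOn, hn, hn₁]
  refine ⟨k - k' + 2 * n + 2 * n₁, ?_⟩
  push_cast
  linarith

end IsRealPair

variable [CompactSpace X] [MeasurableSpace X] [BorelSpace X] (Q : ChartPartition X)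

theorem exists_setIntegral_eq [ConnectedSpace X] {σ : X → X} {S : Set X}
    (hσ : Continuous σ) (hi : Function.Involutive σ) (hS : IsHalf σ S) {x y : X → ℂ}
    (hx : IsRealFunction σ x) (hy : IsRealFunction σ y) :
    ∃ n : ℤ, ∫ p in S, areaDensity Q (fun p => Real.log ‖x p‖)
      (fun p => Real.log ‖y p‖) p ∂areaMeasure Q = n * (Real.pi ^ 2 / 2) := by
  rcases hx.normal.mfderiv_dichotomy with hconst | hisolated
  · have hfin : ({p | ¬ RegularAt x p} ∪ {p | ¬ RegularAt y p} ∪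
        {p | ¬ mfderiv 𝓘(ℂ) 𝓘(ℂ) x p = 0}).Finite :=
      ((finite_not_regularAt hx.normal.hasFiniteOrderAt).union
        (finite_not_regularAt hy.normal.hasFiniteOrderAt)).union
        (finite_of_eventually_nhdsNE fun p => by simpa using hconst p)
    refine ⟨0, ?_⟩
    rw [Int.cast_zero, zero_mul]
    refine integral_eq_zero_of_ae (ae_restrict_of_ae ?_)
    filter_upwards [compl_mem_ae_iff.2 (areaMeasure_eq_zero_of_finite Q hfin hfin.measurableSet)]
      with p hp
    simp only [mem_compl_iff, mem_union, mem_ofPred_eq, not_or, not_not] at hp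
    exact areaDensity_log_norm_eq_zero Q hp.1.1 hp.1.2 hp.2
  · exact IsRealPair.exists_setIntegral_eq ⟨hσ, hi, hS, hx, hy, hisolated⟩ Q

end HalfArea

section Torus

variable {N' N : Type*} [AddCommGroup N'] [AddCommGroup N]

theorem monomial_ne_zero (m : Module.Dual ℤ N) (t : Torus N) : monomial m t ≠ 0 :=
  Units.ne_zero _

theorem monomial_tmul (m : Module.Dual ℤ N) (n : N) (z : Additive ℂˣ) :
    monomial m (n ⊗ₜ[ℤ] z) = (z.toMul : ℂ) ^ m n := by
  simp [monomial]

theorem monomial_zero (m : Module.Dual ℤ N) : monomial m (0 : Torus N) = 1 := by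
  simp [monomial]

theorem monomial_add (m : Module.Dual ℤ N) (s t : Torus N) :
    monomial m (s + t) = monomial m s * monomial m t := by
  simp [monomial]

theorem monomial_monomialMap (A : N' →ₗ[ℤ] N) (m : Module.Dual ℤ N) (t : Torus N') :
    monomial m (monomialMap A t) = monomial (m ∘ₗ A) t := by
  rw [monomial, monomial, monomialMap, LinearMap.rTensor_comp_apply]

theorem monomial_torusConj (m : Module.Dual ℤ N) (t : Torus N) :
    monomial m (torusConj t) = starRingEnd ℂ (monomial m t) := by
  induction t using TensorProduct.induction_on with
  | zero => simp [torusConj, monomial_zero]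
  | tmul n z =>
    rw [torusConj, LinearMap.lTensor_tmul, monomial_tmul, monomial_tmul, map_zpow₀]
    rfl
  | add s t hs ht =>
    rw [monomial_add, map_mul, ← hs, ← ht, ← monomial_add]
    simp [torusConj]

theorem torusConj_monomialMap (A : N' →ₗ[ℤ] N) (t : Torus N') :
    torusConj (monomialMap A t) = monomialMap A (torusConj t) := by
  have h := (LinearMap.lTensor_comp_rTensor _ A
    (MonoidHom.toAdditive (Units.map (starRingEnd ℂ : ℂ →* ℂ))).toIntLinearMap).trans
    (LinearMap.rTensor_comp_lTensor _ A _).symm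
  exact LinearMap.congr_fun h t

theorem logMap_monomialMap (A : N' →ₗ[ℤ] N) (t : Torus N') :
    logMap (monomialMap A t) = A.rTensor ℝ (logMap t) := by
  have h := (LinearMap.lTensor_comp_rTensor _ A logAbs.toIntLinearMap).trans
    (LinearMap.rTensor_comp_lTensor _ A _).symm
  exact LinearMap.congr_fun h t

theorem realCoord_rTensor (A : N' →ₗ[ℤ] N) (m : Module.Dual ℤ N) (v : N' ⊗[ℤ] ℝ) :
    realCoord m (A.rTensor ℝ v) = realCoord (m ∘ₗ A) v := by
  rw [realCoord, realCoord, LinearMap.rTensor_comp_apply]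

theorem realCoord_logMap (m : Module.Dual ℤ N) (t : Torus N) :
    realCoord m (logMap t) = Real.log ‖monomial m t‖ := by
  induction t using TensorProduct.induction_on with
  | zero => simp [realCoord, logMap, monomial_zero]
  | tmul n z =>
    rw [monomial_tmul, norm_zpow, Real.log_zpow]
    simp [realCoord, logMap, logAbs]
  | add s t hs ht =>
    rw [monomial_add, norm_mul, Real.log_mul (norm_ne_zero_iff.2 (monomial_ne_zero m s))
      (norm_ne_zero_iff.2 (monomial_ne_zero m t)), ← hs, ← ht]
    simp [realCoord, logMap]

theorem dual_apply_eq_sum {ι : Type*} [Fintype ι] (b : Module.Basis ι ℤ N) (m : N →ₗ[ℤ] ℤ)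
    (n : N) : m n = ∑ i, b.coord i n * m (b i) := by
  conv_lhs => rw [← b.sum_repr n, map_sum]
  simp

theorem realCoord_eq_sum {ι : Type*} [Fintype ι] (b : Module.Basis ι ℤ N) (m : Module.Dual ℤ N)
    (v : N ⊗[ℤ] ℝ) : realCoord m v = ∑ i, (m (b i) : ℝ) * realCoord (b.coord i) v := by
  induction v using TensorProduct.induction_on with
  | zero => simp [realCoord]
  | tmul n r =>
    simp only [realCoord, LinearMap.rTensor_tmul, TensorProduct.lid_tmul, zsmul_eq_mul]
    rw [dual_apply_eq_sum b m n]
    push_cast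
    rw [Finset.sum_mul]
    exact Finset.sum_congr rfl fun i _ => by ring
  | add s t hs ht =>
    have h (m : Module.Dual ℤ N) : realCoord m (s + t) = realCoord m s + realCoord m t := by
      simp [realCoord]
    simp only [h, mul_add, Finset.sum_add_distrib, ← hs, ← ht]

end Torus

section TwoForm

variable {N' N : Type*} [AddCommGroup N'] [AddCommGroup N]

theorem alternatingMap_eq_sum {ι : Type*} [Fintype ι] (b : Module.Basis ι ℤ N)
    (ϖ : N [⋀^Fin 2]→ₗ[ℤ] ℤ) (v w : N) :
    ϖ ![v, w] = ∑ i, ∑ j, b.coord i v * b.coord j w * ϖ ![b i, b j] := by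
  have hu0 (u v w : N) : Function.update ![v, w] 0 u = ![u, w] := by
    ext i
    fin_cases i <;> simp
  have hu1 (u v w : N) : Function.update ![v, w] 1 u = ![v, u] := by
    ext i
    fin_cases i <;> simp
  have h1 (v w : N) : ϖ ![v, w] = ∑ i, b.coord i v * ϖ ![b i, w] := by
    have h := dual_apply_eq_sum b (ϖ.toMultilinearMap.toLinearMap ![v, w] 0) v
    simpa [hu0] using h
  have h2 (v w : N) : ϖ ![v, w] = ∑ j, b.coord j w * ϖ ![v, b j] := by
    have h := dual_apply_eq_sum b (ϖ.toMultilinearMap.toLinearMap ![v, w] 1) w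
    simpa [hu1] using h
  rw [h1]
  refine Finset.sum_congr rfl fun i _ => ?_
  rw [h2, Finset.mul_sum]
  exact Finset.sum_congr rfl fun j _ => by ring

theorem alternatingMap_swap (ϖ : N [⋀^Fin 2]→ₗ[ℤ] ℤ) (v w : N) : ϖ ![w, v] = -ϖ ![v, w] := by
  have h := ϖ.map_swap ![v, w] (show (0 : Fin 2) ≠ 1 by decide)
  rw [← h]
  congr 1
  ext i
  fin_cases i <;> simp

theorem sum_sum_eq_sum_lt {ι M : Type*} [Fintype ι] [LinearOrder ι] [AddCommMonoid M]
    {t : ι → ι → M} (h0 : ∀ i, t i i = 0) :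
    ∑ i, ∑ j, t i j = ∑ k : ι × ι with k.1 < k.2, (t k.1 k.2 + t k.2 k.1) := by
  have hsplit (i j : ι) : t i j = (if i < j then t i j else 0) + if j < i then t i j else 0 := by
    rcases lt_trichotomy i j with h | rfl | h
    · simp [h, h.not_gt]
    · simp [h0]
    · simp [h, h.not_gt]
  rw [Finset.sum_congr rfl fun i _ => Finset.sum_congr rfl fun j _ => hsplit i j]
  simp_rw [Finset.sum_add_distrib]
  rw [Finset.sum_comm (f := fun i j => if j < i then t i j else 0)]
  simp only [← Finset.sum_add_distrib, Finset.sum_filter, Fintype.sum_prod_type]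

theorem pullbackDensity_eq_sum_wedgeDensity [Module.Free ℤ N] [Module.Finite ℤ N]
    [LinearOrder (Module.Free.ChooseBasisIndex ℤ N)] (ϖ : N [⋀^Fin 2]→ₗ[ℤ] ℤ)
    (F : ℂ → N ⊗[ℤ] ℝ) (z : ℂ) :
    let b := Module.Free.chooseBasis ℤ N
    pullbackDensity ϖ F z = ∑ k : _ × _ with k.1 < k.2, (ϖ ![b k.1, b k.2] : ℝ) *
      wedgeDensity (fun w => realCoord (b.coord k.1) (F w))
        (fun w => realCoord (b.coord k.2) (F w)) z := by
  intro b
  refine (sum_sum_eq_sum_lt fun i => ?_).trans (Finset.sum_congr rfl fun k _ => ?_)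
  · have hdiag : ϖ ![b i, b i] = 0 := ϖ.map_eq_zero_of_eq _ (i := 0) (j := 1) rfl (by decide)
    simp [b, hdiag]
  · rw [alternatingMap_swap ϖ (b k.1) (b k.2), wedgeDensity]
    push_cast
    ring

theorem compLinearMap_apply_eq_sum {ι κ : Type*} [Fintype ι] (b : Module.Basis ι ℤ N)
    (b' : κ → N') (A : N' →ₗ[ℤ] N) (ϖ : N [⋀^Fin 2]→ₗ[ℤ] ℤ) (i j : κ) :
    ϖ.compLinearMap A ![b' i, b' j] =
      ∑ k, ∑ l, b.coord k (A (b' i)) * b.coord l (A (b' j)) * ϖ ![b k, b l] := by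
  rw [← alternatingMap_eq_sum b, AlternatingMap.compLinearMap_apply]
  congr 1
  ext i
  fin_cases i <;> rfl

theorem fderiv_realCoord_comp {ι : Type*} [Fintype ι] (b : Module.Basis ι ℤ N)
    (m : Module.Dual ℤ N) {F : ℂ → N ⊗[ℤ] ℝ} {z : ℂ}
    (hF : ∀ i, DifferentiableAt ℝ (fun w => realCoord (b.coord i) (F w)) z) (t : ℂ) :
    fderiv ℝ (fun w => realCoord m (F w)) z t =
      ∑ i, (m (b i) : ℝ) * fderiv ℝ (fun w => realCoord (b.coord i) (F w)) z t := by
  simp_rw [realCoord_eq_sum b m]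
  rw [fderiv_fun_sum fun i _ => (hF i).const_mul _, sum_apply]
  refine Finset.sum_congr rfl fun i _ => ?_
  rw [fderiv_const_mul (hF i)]
  rfl

theorem sum_sum_bilinear_comp {ι κ R : Type*} [Fintype ι] [Fintype κ] [CommSemiring R]
    (a : κ → κ → R) (c : κ → ι → R) (p q : ι → R) :
    ∑ k, ∑ l, a k l * ((∑ i, c k i * p i) * ∑ j, c l j * q j) =
      ∑ i, ∑ j, (∑ k, ∑ l, c k i * c l j * a k l) * (p i * q j) := by
  simp_rw [Finset.sum_mul_sum, Finset.mul_sum, Finset.sum_mul]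
  rw [Finset.sum_congr rfl fun k _ => Finset.sum_comm, Finset.sum_comm]
  refine Finset.sum_congr rfl fun i _ => ?_
  rw [Finset.sum_congr rfl fun k _ => Finset.sum_comm, Finset.sum_comm]
  refine Finset.sum_congr rfl fun j _ => Finset.sum_congr rfl fun k _ =>
    Finset.sum_congr rfl fun l _ => ?_
  ring

theorem pullbackDensity_rTensor [Module.Free ℤ N'] [Module.Finite ℤ N'] [Module.Free ℤ N]
    [Module.Finite ℤ N] (A : N' →ₗ[ℤ] N) (ϖ : N [⋀^Fin 2]→ₗ[ℤ] ℤ) {F : ℂ → N' ⊗[ℤ] ℝ} {z : ℂ}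
    (hF : ∀ i, DifferentiableAt ℝ
      (fun w => realCoord ((Module.Free.chooseBasis ℤ N').coord i) (F w)) z) :
    pullbackDensity ϖ (fun w => A.rTensor ℝ (F w)) z =
      pullbackDensity (ϖ.compLinearMap A) F z := by
  have hcoord (k) (t : ℂ) := fderiv_realCoord_comp _
    ((Module.Free.chooseBasis ℤ N).coord k ∘ₗ A) hF t
  simp only [pullbackDensity, realCoord_rTensor, hcoord,
    compLinearMap_apply_eq_sum (Module.Free.chooseBasis ℤ N)]
  push_cast
  exact sum_sum_bilinear_comp _ _ _ _

end TwoForm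

variable {N' N : Type*} [AddCommGroup N'] [AddCommGroup N]

section Composition

variable (A : N' →ₗ[ℤ] N) {f : X → Torus N'}

theorem localMonomial_monomialMap (m : Module.Dual ℤ N) (p : X) :
    localMonomial (monomialMap A ∘ f) m p = localMonomial f (m ∘ₗ A) p :=
  funext fun _ => monomial_monomialMap A m _

theorem IsOrientedRealCurve.monomialMap_comp {σ : X → X} {S : Set X}
    (hf : IsOrientedRealCurve σ S f) : IsOrientedRealCurve σ S (monomialMap A ∘ f) where
  isRealStructure := hf.isRealStructure
  isHalf := hf.isHalf
  meromorphic m p := by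
    rw [localMonomial_monomialMap]
    exact hf.meromorphic _ p
  exists_punctures := by
    obtain ⟨P, hP, hσ, hd, hc⟩ := hf.exists_punctures
    refine ⟨P, hP, hσ, fun m p hp => ?_, fun p hp => ?_⟩
    · simp only [Function.comp_apply, monomial_monomialMap]
      exact hd _ p hp
    · rw [Function.comp_apply, Function.comp_apply, hc p hp, torusConj_monomialMap]

theorem IsCocharacterAt.monomialMap_comp {p : X} {n : N'} (h : IsCocharacterAt f p n) :
    IsCocharacterAt (monomialMap A ∘ f) p (A n) := fun m => by
  rw [localMonomial_monomialMap, h]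
  rfl

theorem HasDegree.monomialMap_comp {ι : Type*} {Δ : ι → N'} (h : HasDegree f Δ) :
    HasDegree (monomialMap A ∘ f) (A ∘ Δ) := by
  obtain ⟨p, h1, h2⟩ := h
  refine ⟨p, fun k => (h1 k).monomialMap_comp A, fun x hx => ?_⟩
  simpa using (h2 x hx).monomialMap_comp A

end Composition

theorem IsOrientedRealCurve.hasFiniteOrderAt {σ : X → X} {S : Set X} {f : X → Torus N}
    (hf : IsOrientedRealCurve σ S f) (m : Module.Dual ℤ N) (p : X) :
    HasFiniteOrderAt (fun q => monomial m (f q)) p :=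
  hasFiniteOrderAt_of_ne_zero (hf.meromorphic m p) fun q => monomial_ne_zero m (f q)

/-- The real function `log |χ^m ∘ f|` on the curve. -/
def logMonomial {Y : Type*} (f : Y → Torus N) (m : Module.Dual ℤ N) (p : Y) : ℝ :=
  Real.log ‖monomial m (f p)‖

theorem pullbackDensity_logMap_eq_sum {Y : Type*} [Module.Free ℤ N] [Module.Finite ℤ N]
    [LinearOrder (Module.Free.ChooseBasisIndex ℤ N)] (ϖ : N [⋀^Fin 2]→ₗ[ℤ] ℤ) (f : Y → Torus N)
    (κ : ℂ → Y) :
    let b := Module.Free.chooseBasis ℤ N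
    pullbackDensity ϖ (fun z => logMap (f (κ z))) = fun z =>
      ∑ k : _ × _ with k.1 < k.2, (ϖ ![b k.1, b k.2] : ℝ) *
        wedgeDensity (fun w => logMonomial f (b.coord k.1) (κ w))
          (fun w => logMonomial f (b.coord k.2) (κ w)) z := by
  ext z
  simp only [pullbackDensity_eq_sum_wedgeDensity, realCoord_logMap, logMonomial]

section LogArea

variable [IsManifold 𝓘(ℂ) 1 X] [MeasurableSpace X] [BorelSpace X]

section Independence

variable [T2Space X] (Q P : ChartPartition X) {u v : X → ℝ} {F : Set X} (hF : F.Finite)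
  (hu : ∀ q ∉ F, RealDifferentiableAt u q) (hv : ∀ q ∉ F, RealDifferentiableAt v q)
  (hD : Integrable (areaDensity Q u v) (areaMeasure Q)) {S : Set X} (hS : MeasurableSet S)
include hF hu hv hD hS

theorem integrableOn_wedgeDensity_of_integrable_areaDensity (i : Fin P.size) :
    IntegrableOn (wedgeDensity (fun z => u ((P.chart i).symm z))
      (fun z => v ((P.chart i).symm z))) (P.chart i '' (P.piece i ∩ S)) :=
  ((isParametrization_chart_symm (P.chart_mem i)).integrableOn_areaDensity_image_iff Q hF hu hv
    (P.measurableSet_image hS i) (P.image_inter_subset_target S i)).1 hD.integrableOn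

theorem sum_setIntegral_wedgeDensity_eq :
    ∑ i, ∫ z in P.chart i '' (P.piece i ∩ S), wedgeDensity (fun z => u ((P.chart i).symm z))
      (fun z => v ((P.chart i).symm z)) z = ∫ p in S, areaDensity Q u v p ∂areaMeasure Q := by
  have hcover : S = ⋃ i, P.piece i ∩ S := by rw [← iUnion_inter, P.covers, univ_inter]
  have himage (i : Fin P.size) :
      (P.chart i).symm '' (P.chart i '' (P.piece i ∩ S)) = P.piece i ∩ S :=
    (P.chart i).toPartialEquiv.symm_image_image_of_subset_source
      (inter_subset_left.trans (P.subset i))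
  conv_rhs => rw [hcover]
  rw [integral_iUnion_fintype (fun i => (P.measurableSet_piece i).inter hS)
    (fun i j hij => (P.disjoint hij).mono inter_subset_left inter_subset_left)
    fun i => hD.integrableOn]
  refine Finset.sum_congr rfl fun i _ => ?_
  rw [← (isParametrization_chart_symm (P.chart_mem i)).setIntegral_areaDensity_image Q hF hu hv
    (P.measurableSet_image hS i) (P.image_inter_subset_target S i) hD.integrableOn, himage]

end Independence

variable [CompactSpace X] {S : Set X} (hS : MeasurableSet S)
include hS

theorem hasLogArea_sum [T2Space X] {f : X → Torus N}
    (hf : ∀ m p, HasFiniteOrderAt (fun q => monomial m (f q)) p) (Q : ChartPartition X)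
    [Module.Free ℤ N] [Module.Finite ℤ N] [LinearOrder (Module.Free.ChooseBasisIndex ℤ N)]
    (ϖ : N [⋀^Fin 2]→ₗ[ℤ] ℤ) :
    let b := Module.Free.chooseBasis ℤ N
    HasLogArea S f ϖ (∑ k : _ × _ with k.1 < k.2, (ϖ ![b k.1, b k.2] : ℝ) *
      ∫ p in S, areaDensity Q (logMonomial f (b.coord k.1)) (logMonomial f (b.coord k.2)) p
        ∂areaMeasure Q) := by
  intro b P
  have hfin (m m' : Module.Dual ℤ N) := (finite_not_regularAt (hf m)).union
    (finite_not_regularAt (hf m'))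
  have hdiff (m m' : Module.Dual ℤ N) (q : X)
      (hq : q ∉ {p | ¬ RegularAt (fun q => monomial m (f q)) p} ∪
        {p | ¬ RegularAt (fun q => monomial m' (f q)) p}) :
      RealDifferentiableAt (logMonomial f m) q ∧ RealDifferentiableAt (logMonomial f m') q := by
    simp only [mem_union, mem_ofPred_eq, not_or, not_not] at hq
    exact ⟨hq.1.realDifferentiableAt, hq.2.realDifferentiableAt⟩
  have hD (m m' : Module.Dual ℤ N) :
      Integrable (areaDensity Q (logMonomial f m) (logMonomial f m')) (areaMeasure Q) :=
    integrable_areaDensity Q (hf m) (hf m')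
  have hint (i : Fin P.size) (k) := (integrableOn_wedgeDensity_of_integrable_areaDensity Q P
    (hfin _ _) (fun q hq => (hdiff _ _ q hq).1) (fun q hq => (hdiff _ _ q hq).2)
    (hD (b.coord (Prod.fst k)) (b.coord (Prod.snd k))) hS i).const_mul (ϖ ![b k.1, b k.2] : ℝ)
  simp_rw [pullbackDensity_logMap_eq_sum]
  refine ⟨fun i => integrable_finsetSum _ fun k _ => hint i k, ?_⟩
  rw [Finset.sum_congr rfl fun i _ => integral_finsetSum _ fun k _ => hint i k, Finset.sum_comm]
  refine Finset.sum_congr rfl fun k _ => ?_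
  simp_rw [integral_const_mul]
  rw [← Finset.mul_sum, sum_setIntegral_wedgeDensity_eq Q P (hfin _ _)
    (fun q hq => (hdiff _ _ q hq).1) (fun q hq => (hdiff _ _ q hq).2) (hD _ _) hS]

variable [Module.Free ℤ N] [Module.Finite ℤ N] [Module.Free ℤ N'] [Module.Finite ℤ N']

theorem HasLogArea.monomialMap_comp {f : X → Torus N'}
    (hf : ∀ m p, HasFiniteOrderAt (fun q => monomial m (f q)) p) (A : N' →ₗ[ℤ] N)
    {ϖ : N [⋀^Fin 2]→ₗ[ℤ] ℤ} {a : ℝ} (h : HasLogArea S f (ϖ.compLinearMap A) a) :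
    HasLogArea S (monomialMap A ∘ f) ϖ a := by
  intro P
  set b := Module.Free.chooseBasis ℤ N'
  have hfin : (⋃ i, {p | ¬ RegularAt (fun q => monomial (b.coord i) (f q)) p}).Finite :=
    finite_iUnion fun i => finite_not_regularAt (hf (b.coord i))
  have hae (k : Fin P.size) :
      pullbackDensity ϖ (fun z => logMap ((monomialMap A ∘ f) ((P.chart k).symm z)))
      =ᵐ[volume.restrict (P.chart k '' (P.piece k ∩ S))]
      pullbackDensity (ϖ.compLinearMap A) (fun z => logMap (f ((P.chart k).symm z))) := by
    filter_upwards [ae_restrict_mem (P.measurableSet_image hS k),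
      (isParametrization_chart_symm (P.chart_mem k)).ae_restrict_notMem
        (P.measurableSet_image hS k) (P.image_inter_subset_target S k) hfin] with z hz hreg
    obtain ⟨p, ⟨hp, -⟩, rfl⟩ := hz
    rw [(P.chart k).left_inv (P.subset k hp)] at hreg
    simp only [mem_iUnion, mem_ofPred_eq, not_exists, not_not] at hreg
    simp only [Function.comp_apply, logMap_monomialMap]
    refine pullbackDensity_rTensor A ϖ fun i => ?_
    simp only [realCoord_logMap]
    exact (hreg i).realDifferentiableAt _ (P.chart_mem k) (P.subset k hp)
  refine ⟨fun k => ((h P).1 k).congr (hae k).symm, ?_⟩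
  rw [← (h P).2]
  exact Finset.sum_congr rfl fun k _ => integral_congr_ae (hae k)

end LogArea

section RealIntersections

variable [T2Space X] [CompactSpace X] [IsManifold 𝓘(ℂ) 1 X] {σ : X → X} {S : Set X}
  {f : X → Torus N} (hf : IsOrientedRealCurve σ S f) (hreal : HasOnlyRealIntersections σ f)
include hf hreal

theorem IsOrientedRealCurve.isRealFunction_normalize_monomial (m : Module.Dual ℤ N) :
    IsRealFunction σ (normalize fun q => monomial m (f q)) where
  normal := isNormalMeromorphic_normalize (hf.hasFiniteOrderAt m)
  conj p := by
    obtain ⟨P, hP, -, -, hc⟩ := hf.exists_punctures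
    have hfin := finite_normalize_ne (hf.hasFiniteOrderAt m)
    filter_upwards [eventually_nhdsNE_of_finite hP p, eventually_nhdsNE_of_finite hfin p,
      eventually_nhdsNE_of_finite (hfin.preimage hf.isRealStructure.involutive.injective.injOn) p]
      with q hqP hq hσq
    simp only [mem_ofPred_eq, mem_preimage, not_not] at hq hσq
    rw [hq, hσq, hc q hqP, monomial_torusConj]
  ne_zero p hp := by
    have h0 : IsCocharacterAt f p 0 := not_not.1 fun hn => hp (hreal p hn)
    refine (isNormalMeromorphic_normalize (hf.hasFiniteOrderAt m)).ordAt_eq_zero_iff.1 ?_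
    rw [ordAt_normalize (hf.hasFiniteOrderAt m) p]
    exact (h0 m).trans (by simp)

theorem IsOrientedRealCurve.exists_setIntegral_eq [ConnectedSpace X] [MeasurableSpace X]
    [BorelSpace X] (Q : ChartPartition X) (m m' : Module.Dual ℤ N) :
    ∃ n : ℤ, ∫ p in S, areaDensity Q (logMonomial f m) (logMonomial f m') p ∂areaMeasure Q =
      n * (Real.pi ^ 2 / 2) := by
  obtain ⟨n, hn⟩ := QuantumIndex.exists_setIntegral_eq Q hf.isRealStructure.continuous
    hf.isRealStructure.involutive hf.isHalf (hf.isRealFunction_normalize_monomial hreal m)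
    (hf.isRealFunction_normalize_monomial hreal m')
  refine ⟨n, hn ▸ integral_congr_ae (ae_restrict_of_ae (areaDensity_ae_eq Q
    ((finite_normalize_ne (hf.hasFiniteOrderAt m)).union
      (finite_normalize_ne (hf.hasFiniteOrderAt m'))) (fun p hp => ?_) fun p hp => ?_))⟩
  all_goals
    simp only [mem_union, mem_ofPred_eq, not_or, not_not] at hp
  · rw [hp.1, logMonomial]
  · rw [hp.2, logMonomial]

end RealIntersections

theorem alternatingMapLinearEquiv_map (A : N' →ₗ[ℤ] N) (ϖ : N [⋀^Fin 2]→ₗ[ℤ] ℤ) (h : ⋀[ℤ]^2 N') :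
    exteriorPower.alternatingMapLinearEquiv ϖ (exteriorPower.map 2 A h) =
      exteriorPower.alternatingMapLinearEquiv (ϖ.compLinearMap A) h := by
  have hcomp : (exteriorPower.alternatingMapLinearEquiv ϖ).comp (exteriorPower.map 2 A) =
      exteriorPower.alternatingMapLinearEquiv (ϖ.compLinearMap A) := by
    refine exteriorPower.linearMap_ext ?_
    ext v
    simp only [LinearMap.compAlternatingMap_apply, LinearMap.comp_apply,
      exteriorPower.map_apply_ιMulti, exteriorPower.alternatingMapLinearEquiv_apply_ιMulti,
      AlternatingMap.compLinearMap_apply]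
    rfl
  exact LinearMap.congr_fun hcomp h

section Index

variable [Module.Free ℤ N] [Module.Finite ℤ N] {S : Set X} {f : X → Torus N}

theorem HasLogArea.hasLogArea_logArea {ϖ : N [⋀^Fin 2]→ₗ[ℤ] ℤ} {a : ℝ}
    (h : HasLogArea S f ϖ a) : HasLogArea S f ϖ (logArea S f ϖ) :=
  Classical.epsilon_spec ⟨a, h⟩

theorem HasLogArea.logArea_eq [CompactSpace X] {ϖ : N [⋀^Fin 2]→ₗ[ℤ] ℤ} {a : ℝ}
    (h : HasLogArea S f ϖ a) : logArea S f ϖ = a :=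
  h.hasLogArea_logArea.unique h

theorem IsQuantumIndex.unique {h h' : ⋀[ℤ]^2 N} (hh : IsQuantumIndex S f h)
    (hh' : IsQuantumIndex S f h') : h = h' := by
  rw [← sub_eq_zero, ← Module.forall_dual_apply_eq_zero_iff ℤ]
  intro φ
  have hφ := mul_left_cancel₀ (by positivity)
    ((hh (exteriorPower.alternatingMapLinearEquiv.symm φ)).symm.trans (hh' _))
  rw [LinearEquiv.apply_symm_apply] at hφ
  rw [map_sub, sub_eq_zero]
  exact_mod_cast hφ

theorem IsQuantumIndex.existsUnique {h : ⋀[ℤ]^2 N} (hh : IsQuantumIndex S f h) :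
    ∃! h, IsQuantumIndex S f h :=
  ⟨h, hh, fun _ hh' => hh'.unique hh⟩

theorem IsQuantumIndex.quantumIndex_eq {h : ⋀[ℤ]^2 N} (hh : IsQuantumIndex S f h) :
    quantumIndex S f = h :=
  IsQuantumIndex.unique (Classical.epsilon_spec ⟨h, hh⟩) hh

variable [T2Space X] [CompactSpace X] [IsManifold 𝓘(ℂ) 1 X] {σ : X → X}
  (hf : IsOrientedRealCurve σ S f)
include hf

theorem IsOrientedRealCurve.hasLogArea_logArea (ϖ : N [⋀^Fin 2]→ₗ[ℤ] ℤ) :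
    HasLogArea S f ϖ (logArea S f ϖ) := by
  classical
  let _ : MeasurableSpace X := borel X
  have : BorelSpace X := ⟨rfl⟩
  let _ : LinearOrder (Module.Free.ChooseBasisIndex ℤ N) := linearOrderOfSTO WellOrderingRel
  obtain ⟨Q⟩ := nonempty_chartPartition (X := X)
  exact (hasLogArea_sum hf.isHalf.isOpen.measurableSet hf.hasFiniteOrderAt Q ϖ).hasLogArea_logArea

theorem IsOrientedRealCurve.exists_isQuantumIndex [ConnectedSpace X]
    (hreal : HasOnlyRealIntersections σ f) : ∃ h, IsQuantumIndex S f h := by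
  classical
  let _ : MeasurableSpace X := borel X
  have : BorelSpace X := ⟨rfl⟩
  let _ : LinearOrder (Module.Free.ChooseBasisIndex ℤ N) := linearOrderOfSTO WellOrderingRel
  obtain ⟨Q⟩ := nonempty_chartPartition (X := X)
  let b := Module.Free.chooseBasis ℤ N
  choose n hn using fun i j => hf.exists_setIntegral_eq hreal Q (b.coord i) (b.coord j)
  refine ⟨∑ k : _ × _ with k.1 < k.2, n k.1 k.2 • exteriorPower.ιMulti ℤ 2 ![b k.1, b k.2],
    fun ϖ => ?_⟩
  rw [(hasLogArea_sum hf.isHalf.isOpen.measurableSet hf.hasFiniteOrderAt Q ϖ).logArea_eq,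
    map_sum, Int.cast_sum, Finset.mul_sum]
  refine Finset.sum_congr rfl fun k _ => ?_
  rw [hn, map_zsmul, exteriorPower.alternatingMapLinearEquiv_apply_ιMulti, zsmul_eq_mul]
  push_cast
  ring

end Index

section MonomialImage

variable [Module.Free ℤ N'] [Module.Finite ℤ N'] [Module.Free ℤ N] [Module.Finite ℤ N]
  [T2Space X] [CompactSpace X] [IsManifold 𝓘(ℂ) 1 X] {σ : X → X} {S : Set X} {f : X → Torus N'}
  (hf : IsOrientedRealCurve σ S f) (A : N' →ₗ[ℤ] N)
include hf

theorem IsOrientedRealCurve.logArea_monomialMap_comp (ϖ : N [⋀^Fin 2]→ₗ[ℤ] ℤ) :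
    logArea S (monomialMap A ∘ f) ϖ = logArea S f (ϖ.compLinearMap A) := by
  let _ : MeasurableSpace X := borel X
  have : BorelSpace X := ⟨rfl⟩
  exact ((hf.hasLogArea_logArea _).monomialMap_comp hf.isHalf.isOpen.measurableSet
    hf.hasFiniteOrderAt A).logArea_eq

theorem IsQuantumIndex.monomialMap_comp {h : ⋀[ℤ]^2 N'} (hh : IsQuantumIndex S f h) :
    IsQuantumIndex S (monomialMap A ∘ f) (exteriorPower.map 2 A h) := fun ϖ => by
  rw [hf.logArea_monomialMap_comp, hh, alternatingMapLinearEquiv_map]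

end MonomialImage

end QuantumIndex

end

open QuantumIndex in
theorem mainTheorem7
    {N' N : Type*} [AddCommGroup N'] [Module.Free ℤ N'] [Module.Finite ℤ N']
    [AddCommGroup N] [Module.Free ℤ N] [Module.Finite ℤ N]
    (A : N' →ₗ[ℤ] N)
    {X : Type*} [TopologicalSpace X] [T2Space X] [CompactSpace X] [ConnectedSpace X]
    [ChartedSpace ℂ X] [IsManifold 𝓘(ℂ) ω X]
    (σ : X → X) (S : Set X) (f : X → Torus N') (hf : IsOrientedRealCurve σ S f)
    {ι : Type*} [Finite ι] (Δ' : ι → N') (hΔ : HasDegree f Δ') :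
    IsOrientedRealCurve σ S (monomialMap A ∘ f) ∧
    HasDegree (monomialMap A ∘ f) (A ∘ Δ') ∧
    (HasOnlyRealIntersections σ f →
      (∃! h, IsQuantumIndex S f h) ∧
      (∃! h, IsQuantumIndex S (monomialMap A ∘ f) h) ∧
      quantumIndex S (monomialMap A ∘ f) = exteriorPower.map 2 A (quantumIndex S f)) ∧
    (∀ ϖ : N [⋀^Fin 2]→ₗ[ℤ] ℤ,
      HasLogArea S (monomialMap A ∘ f) ϖ (logArea S (monomialMap A ∘ f) ϖ) ∧
      HasLogArea S f (ϖ.compLinearMap A) (logArea S f (ϖ.compLinearMap A)) ∧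
      logArea S (monomialMap A ∘ f) ϖ = logArea S f (ϖ.compLinearMap A)) := by
  have : IsManifold 𝓘(ℂ) 1 X := IsManifold.of_le (n := ω) le_top
  have hAf : IsOrientedRealCurve σ S (monomialMap A ∘ f) := hf.monomialMap_comp A
  refine ⟨hAf, hΔ.monomialMap_comp A, fun hreal => ?_, fun ϖ =>
    ⟨hAf.hasLogArea_logArea ϖ, hf.hasLogArea_logArea _, hf.logArea_monomialMap_comp A ϖ⟩⟩
  obtain ⟨h, hh⟩ := hf.exists_isQuantumIndex hreal
  have hAh : IsQuantumIndex S (monomialMap A ∘ f) (exteriorPower.map 2 A h) :=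
    hh.monomialMap_comp hf A
  exact ⟨hh.existsUnique, hAh.existsUnique, by rw [hAh.quantumIndex_eq, hh.quantumIndex_eq]⟩
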